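/- **Setting.** Let $\Omega\subset\mathbb R^2$ be a bounded connected open set with Lipschitz boundary, let $T>0$, and let $\mathbb M^{2\times2}_{\rm sym}$ be the space of real symmetric $2\times2$ matrices with the scalar product $A:B={\rm tr}(A^TB)$, the norm $|A|=\sqrt{A:A}$ and the deviator $A_D=A-\tfrac12({\rm tr}A)\,{\rm Id}$. Let $\mathbb Ce=\lambda({\rm tr}\,e)\,{\rm Id}+2\mu e$ with $\mu>0$, $\lambda+\mu>0$; let $\alpha,\kappa>0$, $$K=\{\sigma\in\mathbb M^{2\times2}_{\rm sym}:\ |\sigma_D|+\alpha\,{\rm tr}\,\sigma\le\kappa\},\qquad H(q)=\sup_{\sigma\in K}\sigma:q\in[0,+\infty],$$ and let $\partial H$ be the subdifferential of $H$. Write $Ev=(Dv+Dv^T)/2$. For $\hat w\in H^1(\Omega;\mathbb R^2)$ let $\mathcal A_r(\hat w)$ be the set of all $(v,\eta,q)\in H^1(\Omega;\mathbb R^2)\times L^2(\Omega;\mathbb M^{2\times2}_{\rm sym})\times L^2(\Omega;\mathbb M^{2\times2}_{\rm sym})$ with $Ev=\eta+q$ a.e. in $\Omega$ and $v=\hat w$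 on $\partial\Omega$ in the sense of traces, i.e. $v-\hat w\in H^1_0(\Omega;\mathbb R^2)$. **Data.** Let $w\in AC([0,T];H^1(\Omega;\mathbb R^2))$, $f\in AC([0,T];L^2(\Omega;\mathbb R^2))$, $\chi\in AC([0,T];L^2(\Omega;\mathbb M^{2\times2}_{\rm sym}))$, and suppose that for some $\delta\in(0,\kappa)$ and every $t\in[0,T]$ $$-{\rm div}\,\chi(t)=f(t)\ \text{ in }\Omega,\qquad |\chi_D(t)|+\alpha\,{\rm tr}\,\chi(t)\le\kappa-\delta\ \text{ a.e. in }\Omega .$$ Let $\varepsilon>0$, and let $(u_{0,\varepsilon},e_0,p_{0,\varepsilon})\in\mathcal A_r(w(0))$ be such that $\sigma_0:=\mathbb Ce_0$ satisfies $\sigma_0(x)\in K$ for a.e. $x\in\Omega$ and $-{\rm div}\,\sigma_0=f(0)$ in $\Omega$. **Visco-plastic solution.** Let $u_\varepsilon\in AC([0,T];H^1(\Omega;\mathbb R^2))$ and $e_\varepsilon,p_\varepsilon\in AC([0,T];L^2(\Omega;\mathbb M^{2\times2}_{\rm sym}))$ be such that $(u_\varepsilon(0),e_\varepsilon(0),p_\varepsilon(0))=(u_{0,\varepsilon},e_0,p_{0,\varepsilon})$;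 for all $t\in[0,T]$ $$(u_\varepsilon(t),e_\varepsilon(t),p_\varepsilon(t))\in\mathcal A_r(w(t)),\qquad \sigma_\varepsilon(t)=\mathbb Ce_\varepsilon(t),\qquad -{\rm div}\,\sigma_\varepsilon(t)=f(t)\ \text{ in }\Omega;$$ and for a.e. $t\in[0,T]$ $$\sigma_\varepsilon(t)-\varepsilon\dot p_\varepsilon(t)\in\partial H(\dot p_\varepsilon(t))\quad\text{a.e. in }\Omega .$$ **Claim.** Assume in addition that $w\in H^1([0,T];H^2(\Omega;\mathbb R^2))$, $\chi\in W^{1,\infty}([0,T];L^\infty(\Omega;\mathbb M^{2\times2}_{\rm sym}))\cap H^1([0,T];H^1(\Omega;\mathbb M^{2\times2}_{\rm sym}))$, $f\in L^\infty(0,T;H^1(\Omega;\mathbb R^2))$ and $e_0\in H^1_{\rm loc}(\Omega;\mathbb M^{2\times2}_{\rm sym})$. Then $$\dot u_\varepsilon\in L^2(0,T;H^2_{\rm loc}(\Omega;\mathbb R^2)),\qquad e_\varepsilon,\ \sigma_\varepsilon\in H^1([0,T];H^1_{\rm loc}(\Omega;\mathbb M^{2\times2}_{\rm sym})),\qquad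 \dot p_\varepsilon\in L^2(0,T;H^1_{\rm loc}(\Omega;\mathbb M^{2\times2}_{\rm sym})).$$ Here $W^{1,\infty}([0,T];L^\infty)$ means bounded and Lipschitz continuous on $[0,T]$ with values in $L^\infty(\Omega)$, and a space of time-dependent functions with values in $H^k_{\rm loc}(\Omega)$ consists of the functions whose restriction to every open $\Omega'\subset\subset\Omega$ belongs to the same space with $H^k(\Omega')$ in place of $H^k_{\rm loc}(\Omega)$. -/

import Mathlib

open MeasureTheory Set Filter Topology
open scoped ENNReal NNReal ContDiff

noncomputable section

namespace Perzyna

/-! ### Vectors and matrices -/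

/-- The Euclidean plane. -/
abbrev Plane := EuclideanSpace ℝ (Fin 2)

/-- The `i`-th vector of the canonical basis of the plane. -/
def basisVec (i : Fin 2) : Plane := EuclideanSpace.single i 1

/-- Real symmetric `2 × 2` matrices, as a subspace of the matrices with the Frobenius scalar
product `A : B = ∑ i j, A i j * B i j = tr (Aᵀ B)`. -/
def symSubmodule : Submodule ℝ (EuclideanSpace ℝ (Fin 2 × Fin 2)) where
  carrier := {A | ∀ i j, A (i, j) = A (j, i)}
  add_mem' := by
    intro A B hA hB i j
    simp only [PiLp.add_apply, hA i j, hB i j]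
  zero_mem' := by
    intro i j
    simp
  smul_mem' := by
    intro c A hA i j
    simp only [PiLp.smul_apply, hA i j]

/-- The Euclidean space of real symmetric `2 × 2` matrices. -/
abbrev Sym2x2 := symSubmodule

/-- The entry `A i j`. -/
def entry (A : Sym2x2) (i j : Fin 2) : ℝ := (A : EuclideanSpace ℝ (Fin 2 × Fin 2)) (i, j)

/-- The symmetric part `(G + Gᵀ) / 2` of the matrix with entries `G i j`. -/
def symPart (G : Fin 2 → Fin 2 → ℝ) : Sym2x2 :=
  ⟨WithLp.toLp 2 (fun ij : Fin 2 × Fin 2 => (G ij.1 ij.2 + G ij.2 ij.1) / 2),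
    fun i j => by simp [add_comm]⟩

/-- The identity matrix. -/
def idMat : Sym2x2 := symPart (fun i j => if i = j then 1 else 0)

/-- The trace, as a (continuous) linear form. -/
def tr : Sym2x2 →L[ℝ] ℝ :=
  LinearMap.toContinuousLinearMap
    { toFun := fun A => ∑ i, entry A i i
      map_add' := fun A B => by simp [entry, Finset.sum_add_distrib]
      map_smul' := fun c A => by simp [entry, mul_add] }

/-- The deviatoric part `A - (1/2) (tr A) Id`. -/
def dev (A : Sym2x2) : Sym2x2 := A - ((1 / 2 : ℝ) * tr A) • idMat

/-- The isotropic elasticity tensor `ℂ e = lam (tr e) Id + 2 mu e`. -/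
def elasticity (lam mu : ℝ) : Sym2x2 →L[ℝ] Sym2x2 :=
  lam • tr.smulRight idMat + (2 * mu) • ContinuousLinearMap.id ℝ Sym2x2

/-- The Drucker-Prager elasticity set `{σ | |σ_D| + α tr σ ≤ κ}`. -/
def elasticitySet (α κ : ℝ) : Set Sym2x2 := {σ | ‖dev σ‖ + α * tr σ ≤ κ}

/-- The support function `H p = sup_{σ ∈ K} σ : p` of the elasticity set, with values in
`[0, +∞]`, seen in the extended reals. -/
def supportFun (α κ : ℝ) (p : Sym2x2) : EReal :=
  ⨆ σ ∈ elasticitySet α κ, ((inner ℝ σ p : ℝ) : EReal)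

/-- The subdifferential at `q` of an extended real valued function `F` (it is empty where
`F q = +∞`, as soon as `F` is finite somewhere). -/
def subdifferential (F : Sym2x2 → EReal) (q : Sym2x2) : Set Sym2x2 :=
  {τ | ∀ r, F q + ((inner ℝ τ (r - q) : ℝ) : EReal) ≤ F r}

/-! ### The reference configuration -/

/-- Lipschitz boundary: near each boundary point, up to an isometric change of coordinates, the
set is the open epigraph of a Lipschitz function of one variable. -/
def HasLipschitzBoundary (Ω : Set Plane) : Prop :=
  ∀ x₀ ∈ frontier Ω, ∃ (Φ : Plane ≃ᵢ Plane) (r : ℝ) (L : ℝ≥0) (γ : ℝ → ℝ),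
    0 < r ∧ LipschitzWith L γ ∧
      ∀ x ∈ Metric.ball x₀ r, x ∈ Ω ↔ γ (Φ x 0) < Φ x 1

/-- `Ω' ⊂⊂ Ω` for an open set `Ω'`. -/
def OpenCompactlyContained (Ω' Ω : Set Plane) : Prop :=
  IsOpen Ω' ∧ IsCompact (closure Ω') ∧ closure Ω' ⊆ Ω

/-! ### Lebesgue and Sobolev spaces in the plane -/

/-- The space `L²(Ω; Y)`. -/
abbrev L2 (Ω : Set Plane) (Y : Type) [NormedAddCommGroup Y] : Type :=
  Lp Y 2 (volume.restrict Ω)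

/-- `φ ∈ C_c^∞(Ω; Y)`. -/
def IsTestFunction {Y : Type} [NormedAddCommGroup Y] [NormedSpace ℝ Y]
    (Ω : Set Plane) (φ : Plane → Y) : Prop :=
  ContDiff ℝ ∞ φ ∧ HasCompactSupport φ ∧ tsupport φ ⊆ Ω

/-- The partial derivative `∂_i φ` of a smooth function. -/
def partialDeriv (i : Fin 2) (φ : Plane → ℝ) (x : Plane) : ℝ := fderiv ℝ φ x (basisVec i)

section Sobolev

variable {Y : Type} [NormedAddCommGroup Y] [InnerProductSpace ℝ Y]

/-- `g = ∂_i f` in `Ω` in the sense of distributions, for `f, g ∈ L²(Ω; Y)`. -/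
def IsWeakPartial (Ω : Set Plane) (i : Fin 2) (f g : L2 Ω Y) : Prop :=
  ∀ φ : Plane → ℝ, IsTestFunction Ω φ →
    ∫ x in Ω, partialDeriv i φ x • f x = - ∫ x in Ω, φ x • g x

theorem IsTestFunction.memLp {Ω : Set Plane} {φ : Plane → ℝ} (h : IsTestFunction Ω φ) :
    MemLp φ 2 (volume.restrict Ω) :=
  (h.1.continuous.memLp_of_hasCompactSupport h.2.1).restrict Ω

theorem IsTestFunction.memLp_partialDeriv {Ω : Set Plane} {φ : Plane → ℝ}
    (h : IsTestFunction Ω φ) (i : Fin 2) :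
    MemLp (partialDeriv i φ) 2 (volume.restrict Ω) := by
  have hc : Continuous (partialDeriv i φ) :=
    (h.1.continuous_fderiv (by simp)).clm_apply continuous_const
  have hs : HasCompactSupport (partialDeriv i φ) := h.2.1.fderiv_apply ℝ (basisVec i)
  exact (hc.memLp_of_hasCompactSupport hs).restrict Ω

/-- Integration against a fixed square integrable weight, as a continuous linear map. -/
def weightedIntegral [CompleteSpace Y] (Ω : Set Plane) (h : Plane → ℝ)
    (hh : MemLp h 2 (volume.restrict Ω)) : L2 Ω Y →L[ℝ] Y :=
  (ContinuousLinearMap.lsmul ℝ ℝ).lpPairing (volume.restrict Ω) 2 2 (hh.toLp h)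

theorem weightedIntegral_apply [CompleteSpace Y] (Ω : Set Plane) (h : Plane → ℝ)
    (hh : MemLp h 2 (volume.restrict Ω)) (f : L2 Ω Y) :
    weightedIntegral Ω h hh f = ∫ x in Ω, h x • f x := by
  rw [weightedIntegral, ContinuousLinearMap.lpPairing_eq_integral]
  refine integral_congr_ae ?_
  filter_upwards [hh.coeFn_toLp] with x hx
  simp [hx]

theorem isWeakPartial_iff [CompleteSpace Y] {Ω : Set Plane} {i : Fin 2} {f g : L2 Ω Y} :
    IsWeakPartial Ω i f g ↔ ∀ (φ : Plane → ℝ) (h : IsTestFunction Ω φ),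
      weightedIntegral Ω _ (h.memLp_partialDeriv i) f + weightedIntegral Ω _ h.memLp g = 0 := by
  simp only [weightedIntegral_apply, IsWeakPartial, eq_neg_iff_add_eq_zero]

variable [CompleteSpace Y]

/-- The space that contains `(f, ∂₁ f, ∂₂ f)` for `f ∈ H¹(Ω; Y)`. -/
abbrev H1Ambient (Ω : Set Plane) (Y : Type) [NormedAddCommGroup Y] : Type :=
  WithLp 2 (L2 Ω Y × PiLp 2 (fun _ : Fin 2 => L2 Ω Y))

/-- The Sobolev space `H¹(Ω; Y)`, as the space of all `f ∈ L²(Ω; Y)` together with their weak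
partial derivatives (which are unique) in `L²(Ω; Y)`; its norm is
`(‖f‖² + ‖∂₁ f‖² + ‖∂₂ f‖²)^(1/2)`. -/
def H1 (Ω : Set Plane) (Y : Type) [NormedAddCommGroup Y] [InnerProductSpace ℝ Y]
    [CompleteSpace Y] : Submodule ℝ (H1Ambient Ω Y) where
  carrier := {v | ∀ i, IsWeakPartial Ω i v.fst (v.snd i)}
  add_mem' := by
    intro v w hv hw i
    rw [isWeakPartial_iff]
    intro φ h
    have h1 := isWeakPartial_iff.1 (hv i) φ h
    have h2 := isWeakPartial_iff.1 (hw i) φ h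
    simp only [WithLp.add_fst, WithLp.add_snd, PiLp.add_apply, map_add]
    rw [add_add_add_comm, h1, h2, add_zero]
  zero_mem' := by
    intro i
    rw [isWeakPartial_iff]
    intro φ h
    simp
  smul_mem' := by
    intro c v hv i
    rw [isWeakPartial_iff]
    intro φ h
    have h1 := isWeakPartial_iff.1 (hv i) φ h
    simp only [WithLp.smul_fst, WithLp.smul_snd, PiLp.smul_apply, map_smul]
    rw [← smul_add, h1, smul_zero]

/-- The function `f` underlying an element of `H¹(Ω; Y)`. -/
def H1.fn {Ω : Set Plane} (v : H1 Ω Y) : L2 Ω Y := (v : H1Ambient Ω Y).fst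

/-- The weak partial derivative `∂_i f` of an element of `H¹(Ω; Y)`. -/
def H1.pd {Ω : Set Plane} (i : Fin 2) (v : H1 Ω Y) : L2 Ω Y := (v : H1Ambient Ω Y).snd i

theorem H1.continuous_fn {Ω : Set Plane} : Continuous (H1.fn : H1 Ω Y → L2 Ω Y) :=
  (WithLp.continuous_fst 2 _ _).comp continuous_subtype_val

theorem H1.continuous_pd {Ω : Set Plane} (i : Fin 2) :
    Continuous (H1.pd i : H1 Ω Y → L2 Ω Y) :=
  (PiLp.continuous_apply 2 _ i).comp ((WithLp.continuous_snd 2 _ _).comp continuous_subtype_val)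

theorem H1.isClosed {Ω : Set Plane} : IsClosed (H1 Ω Y : Set (H1Ambient Ω Y)) := by
  have : (H1 Ω Y : Set (H1Ambient Ω Y)) =
      ⋂ (i : Fin 2) (φ : Plane → ℝ) (h : IsTestFunction Ω φ),
        {v : H1Ambient Ω Y | weightedIntegral Ω _ (h.memLp_partialDeriv i) v.fst
          + weightedIntegral Ω _ h.memLp (v.snd i) = 0} := by
    ext v
    simp only [mem_iInter, mem_ofPred_eq]
    exact forall_congr' fun i => isWeakPartial_iff
  rw [this]
  refine isClosed_iInter fun i => isClosed_iInter fun φ => isClosed_iInter fun h => ?_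
  refine isClosed_eq ?_ continuous_const
  exact ((weightedIntegral Ω _ (h.memLp_partialDeriv i)).continuous.comp
      (WithLp.continuous_fst 2 _ _)).add
    ((weightedIntegral Ω _ h.memLp).continuous.comp
      ((PiLp.continuous_apply 2 _ i).comp (WithLp.continuous_snd 2 _ _)))

instance H1.instCompleteSpace {Ω : Set Plane} : CompleteSpace (H1 Ω Y) :=
  H1.isClosed.completeSpace_coe

/-- The space that contains `(f, ∂₁ f, ∂₂ f)`, with entries in `H¹(Ω; Y)`, for
`f ∈ H²(Ω; Y)`. -/
abbrev H2Ambient (Ω : Set Plane) (Y : Type) [NormedAddCommGroup Y] [InnerProductSpace ℝ Y]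
    [CompleteSpace Y] : Type :=
  WithLp 2 (H1 Ω Y × PiLp 2 (fun _ : Fin 2 => H1 Ω Y))

theorem H1.fn_add {Ω : Set Plane} (v w : H1 Ω Y) : H1.fn (v + w) = H1.fn v + H1.fn w := rfl

theorem H1.fn_smul {Ω : Set Plane} (c : ℝ) (v : H1 Ω Y) : H1.fn (c • v) = c • H1.fn v := rfl

theorem H1.pd_add {Ω : Set Plane} (i : Fin 2) (v w : H1 Ω Y) :
    H1.pd i (v + w) = H1.pd i v + H1.pd i w := rfl

theorem H1.pd_smul {Ω : Set Plane} (i : Fin 2) (c : ℝ) (v : H1 Ω Y) :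
    H1.pd i (c • v) = c • H1.pd i v := rfl

/-- The Sobolev space `H²(Ω; Y)`: all `f ∈ H¹(Ω; Y)` whose weak partial derivatives belong to
`H¹(Ω; Y)`; its norm is `(‖f‖² + ‖∂₁ f‖² + ‖∂₂ f‖²)^(1/2)` with norms of `H¹(Ω; Y)`. -/
def H2 (Ω : Set Plane) (Y : Type) [NormedAddCommGroup Y] [InnerProductSpace ℝ Y]
    [CompleteSpace Y] : Submodule ℝ (H2Ambient Ω Y) where
  carrier := {v | ∀ i, H1.fn (v.snd i) = H1.pd i v.fst}
  add_mem' := by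
    intro v w hv hw i
    simp only [WithLp.add_fst, WithLp.add_snd, PiLp.add_apply, H1.fn_add, H1.pd_add, hv i,
      hw i]
  zero_mem' := fun i => rfl
  smul_mem' := by
    intro c v hv i
    simp only [WithLp.smul_fst, WithLp.smul_snd, PiLp.smul_apply, H1.fn_smul, H1.pd_smul,
      hv i]

/-- An element of `H²(Ω; Y)` as an element of `H¹(Ω; Y)`. -/
def H2.fn {Ω : Set Plane} (v : H2 Ω Y) : H1 Ω Y := (v : H2Ambient Ω Y).fst

theorem H2.isClosed {Ω : Set Plane} : IsClosed (H2 Ω Y : Set (H2Ambient Ω Y)) := by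
  have : (H2 Ω Y : Set (H2Ambient Ω Y)) =
      ⋂ i : Fin 2, {v : H2Ambient Ω Y | H1.fn (v.snd i) = H1.pd i v.fst} := by
    ext v
    simp only [mem_iInter, mem_ofPred_eq]
    exact Iff.rfl
  rw [this]
  refine isClosed_iInter fun i => isClosed_eq ?_ ?_
  · exact H1.continuous_fn.comp
      ((PiLp.continuous_apply 2 _ i).comp (WithLp.continuous_snd 2 _ _))
  · exact (H1.continuous_pd i).comp (WithLp.continuous_fst 2 _ _)

instance H2.instCompleteSpace {Ω : Set Plane} : CompleteSpace (H2 Ω Y) :=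
  H2.isClosed.completeSpace_coe

/-- The space `H¹₀(Ω; Y)`: the closure of `C_c^∞(Ω; Y)` in `H¹(Ω; Y)`. For a bounded set with
Lipschitz boundary these are the functions with zero trace on the boundary. -/
def H10 (Ω : Set Plane) (Y : Type) [NormedAddCommGroup Y] [InnerProductSpace ℝ Y]
    [CompleteSpace Y] : Set (H1 Ω Y) :=
  closure {v | ∃ φ : Plane → Y, IsTestFunction Ω φ ∧ H1.fn v =ᵐ[volume.restrict Ω] φ}

/-- `f ∈ H¹_loc(Ω; Y)`, for `f ∈ L²(Ω; Y)`. -/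
def MemH1Loc (Ω : Set Plane) (f : L2 Ω Y) : Prop :=
  ∀ Ω', OpenCompactlyContained Ω' Ω →
    ∃ g : H1 Ω' Y, H1.fn g =ᵐ[volume.restrict Ω'] f

end Sobolev

/-! ### Functions of time with values in a function space -/

section Time

variable {X : Type} [NormedAddCommGroup X] [NormedSpace ℝ X]

/-- `f ∈ L^p(0,T; X)` (Bochner). -/
def MemLpTime (q : ℝ≥0∞) (T : ℝ) (f : ℝ → X) : Prop := MemLp f q (volume.restrict (Ioo 0 T))

/-- `f ∈ H¹([0,T]; X)`: `f` is on `[0,T]` the indefinite integral of some `g ∈ L²(0,T; X)`. -/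
def MemH1Time (T : ℝ) (f : ℝ → X) : Prop :=
  ∃ g : ℝ → X, MemLpTime 2 T g ∧ ∀ t ∈ Icc 0 T, f t = f 0 + ∫ s in (0 : ℝ)..t, g s

variable {Y : Type} [NormedAddCommGroup Y] [InnerProductSpace ℝ Y]

/-- `f ∈ W^{1,∞}([0,T]; L^∞(Ω; Y))`: the values of `f` are bounded in `L^∞(Ω; Y)` and `f` is
Lipschitz continuous on `[0,T]` for the norm of `L^∞(Ω; Y)`. -/
def MemW1InfLInf (Ω : Set Plane) (T : ℝ) (f : ℝ → L2 Ω Y) : Prop :=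
  ∃ C : ℝ≥0, (∀ t ∈ Icc 0 T, eLpNorm (f t) ∞ (volume.restrict Ω) ≤ C) ∧
    ∀ s ∈ Icc 0 T, ∀ t ∈ Icc 0 T,
      eLpNorm (f t - f s : L2 Ω Y) ∞ (volume.restrict Ω) ≤ C * ENNReal.ofReal |t - s|

variable [CompleteSpace Y]

/-- `f ∈ L^q(0,T; H¹(Ω; Y))`, for a function `f` with values in `L²(Ω; Y)`. -/
def MemLpTimeH1 (q : ℝ≥0∞) (Ω : Set Plane) (T : ℝ) (f : ℝ → L2 Ω Y) : Prop :=
  ∃ g : ℝ → H1 Ω Y, MemLpTime q T g ∧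
    ∀ᵐ t ∂volume.restrict (Ioo 0 T), H1.fn (g t) = f t

/-- `f ∈ H¹([0,T]; H¹(Ω; Y))`, for a function `f` with values in `L²(Ω; Y)`. -/
def MemH1TimeH1 (Ω : Set Plane) (T : ℝ) (f : ℝ → L2 Ω Y) : Prop :=
  ∃ g : ℝ → H1 Ω Y, MemH1Time T g ∧ ∀ t ∈ Icc 0 T, H1.fn (g t) = f t

/-- `f ∈ H¹([0,T]; H²(Ω; Y))`, for a function `f` with values in `H¹(Ω; Y)`. -/
def MemH1TimeH2 (Ω : Set Plane) (T : ℝ) (f : ℝ → H1 Ω Y) : Prop :=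
  ∃ g : ℝ → H2 Ω Y, MemH1Time T g ∧ ∀ t ∈ Icc 0 T, H2.fn (g t) = f t

/-- `f ∈ L²(0,T; H¹_loc(Ω; Y))`, for a function `f` with values in `L²(Ω; Y)`. -/
def MemL2TimeH1Loc (Ω : Set Plane) (T : ℝ) (f : ℝ → L2 Ω Y) : Prop :=
  ∀ Ω', OpenCompactlyContained Ω' Ω → ∃ g : ℝ → H1 Ω' Y, MemLpTime 2 T g ∧
    ∀ᵐ t ∂volume.restrict (Ioo 0 T), H1.fn (g t) =ᵐ[volume.restrict Ω'] f t

/-- `f ∈ L²(0,T; H²_loc(Ω; Y))`, for a function `f` with values in `L²(Ω; Y)`. -/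
def MemL2TimeH2Loc (Ω : Set Plane) (T : ℝ) (f : ℝ → L2 Ω Y) : Prop :=
  ∀ Ω', OpenCompactlyContained Ω' Ω → ∃ g : ℝ → H2 Ω' Y, MemLpTime 2 T g ∧
    ∀ᵐ t ∂volume.restrict (Ioo 0 T), H1.fn (H2.fn (g t)) =ᵐ[volume.restrict Ω'] f t

/-- `f ∈ H¹([0,T]; H¹_loc(Ω; Y))`, for a function `f` with values in `L²(Ω; Y)`. -/
def MemH1TimeH1Loc (Ω : Set Plane) (T : ℝ) (f : ℝ → L2 Ω Y) : Prop :=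
  ∀ Ω', OpenCompactlyContained Ω' Ω → ∃ g : ℝ → H1 Ω' Y, MemH1Time T g ∧
    ∀ t ∈ Icc 0 T, H1.fn (g t) =ᵐ[volume.restrict Ω'] f t

end Time

/-! ### The visco-plastic model -/

/-- `div τ = g` in `Ω` in the sense of distributions. -/
def HasWeakDiv (Ω : Set Plane) (τ : L2 Ω Sym2x2) (g : L2 Ω Plane) : Prop :=
  ∀ φ : Plane → ℝ, IsTestFunction Ω φ → ∀ i : Fin 2,
    ∫ x in Ω, ∑ j, entry (τ x) i j * partialDeriv j φ x = - ∫ x in Ω, g x i * φ x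

/-- The symmetrized gradient `E v = (Dv + Dvᵀ) / 2`. -/
def symGrad {Ω : Set Plane} (v : H1 Ω Plane) (x : Plane) : Sym2x2 :=
  symPart (fun i j => H1.pd j v x i)

/-- The stress `σ = ℂ e`. -/
def stress {Ω : Set Plane} (lam mu : ℝ) (e : L2 Ω Sym2x2) : L2 Ω Sym2x2 :=
  (elasticity lam mu).compLp e

/-- The space `𝒜_r(ŵ)` of kinematically admissible fields: `E v = η + q` a.e. in `Ω` and `v = ŵ`
on the boundary of `Ω`. -/
def IsAdmissible (Ω : Set Plane) (w v : H1 Ω Plane) (η q : L2 Ω Sym2x2) : Prop :=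
  (∀ᵐ x ∂volume.restrict Ω, symGrad v x = η x + q x) ∧ v - w ∈ H10 Ω Plane

/-- Body load with the safe-load condition: `-div χ(t) = f(t)` and
`|χ_D(t)| + α tr χ(t) ≤ κ - δ` for all `t ∈ [0,T]`, for some `δ ∈ (0,κ)`. -/
def IsSafeLoad (Ω : Set Plane) (T α κ : ℝ) (f : ℝ → L2 Ω Plane) (χ : ℝ → L2 Ω Sym2x2) : Prop :=
  ∃ δ ∈ Ioo 0 κ, ∀ t ∈ Icc 0 T, HasWeakDiv Ω (χ t) (-f t) ∧
    ∀ᵐ x ∂volume.restrict Ω, ‖dev (χ t x)‖ + α * tr (χ t x) ≤ κ - δ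

/-- The triple `(u, e, p)` is a solution of the Perzyna visco-plastic model with viscosity `ε`,
boundary displacement `w`, body load `f` and initial datum `(u₀, e₀, p₀)`. The time derivative of
`p` is the derivative of a function with values in the Hilbert space `L²(Ω; 𝕄)`. -/
structure IsViscoplasticSolution (Ω : Set Plane) (T lam mu α κ ε : ℝ)
    (w : ℝ → H1 Ω Plane) (f : ℝ → L2 Ω Plane)
    (u₀ : H1 Ω Plane) (e₀ p₀ : L2 Ω Sym2x2)
    (u : ℝ → H1 Ω Plane) (e p : ℝ → L2 Ω Sym2x2) : Prop where
  ac_u : AbsolutelyContinuousOnInterval u 0 T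
  ac_e : AbsolutelyContinuousOnInterval e 0 T
  ac_p : AbsolutelyContinuousOnInterval p 0 T
  init_u : u 0 = u₀
  init_e : e 0 = e₀
  init_p : p 0 = p₀
  admissible : ∀ t ∈ Icc 0 T, IsAdmissible Ω (w t) (u t) (e t) (p t)
  equilibrium : ∀ t ∈ Icc 0 T, HasWeakDiv Ω (stress lam mu (e t)) (-f t)
  flow_rule : ∀ᵐ t ∂volume.restrict (Ioo 0 T), ∀ᵐ x ∂volume.restrict Ω,
    stress lam mu (e t) x - ε • (deriv p t) x ∈
      subdifferential (supportFun α κ) ((deriv p t) x)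

end Perzyna

end

open Perzyna

open MeasureTheory Set Filter Topology
open scoped ENNReal NNReal ContDiff

noncomputable section

namespace Perzyna

/-! The proof is a difference quotient argument in space, closed by Grönwall's inequality in time.
Let `v`, `e'`, `q` be the time derivatives of the displacement, of the elastic strain and of the
plastic strain. At almost every time `E v = e' + q`, the field `ℂ e' - χ'` has no divergence, `v -
w'` vanishes on the boundary, and the flow rule links `q` to the stress `σ = ℂ e`.

The flow rule is a monotone inclusion perturbed by `ε q`, so `q` is pointwise a Lipschitz function
of `σ` with constant `1/ε` (`norm_sub_le_of_flowRule`). For a cut-off `η` and the difference `Δ`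
along a coordinate direction with step `h`, this gives `‖η Δ q‖ ≤ (‖ℂ‖/ε) ‖η Δ e‖`. On the other
hand, at a fixed time `v` solves an elliptic system. Testing it with the discrete analogue of a
second derivative of `v`, localized by `η²`, gives `‖η Δ e'‖ ≤ K (‖η Δ χ'‖ + ‖η Δ q‖ + h ‖v‖)`
(`interior_estimate`). The same `η` stands on both sides, so no domain is lost, and together the two
bounds read `‖η Δ e'‖ ≤ h m(t) + A ‖η Δ e‖` with `m` square integrable in time. Grönwall's
inequality, started from `e₀` in `H¹_loc`, bounds `‖η Δ e‖` by a multiple of `h`, and then the same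
follows for `e'` and `q` (`IsRate.exists_quotient_bound`).

Weak compactness turns such bounds into weak derivatives (`exists_isWeakPartial_of_diffOp_le`), and
measurability in time is recovered because a continuous injection of Polish spaces has a measurable
left inverse (`exists_aestronglyMeasurable_lift`). Since `E v = e' + q` is then locally of class
`H¹`, and second derivatives of `v` are combinations of first derivatives of `E v`, the velocity is
locally of class `H²` (`exists_H2_of_symGradLp`).

Two preliminaries make the rates available: absolutely continuous curves in a separable Hilbert
space are indefinite integrals, and the inequalities of Korn and Poincaré bound the rates in `L²` in
time (`global_estimate`, `IsRate.memLpTime`). -/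

/-! ### Operators on the square integrable functions of the plane -/

/-- The space `L²(ℝ²; Y)`. -/
abbrev LR (Y : Type) [NormedAddCommGroup Y] : Type := Lp Y 2 (volume : Measure Plane)

/-! ### Calculus of test functions. -/

section TestFunctions

variable {Ω : Set Plane} {φ ψ : Plane → ℝ}

theorem IsTestFunction.mono {Ω' : Set Plane} (h : IsTestFunction Ω φ) (hΩ : Ω ⊆ Ω') :
    IsTestFunction Ω' φ :=
  ⟨h.1, h.2.1, h.2.2.trans hΩ⟩

theorem IsTestFunction.toUniv (h : IsTestFunction Ω φ) : IsTestFunction univ φ :=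
  h.mono (subset_univ _)

theorem IsTestFunction.differentiable (h : IsTestFunction Ω φ) : Differentiable ℝ φ :=
  h.1.differentiable (by simp)

theorem tsupport_partialDeriv_subset (i : Fin 2) (φ : Plane → ℝ) :
    tsupport (partialDeriv i φ) ⊆ tsupport φ :=
  tsupport_fderiv_apply_subset ℝ (basisVec i)

theorem IsTestFunction.pd (h : IsTestFunction Ω φ) (i : Fin 2) :
    IsTestFunction Ω (partialDeriv i φ) :=
  ⟨(h.1.fderiv_right (m := ∞) (by simp)).clm_apply contDiff_const,
    h.2.1.fderiv_apply ℝ (basisVec i), (tsupport_partialDeriv_subset i φ).trans h.2.2⟩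

theorem IsTestFunction.mul (h : IsTestFunction Ω φ) {Ω' : Set Plane} (h' : IsTestFunction Ω' ψ) :
    IsTestFunction (Ω ∩ Ω') (fun x => φ x * ψ x) :=
  ⟨h.1.mul h'.1, h.2.1.mul_right, subset_inter ((tsupport_mul_subset_left).trans h.2.2)
    ((tsupport_mul_subset_right).trans h'.2.2)⟩

theorem partialDeriv_mul (hφ : Differentiable ℝ φ) (hψ : Differentiable ℝ ψ) (i : Fin 2)
    (x : Plane) : partialDeriv i (fun x => φ x * ψ x) x =
      φ x * partialDeriv i ψ x + ψ x * partialDeriv i φ x := by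
  simp [partialDeriv, fderiv_fun_mul (hφ x) (hψ x)]

theorem partialDeriv_comp_add_right (φ : Plane → ℝ) (a : Plane) (i : Fin 2) (x : Plane) :
    partialDeriv i (fun y => φ (y + a)) x = partialDeriv i φ (x + a) := by
  simp [partialDeriv, fderiv_comp_add_right]

theorem IsTestFunction.comp_add_right (h : IsTestFunction univ φ) (a : Plane) :
    IsTestFunction univ (fun x => φ (x + a)) :=
  ⟨h.1.comp (contDiff_id.add contDiff_const),
    h.2.1.comp_homeomorph (Homeomorph.addRight a), subset_univ _⟩

theorem IsTestFunction.memLp_top (h : IsTestFunction Ω φ) :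
    MemLp φ ∞ (volume : Measure Plane) :=
  h.1.continuous.memLp_of_hasCompactSupport h.2.1

theorem IsTestFunction.memLp_two (h : IsTestFunction Ω φ) :
    MemLp φ 2 (volume : Measure Plane) :=
  h.1.continuous.memLp_of_hasCompactSupport h.2.1

theorem norm_basisVec (i : Fin 2) : ‖basisVec i‖ = 1 := by
  simp [basisVec]

end TestFunctions

/-! ### Extension, restriction, cut-off, translation and difference operators. -/

section Operators

variable {Y : Type} [NormedAddCommGroup Y] [InnerProductSpace ℝ Y]
variable {Z : Type} [NormedAddCommGroup Z] [InnerProductSpace ℝ Z]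

/-- The extension of a function by zero. -/
def extFun {Ω : Set Plane} (hΩ : MeasurableSet Ω) (f : L2 Ω Y) : LR Y :=
  ((memLp_indicator_iff_restrict hΩ).2 (Lp.memLp f)).toLp (Ω.indicator f)

theorem coeFn_extFun {Ω : Set Plane} (hΩ : MeasurableSet Ω) (f : L2 Ω Y) :
    extFun hΩ f =ᵐ[volume] Ω.indicator f :=
  MemLp.coeFn_toLp _

theorem norm_extFun {Ω : Set Plane} (hΩ : MeasurableSet Ω) (f : L2 Ω Y) :
    ‖extFun hΩ f‖ = ‖f‖ := by
  rw [extFun, Lp.norm_toLp, eLpNorm_indicator_eq_eLpNorm_restrict hΩ, Lp.norm_def]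

/-- Extension by zero, as a continuous linear map. -/
def ext {Ω : Set Plane} (hΩ : MeasurableSet Ω) : L2 Ω Y →L[ℝ] LR Y :=
  LinearMap.mkContinuous
    { toFun := extFun hΩ
      map_add' := fun f g => by
        rw [extFun, extFun, extFun, ← MemLp.toLp_add]
        refine MemLp.toLp_congr _ _ ?_
        have := (ae_restrict_iff' hΩ).1 (Lp.coeFn_add f g)
        filter_upwards [this] with x hx
        by_cases hxΩ : x ∈ Ω
        · simp only [indicator_of_mem hxΩ, Pi.add_apply]
          exact hx hxΩ
        · simp [hxΩ]
      map_smul' := fun c f => by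
        rw [RingHom.id_apply, extFun, extFun, ← MemLp.toLp_const_smul]
        refine MemLp.toLp_congr _ _ ?_
        have := (ae_restrict_iff' hΩ).1 (Lp.coeFn_smul c f)
        filter_upwards [this] with x hx
        by_cases hxΩ : x ∈ Ω
        · simp only [indicator_of_mem hxΩ, Pi.smul_apply]
          exact hx hxΩ
        · simp [hxΩ] }
    1 (fun f => by
      rw [one_mul]
      exact (norm_extFun hΩ f).le)

theorem coeFn_ext {Ω : Set Plane} (hΩ : MeasurableSet Ω) (f : L2 Ω Y) :
    ext hΩ f =ᵐ[volume] Ω.indicator f :=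
  coeFn_extFun hΩ f

theorem norm_ext {Ω : Set Plane} (hΩ : MeasurableSet Ω) (f : L2 Ω Y) : ‖ext hΩ f‖ = ‖f‖ :=
  norm_extFun hΩ f

/-- Restriction to a subset. -/
def rest (Ω : Set Plane) : LR Y →L[ℝ] L2 Ω Y := LpToLpRestrictCLM Plane Y ℝ volume 2 Ω

theorem coeFn_rest (Ω : Set Plane) (f : LR Y) : rest Ω f =ᵐ[volume.restrict Ω] f :=
  LpToLpRestrictCLM_coeFn ℝ Ω f

theorem norm_rest_le (Ω : Set Plane) (f : LR Y) : ‖rest Ω f‖ ≤ ‖f‖ :=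
  norm_Lp_toLp_restrict_le Ω f

/-- Multiplication by a test function. -/
def mulOp {Ω : Set Plane} {φ : Plane → ℝ} (h : IsTestFunction Ω φ) : LR Y →L[ℝ] LR Y :=
  (ContinuousLinearMap.lsmul ℝ ℝ).holderL volume ∞ 2 2 (h.memLp_top.toLp φ)

theorem coeFn_mulOp {Ω : Set Plane} {φ : Plane → ℝ} (h : IsTestFunction Ω φ) (f : LR Y) :
    mulOp h f =ᵐ[volume] fun x => φ x • f x := by
  have h1 := (ContinuousLinearMap.lsmul ℝ ℝ).coeFn_holder (r := 2) (h.memLp_top.toLp φ) f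
  filter_upwards [h1, h.memLp_top.coeFn_toLp] with x hx1 hx2
  change ((ContinuousLinearMap.holder 2 (ContinuousLinearMap.lsmul ℝ ℝ) _ f : LR Y) : Plane → Y) x
    = _
  rw [hx1, hx2]
  rfl

theorem measurePreserving_add_const (a : Plane) :
    MeasurePreserving (fun x : Plane => x + a) volume volume :=
  measurePreserving_add_right volume a

/-- Translation `f ↦ f(· + a)`. -/
def tau (a : Plane) : LR Y →L[ℝ] LR Y :=
  (Lp.compMeasurePreservingₗᵢ ℝ _ (measurePreserving_add_const a)).toContinuousLinearMap

theorem coeFn_tau (a : Plane) (f : LR Y) : tau a f =ᵐ[volume] fun x => f (x + a) :=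
  Lp.coeFn_compMeasurePreserving f (measurePreserving_add_const a)

theorem norm_tau (a : Plane) (f : LR Y) : ‖tau a f‖ = ‖f‖ :=
  LinearIsometry.norm_map _ f

/-- Strong continuity of translations makes curves of translates integrable in `L²` and lets
mollified pairings converge in `sum_inner_eq_zero_of_hasWPD`. -/
theorem continuous_tau (f : LR Y) : Continuous (fun a : Plane => tau a f) := by
  have hc : Continuous (fun a : Plane => (⟨fun x => x + a, by fun_prop⟩ : C(Plane, Plane))) :=
    ContinuousMap.continuous_of_continuous_uncurry _
      (by simp only [Function.uncurry_def, ContinuousMap.coe_mk]; fun_prop)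
  exact continuous_const.compMeasurePreservingLp hc
    (fun a => measurePreserving_add_const a) (by simp)

theorem tau_zero (f : LR Y) : tau 0 f = f := by
  apply Lp.ext
  filter_upwards [coeFn_tau 0 f] with x hx
  rw [hx, add_zero]

theorem tau_tau (a b : Plane) (f : LR Y) : tau a (tau b f) = tau (a + b) f := by
  apply Lp.ext
  have h1 := (measurePreserving_add_const a).quasiMeasurePreserving.ae (coeFn_tau b f)
  filter_upwards [coeFn_tau a (tau b f), coeFn_tau (a + b) f, h1] with x hx hx' h1
  rw [hx, hx', h1, add_assoc]

/-- The difference operator `f ↦ f(· + a) - f`. -/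
def diffOp (a : Plane) : LR Y →L[ℝ] LR Y := tau a - ContinuousLinearMap.id ℝ _

theorem diffOp_apply (a : Plane) (f : LR Y) : diffOp a f = tau a f - f := rfl

theorem coeFn_diffOp (a : Plane) (f : LR Y) :
    diffOp a f =ᵐ[volume] fun x => f (x + a) - f x := by
  filter_upwards [Lp.coeFn_sub (tau a f) f, coeFn_tau a f] with x h1 h2
  rw [diffOp_apply, h1, Pi.sub_apply, h2]

/-- Pointwise application of a linear map. -/
def mapOp (L : Y →L[ℝ] Z) : LR Y →L[ℝ] LR Z := L.compLpL 2 volume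

theorem coeFn_mapOp (L : Y →L[ℝ] Z) (f : LR Y) : mapOp L f =ᵐ[volume] fun x => L (f x) :=
  L.coeFn_compLpL f

theorem mapOp_mulOp (L : Y →L[ℝ] Z) {Ω : Set Plane} {φ : Plane → ℝ} (h : IsTestFunction Ω φ)
    (f : LR Y) : mapOp L (mulOp h f) = mulOp h (mapOp L f) := by
  apply Lp.ext
  filter_upwards [coeFn_mapOp L (mulOp h f), coeFn_mulOp h f, coeFn_mulOp h (mapOp L f),
    coeFn_mapOp L f] with x h1 h2 h3 h4
  rw [h1, h2, h3, h4, map_smul]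

theorem mapOp_tau (L : Y →L[ℝ] Z) (a : Plane) (f : LR Y) :
    mapOp L (tau a f) = tau a (mapOp L f) := by
  apply Lp.ext
  have h5 := (measurePreserving_add_const a).quasiMeasurePreserving.ae (coeFn_mapOp L f)
  filter_upwards [coeFn_mapOp L (tau a f), coeFn_tau a f, coeFn_tau a (mapOp L f), h5]
    with x h1 h2 h3 h4
  rw [h1, h2, h3, h4]

theorem mapOp_diffOp (L : Y →L[ℝ] Z) (a : Plane) (f : LR Y) :
    mapOp L (diffOp a f) = diffOp a (mapOp L f) := by
  rw [diffOp_apply, diffOp_apply, map_sub, mapOp_tau]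

theorem mapOp_ext (L : Y →L[ℝ] Z) {Ω : Set Plane} (hΩ : MeasurableSet Ω) (f : L2 Ω Y) :
    mapOp L (ext hΩ f) = ext hΩ (L.compLp f) := by
  apply Lp.ext
  have h4 := (ae_restrict_iff' hΩ).1 (L.coeFn_compLp f)
  filter_upwards [coeFn_mapOp L (ext hΩ f), coeFn_ext hΩ f, coeFn_ext hΩ (L.compLp f), h4]
    with x h1 h2 h3 h4
  rw [h1, h2, h3]
  by_cases hx : x ∈ Ω <;> simp [hx, h4]

theorem mulOp_comm {Ω Ω' : Set Plane} {φ ψ : Plane → ℝ} (h : IsTestFunction Ω φ)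
    (h' : IsTestFunction Ω' ψ) (f : LR Y) : mulOp h (mulOp h' f) = mulOp h' (mulOp h f) := by
  apply Lp.ext
  filter_upwards [coeFn_mulOp h (mulOp h' f), coeFn_mulOp h' (mulOp h f), coeFn_mulOp h f,
    coeFn_mulOp h' f] with x h1 h2 h3 h4
  rw [h1, h2, h3, h4, smul_comm]

theorem inner_mulOp {Ω : Set Plane} {φ : Plane → ℝ} (h : IsTestFunction Ω φ) (f g : LR Y) :
    inner ℝ (mulOp h f) g = inner ℝ f (mulOp h g) := by
  rw [L2.inner_def, L2.inner_def]
  refine integral_congr_ae ?_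
  filter_upwards [coeFn_mulOp h f, coeFn_mulOp h g] with x h1 h2
  rw [h1, h2, real_inner_smul_left, real_inner_smul_right]

theorem inner_tau (a : Plane) (f g : LR Y) :
    inner ℝ (tau a f) g = inner ℝ f (tau (-a) g) := by
  have h : inner ℝ (tau a f) (tau a (tau (-a) g)) = inner ℝ f (tau (-a) g) :=
    LinearIsometry.inner_map_map
      (Lp.compMeasurePreservingₗᵢ ℝ _ (measurePreserving_add_const a)) f (tau (-a) g)
  rwa [tau_tau, add_neg_cancel, tau_zero] at h

end Operators

/-! ### Weak partial derivatives in the plane -/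

section WeakDerivatives

variable {Y : Type} [NormedAddCommGroup Y] [InnerProductSpace ℝ Y]

theorem IsTestFunction.integrable_smul {Ω : Set Plane} {φ : Plane → ℝ} (h : IsTestFunction Ω φ)
    {μ : Measure Plane} [IsFiniteMeasureOnCompacts μ] (f : Lp Y 2 μ) :
    Integrable (fun x => φ x • f x) μ :=
  memLp_one_iff_integrable.1 <| MemLp.smul (p := 2) (q := 2) (Lp.memLp f)
    (h.1.continuous.memLp_of_hasCompactSupport h.2.1)

/-- Integration of a square integrable function of the plane against a test function. -/
def pairOp [CompleteSpace Y] {Ω : Set Plane} {φ : Plane → ℝ} (h : IsTestFunction Ω φ) :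
    LR Y →L[ℝ] Y :=
  (ContinuousLinearMap.lsmul ℝ ℝ).lpPairing volume 2 2 (h.memLp_two.toLp φ)

theorem pairOp_apply [CompleteSpace Y] {Ω : Set Plane} {φ : Plane → ℝ} (h : IsTestFunction Ω φ)
    (f : LR Y) : pairOp h f = ∫ x, φ x • f x := by
  rw [pairOp, ContinuousLinearMap.lpPairing_eq_integral]
  refine integral_congr_ae ?_
  filter_upwards [h.memLp_two.coeFn_toLp] with x hx
  simp [hx]

theorem eq_of_pairOp_eq [CompleteSpace Y] {f g : LR Y}
    (h : ∀ (φ : Plane → ℝ) (hφ : IsTestFunction univ φ), pairOp hφ f = pairOp hφ g) : f = g := by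
  apply Lp.ext
  refine ae_eq_of_integral_contDiff_smul_eq ((Lp.memLp f).locallyIntegrable (by norm_num))
    ((Lp.memLp g).locallyIntegrable (by norm_num)) fun φ h1 h2 => ?_
  have hφ : IsTestFunction univ φ := ⟨h1, h2, subset_univ _⟩
  rw [← pairOp_apply hφ, ← pairOp_apply hφ, h φ hφ]

/-- `G = ∂_i F` in the plane in the sense of distributions. -/
def HasWPD (i : Fin 2) (F G : LR Y) : Prop :=
  ∀ φ : Plane → ℝ, IsTestFunction univ φ →
    ∫ x, partialDeriv i φ x • F x = - ∫ x, φ x • G x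

theorem hasWPD_iff [CompleteSpace Y] {i : Fin 2} {F G : LR Y} :
    HasWPD i F G ↔ ∀ (φ : Plane → ℝ) (h : IsTestFunction univ φ),
      pairOp (h.pd i) F + pairOp h G = 0 := by
  simp only [pairOp_apply, HasWPD, eq_neg_iff_add_eq_zero]

theorem HasWPD.sub [CompleteSpace Y] {i : Fin 2} {F G F' G' : LR Y} (h : HasWPD i F G)
    (h' : HasWPD i F' G') : HasWPD i (F - F') (G - G') := by
  rw [hasWPD_iff] at *
  intro φ hφ
  have h1 := h φ hφ
  have h2 := h' φ hφ
  rw [map_sub, map_sub, sub_add_sub_comm, h1, h2, sub_zero]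

theorem integral_smul_tau (φ : Plane → ℝ) (a : Plane) (F : LR Y) :
    ∫ x, φ x • tau a F x = ∫ x, φ (x - a) • F x := by
  rw [← integral_add_right_eq_self (fun x => φ (x - a) • F x) a]
  refine integral_congr_ae ?_
  filter_upwards [coeFn_tau a F] with x hx
  rw [hx, add_sub_cancel_right]

theorem HasWPD.tau {i : Fin 2} {F G : LR Y} (h : HasWPD i F G) (a : Plane) :
    HasWPD i (tau a F) (tau a G) := by
  intro φ hφ
  rw [integral_smul_tau, integral_smul_tau]
  have := h _ (hφ.comp_add_right (-a))
  simp only [partialDeriv_comp_add_right] at this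
  simpa only [sub_eq_add_neg] using this

theorem HasWPD.diffOp [CompleteSpace Y] {i : Fin 2} {F G : LR Y} (h : HasWPD i F G)
    (a : Plane) : HasWPD i (diffOp a F) (diffOp a G) :=
  (h.tau a).sub h

theorem HasWPD.mulOp {i : Fin 2} {F G : LR Y} (h : HasWPD i F G)
    {Ω : Set Plane} {ψ : Plane → ℝ} (hψ : IsTestFunction Ω ψ) :
    HasWPD i (mulOp hψ F) (mulOp hψ G + mulOp (hψ.pd i) F) := by
  intro φ hφ
  have h1 := h _ ((hφ.mul hψ).mono (subset_univ _))
  have e1 : ∫ x, partialDeriv i φ x • Perzyna.mulOp hψ F x =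
      ∫ x, (partialDeriv i (fun x => φ x * ψ x) x • F x - (φ x * partialDeriv i ψ x) • F x) := by
    refine integral_congr_ae ?_
    filter_upwards [coeFn_mulOp hψ F] with x hx
    rw [hx, partialDeriv_mul hφ.differentiable hψ.differentiable, ← sub_smul, smul_smul]
    congr 1; ring
  have e2 : ∫ x, φ x • (Perzyna.mulOp hψ G + Perzyna.mulOp (hψ.pd i) F : LR Y) x =
      ∫ x, ((φ x * ψ x) • G x + (φ x * partialDeriv i ψ x) • F x) := by
    refine integral_congr_ae ?_
    filter_upwards [coeFn_mulOp hψ G, coeFn_mulOp (hψ.pd i) F,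
      Lp.coeFn_add (Perzyna.mulOp hψ G) (Perzyna.mulOp (hψ.pd i) F)] with x hx1 hx2 hx3
    rw [hx3, Pi.add_apply, hx1, hx2, smul_add, smul_smul, smul_smul]
  have i1 := ((hφ.mul hψ).pd i).integrable_smul F
  have i2 := (hφ.mul (hψ.pd i)).integrable_smul F
  have i3 := (hφ.mul hψ).integrable_smul G
  rw [e1, e2, integral_sub i1 i2, integral_add i3 i2, h1]
  abel

/-- The product of a function with a weak partial derivative in an open set and a cut-off function
has a weak partial derivative in the plane. -/
theorem IsWeakPartial.hasWPD {Ω : Set Plane} (hΩ : MeasurableSet Ω) {i : Fin 2} {f g : L2 Ω Y}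
    (h : IsWeakPartial Ω i f g) {ψ : Plane → ℝ} (hψ : IsTestFunction Ω ψ) :
    HasWPD i (mulOp hψ (ext hΩ f)) (mulOp hψ (ext hΩ g) + mulOp (hψ.pd i) (ext hΩ f)) := by
  intro φ hφ
  have hφψ : IsTestFunction Ω (fun x => φ x * ψ x) := (hφ.mul hψ).mono inter_subset_right
  have hφψ' : IsTestFunction Ω (fun x => φ x * partialDeriv i ψ x) :=
    (hφ.mul (hψ.pd i)).mono inter_subset_right
  have h1 := h _ hφψ
  have e1 : ∫ x, partialDeriv i φ x • mulOp hψ (ext hΩ f) x =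
      ∫ x in Ω, (partialDeriv i (fun x => φ x * ψ x) x • f x -
        (φ x * partialDeriv i ψ x) • f x) := by
    rw [← integral_indicator hΩ]
    refine integral_congr_ae ?_
    filter_upwards [coeFn_mulOp hψ (ext hΩ f), coeFn_ext hΩ f] with x hx hx'
    rw [hx, hx']
    by_cases hxΩ : x ∈ Ω
    · simp only [indicator_of_mem hxΩ, ← sub_smul, smul_smul,
        partialDeriv_mul hφ.differentiable hψ.differentiable]
      congr 1; ring
    · simp [hxΩ]
  have e2 : ∫ x, φ x • (mulOp hψ (ext hΩ g) + mulOp (hψ.pd i) (ext hΩ f) : LR Y) x =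
      ∫ x in Ω, ((φ x * ψ x) • g x + (φ x * partialDeriv i ψ x) • f x) := by
    rw [← integral_indicator hΩ]
    refine integral_congr_ae ?_
    filter_upwards [coeFn_mulOp hψ (ext hΩ g), coeFn_mulOp (hψ.pd i) (ext hΩ f),
      Lp.coeFn_add (mulOp hψ (ext hΩ g)) (mulOp (hψ.pd i) (ext hΩ f)), coeFn_ext hΩ f,
      coeFn_ext hΩ g] with x hx1 hx2 hx3 hx4 hx5
    rw [hx3, Pi.add_apply, hx1, hx2, hx4, hx5]
    by_cases hxΩ : x ∈ Ω
    · simp only [indicator_of_mem hxΩ, smul_add, smul_smul]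
    · simp [hxΩ]
  have i1 := (hφψ.pd i).integrable_smul f
  have i2 := hφψ'.integrable_smul f
  have i3 := hφψ.integrable_smul g
  rw [e1, e2, integral_sub i1 i2, integral_add i3 i2, h1]
  abel

/-- No derivative of `F` is needed: once the translation is moved onto `φ`, the pairing is the
convolution of `F` with `φ(-·)` evaluated along a line. The reflection produces the minus sign. -/
theorem hasDerivAt_integral_smul_tau [CompleteSpace Y] {φ : Plane → ℝ}
    (hφ : IsTestFunction univ φ) (i : Fin 2) (F : LR Y) (t : ℝ) :
    HasDerivAt (fun t : ℝ => ∫ x, φ x • tau (t • basisVec i) F x)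
      (- ∫ x, partialDeriv i φ x • tau (t • basisVec i) F x) t := by
  set ψ : Plane → ℝ := fun z => φ (-z) with hψdef
  have hψ1 : ContDiff ℝ ∞ ψ := hφ.1.comp contDiff_neg
  have hψ2 : HasCompactSupport ψ := hφ.2.1.comp_homeomorph (Homeomorph.neg Plane)
  have hFl : LocallyIntegrable F (volume : Measure Plane) :=
    (Lp.memLp F).locallyIntegrable (by norm_num)
  set L : Y →L[ℝ] ℝ →L[ℝ] Y := (ContinuousLinearMap.lsmul ℝ ℝ).flip with hL
  have h0 := hψ2.hasFDerivAt_convolution_right (μ := volume) L hFl (hψ1.of_le (by simp))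
    (t • basisVec i)
  have hline : HasDerivAt (fun t : ℝ => t • basisVec i) (basisVec i) t := by
    simpa using (hasDerivAt_id t).smul_const (basisVec i)
  have h1 := h0.comp_hasDerivAt t hline
  have hψ' : ∀ z, fderiv ℝ ψ z (basisVec i) = - partialDeriv i φ (-z) := by
    intro z
    have h1 : HasFDerivAt φ (fderiv ℝ φ (-z)) (-z) := (hφ.differentiable _).hasFDerivAt
    have h2 : HasFDerivAt ψ ((fderiv ℝ φ (-z)).comp (-ContinuousLinearMap.id ℝ Plane)) z :=
      h1.comp z (hasFDerivAt_id z).neg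
    rw [h2.fderiv]
    simp [partialDeriv]
  convert h1 using 1
  · funext s
    rw [integral_smul_tau, Function.comp_apply, convolution_def]
    refine integral_congr_ae (Eventually.of_forall fun x => ?_)
    simp [hL, hψdef]
  · rw [integral_smul_tau, convolution_def, ContinuousLinearMap.integral_apply]
    swap
    · exact (hψ2.fderiv ℝ).convolutionExists_right (ContinuousLinearMap.precompR Plane L) hFl
        (hψ1.continuous_fderiv (by simp)) _
    rw [← integral_neg]
    refine integral_congr_ae (Eventually.of_forall fun x => ?_)
    change _ = fderiv ℝ ψ (t • basisVec i - x) (basisVec i) • F x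
    rw [hψ', neg_sub, neg_smul]

/-- This is the fundamental theorem of calculus along a coordinate direction. It holds after pairing
with any test function, because the pairing with the translates of `F` is differentiable with
derivative the pairing with the translates of `G`. Translations being isometries, the bound
`norm_diffOp_le` follows at once. -/
theorem tau_sub_eq_integral [CompleteSpace Y] {i : Fin 2} {F G : LR Y} (h : HasWPD i F G)
    (t : ℝ) : diffOp (t • basisVec i) F = ∫ s in (0 : ℝ)..t, tau (s • basisVec i) G := by
  have hcont : Continuous fun s : ℝ => tau (s • basisVec i) G :=
    (continuous_tau G).comp (by fun_prop)
  refine eq_of_pairOp_eq fun φ hφ => ?_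
  rw [← ContinuousLinearMap.intervalIntegral_comp_comm _ (hcont.intervalIntegrable _ _)]
  have hd : ∀ s : ℝ, HasDerivAt (fun t : ℝ => pairOp hφ (tau (t • basisVec i) F))
      (pairOp hφ (tau (s • basisVec i) G)) s := by
    intro s
    have h1 := hasDerivAt_integral_smul_tau hφ i F s
    rw [h.tau _ φ hφ, neg_neg] at h1
    simpa only [pairOp_apply] using h1
  rw [intervalIntegral.integral_eq_sub_of_hasDerivAt (fun s _ => hd s)
    (((pairOp hφ).continuous.comp hcont).intervalIntegrable _ _)]
  rw [diffOp_apply, map_sub, zero_smul, tau_zero]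

theorem norm_diffOp_le [CompleteSpace Y] {i : Fin 2} {F G : LR Y} (h : HasWPD i F G) (t : ℝ) :
    ‖diffOp (t • basisVec i) F‖ ≤ |t| * ‖G‖ := by
  rw [tau_sub_eq_integral h t]
  refine (intervalIntegral.norm_integral_le_of_norm_le_const (C := ‖G‖) fun s _ => ?_).trans ?_
  · rw [norm_tau]
  · rw [sub_zero, mul_comm]

/-- Weak sequential compactness of bounded sets, in the form of weak cluster points. -/
theorem exists_weak_clusterPt {X : Type} [NormedAddCommGroup X] [InnerProductSpace ℝ X]
    [CompleteSpace X] {ι : Type} {l : Filter ι} [l.NeBot] (d : ι → X) (M : ℝ)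
    (hd : ∀ᶠ n in l, ‖d n‖ ≤ M) :
    ∃ g : X, ‖g‖ ≤ M ∧ ∀ x, MapClusterPt (inner ℝ g x) l (fun n => inner ℝ (d n) x) := by
  -- Banach-Alaoglu in the dual, carried back by the Riesz isometry. A cluster point is enough, so
  -- neither separability nor a subsequence is needed.
  have hK := WeakDual.isCompact_closedBall (𝕜 := ℝ) (E := X) 0 M
  let D : ι → WeakDual ℝ X := fun n =>
    StrongDual.toWeakDual (InnerProductSpace.toDual ℝ X (d n))
  have hD : ∀ᶠ n in l, D n ∈ WeakDual.toStrongDual ⁻¹' Metric.closedBall (0 : StrongDual ℝ X) M := by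
    filter_upwards [hd] with n hn
    simp only [mem_preimage, mem_closedBall_zero_iff]
    change ‖InnerProductSpace.toDual ℝ X (d n)‖ ≤ M
    rwa [LinearIsometryEquiv.norm_map]
  obtain ⟨w, hw, hcl⟩ := hK.exists_mapClusterPt (tendsto_principal.2 hD)
  refine ⟨(InnerProductSpace.toDual ℝ X).symm (WeakDual.toStrongDual w), ?_, fun x => ?_⟩
  · rw [LinearIsometryEquiv.norm_map]
    simpa using hw
  · have := hcl.continuousAt_comp (f := fun w : WeakDual ℝ X => w x)
      (WeakDual.eval_continuous x).continuousAt
    rw [InnerProductSpace.toDual_symm_apply]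
    exact this

theorem IsTestFunction.memLp_smul_const {Ω : Set Plane} {φ : Plane → ℝ}
    (hφ : IsTestFunction Ω φ) (y : Y) (μ : Measure Plane) [IsFiniteMeasureOnCompacts μ] :
    MemLp (fun x => φ x • y) 2 μ :=
  MemLp.smul (p := 2) (q := ∞) (memLp_top_const y)
    (hφ.1.continuous.memLp_of_hasCompactSupport hφ.2.1)

/-- Components of an integral against a test function are `L²` inner products, which is the form in
which weak cluster points can be used. -/
theorem inner_integral_smul [CompleteSpace Y] {Ω : Set Plane} {φ : Plane → ℝ}
    (hφ : IsTestFunction Ω φ) {Ω' : Set Plane} (f : L2 Ω' Y) (y : Y) :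
    inner ℝ y (∫ x in Ω', φ x • f x) =
      inner ℝ f ((hφ.memLp_smul_const y (volume.restrict Ω')).toLp _) := by
  rw [L2.inner_def, ← integral_inner (hφ.integrable_smul f)]
  refine integral_congr_ae ?_
  filter_upwards [(hφ.memLp_smul_const y (volume.restrict Ω')).coeFn_toLp] with x hx
  rw [hx, real_inner_smul_right, real_inner_smul_right, real_inner_comm]

/-- A bound on the difference quotients gives a weak partial derivative. -/
theorem exists_isWeakPartial_of_diffOp_le [CompleteSpace Y] {Ω : Set Plane}
    {i : Fin 2} {F : LR Y} {M d : ℝ} (hd : 0 < d)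
    (hM : ∀ h ∈ Ioo 0 d, ‖rest Ω (diffOp (h • basisVec i) F)‖ ≤ h * M) :
    ∃ G : L2 Ω Y, ‖G‖ ≤ M ∧ IsWeakPartial Ω i (rest Ω F) G := by
  have hev : ∀ᶠ h : ℝ in 𝓝[>] 0, h ∈ Ioo 0 d := Ioo_mem_nhdsGT hd
  -- The candidate derivative is a weak cluster point of the difference quotients as the step
  -- decreases to zero.
  obtain ⟨G, hG, hcl⟩ := exists_weak_clusterPt (l := 𝓝[>] (0 : ℝ))
    (fun h : ℝ => h⁻¹ • rest Ω (diffOp (h • basisVec i) F)) M (by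
      filter_upwards [hev] with h hh
      rw [norm_smul, norm_inv, Real.norm_of_nonneg hh.1.le, inv_mul_le_iff₀ hh.1]
      exact hM h hh)
  refine ⟨G, hG, fun φ hφ => ?_⟩
  have hφu := hφ.toUniv
  have hsupp : ∀ x, x ∉ Ω → φ x = 0 := fun x hx =>
    image_eq_zero_of_notMem_tsupport fun h => hx (hφ.2.2 h)
  have hsupp' : ∀ x, x ∉ Ω → partialDeriv i φ x = 0 := fun x hx =>
    image_eq_zero_of_notMem_tsupport fun h => hx ((hφ.pd i).2.2 h)
  apply ext_inner_left ℝ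
  intro y
  rw [inner_neg_right]
  have hrest : ∀ (F : LR Y) (ψ : Plane → ℝ), (∀ x, x ∉ Ω → ψ x = 0) →
      ∫ x in Ω, ψ x • rest Ω F x = ∫ x, ψ x • F x := by
    intro F ψ hψ
    have h0 : ∫ x in Ω, ψ x • F x = ∫ x, ψ x • F x :=
      setIntegral_eq_integral_of_forall_compl_eq_zero (fun x hx => by rw [hψ x hx, zero_smul])
    rw [← h0]
    refine integral_congr_ae ?_
    filter_upwards [coeFn_rest Ω F] with x hx
    rw [hx]
  -- The same pairings converge, because the difference falls on the smooth function `φ`. A cluster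
  -- point of a convergent family is its limit, and this identifies `G`.
  have hlim : Tendsto (fun h : ℝ => inner ℝ y (∫ x in Ω, φ x •
      (h⁻¹ • rest Ω (diffOp (h • basisVec i) F) : L2 Ω Y) x)) (𝓝[>] 0)
      (𝓝 (inner ℝ y (-∫ x, partialDeriv i φ x • F x))) := by
    have h1 := (hasDerivAt_integral_smul_tau hφu i F 0)
    rw [zero_smul, tau_zero] at h1
    have h2 := h1.tendsto_slope_zero_right
    have hc : Continuous fun z : Y => (inner ℝ y z : ℝ) := by fun_prop
    refine (hc.tendsto _).comp (h2.congr' ?_)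
    filter_upwards [self_mem_nhdsWithin] with h hh
    rw [← map_smul, hrest _ _ hsupp, ← pairOp_apply hφu, ← pairOp_apply hφu, ← pairOp_apply hφu,
      map_smul, diffOp_apply, map_sub, zero_add, zero_smul, tau_zero]
  have h3 : MapClusterPt (inner ℝ y (∫ x in Ω, φ x • G x)) (𝓝[>] 0) (fun h : ℝ =>
      inner ℝ y (∫ x in Ω, φ x • (h⁻¹ • rest Ω (diffOp (h • basisVec i) F) : L2 Ω Y) x)) := by
    simpa only [inner_integral_smul hφ] using
      hcl ((hφ.memLp_smul_const y (volume.restrict Ω)).toLp _)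
  have h4 : inner ℝ y (∫ x in Ω, φ x • G x) = inner ℝ y (-∫ x, partialDeriv i φ x • F x) := by
    have : (𝓝 _ ⊓ 𝓝 _).NeBot := h3.neBot.mono (inf_le_inf le_rfl hlim)
    exact eq_of_nhds_neBot this
  rw [hrest _ _ hsupp', h4, inner_neg_right, neg_neg]

end WeakDerivatives

/-! ### Symmetric matrices -/

section Matrices

theorem entry_symPart (G : Fin 2 → Fin 2 → ℝ) (i j : Fin 2) :
    entry (symPart G) i j = (G i j + G j i) / 2 := rfl

theorem entry_comm (A : Sym2x2) (i j : Fin 2) : entry A i j = entry A j i := A.2 i j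

theorem sym_ext {A B : Sym2x2} (h : ∀ i j, entry A i j = entry B i j) : A = B := by
  apply Subtype.ext
  ext ij
  exact h ij.1 ij.2

theorem entry_add (A B : Sym2x2) (i j : Fin 2) : entry (A + B) i j = entry A i j + entry B i j :=
  rfl

theorem entry_smul (c : ℝ) (A : Sym2x2) (i j : Fin 2) : entry (c • A) i j = c * entry A i j :=
  rfl

/-- The entry `A i j`, as a continuous linear form. -/
def entryL (i j : Fin 2) : Sym2x2 →L[ℝ] ℝ :=
  LinearMap.toContinuousLinearMap
    { toFun := fun A => entry A i j
      map_add' := fun _ _ => rfl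
      map_smul' := fun _ _ => rfl }

theorem entryL_apply (i j : Fin 2) (A : Sym2x2) : entryL i j A = entry A i j := rfl

theorem inner_sym (A B : Sym2x2) :
    inner ℝ A B = ∑ i, ∑ j, entry A i j * entry B i j := by
  rw [Submodule.coe_inner, PiLp.inner_apply, Fintype.sum_prod_type]
  simp [entry, mul_comm]

/-- The symmetric part of the tensor product of `a` with the `j`-th basis vector. -/
def symTensor (j : Fin 2) : Plane →L[ℝ] Sym2x2 :=
  LinearMap.toContinuousLinearMap
    { toFun := fun a => symPart (fun i k => if k = j then a i else 0)
      map_add' := fun a b => by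
        refine sym_ext fun i k => ?_
        simp only [entry_add, entry_symPart, PiLp.add_apply]
        split_ifs <;> ring
      map_smul' := fun c a => by
        refine sym_ext fun i k => ?_
        simp only [entry_smul, entry_symPart, PiLp.smul_apply, RingHom.id_apply, smul_eq_mul]
        split_ifs <;> ring }

theorem entry_symTensor (j : Fin 2) (a : Plane) (i k : Fin 2) :
    entry (symTensor j a) i k = ((if k = j then a i else 0) + (if i = j then a k else 0)) / 2 :=
  rfl

/-- By symmetry of `A`, its product with the symmetrized tensor equals its product with the full
one. Hence the equilibrium equation, given row by row, can be tested with symmetrized gradients. -/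
theorem inner_symTensor (A : Sym2x2) (j : Fin 2) (a : Plane) :
    inner ℝ A (symTensor j a) = ∑ i, entry A i j * a i := by
  have h := entry_comm A 0 1
  rw [inner_sym]
  simp only [entry_symTensor, Fin.sum_univ_two]
  fin_cases j <;> simp <;> rw [h] <;> ring

/-- The symmetrized gradient becomes a sum of fixed linear maps applied to the partial derivatives,
so it commutes with translations and cut-offs through `mapOp`. -/
theorem symPart_eq_sum (g : Fin 2 → Plane) :
    symPart (fun i j => g j i) = ∑ j, symTensor j (g j) := by
  refine sym_ext fun i k => ?_
  rw [Fin.sum_univ_two, entry_add, entry_symTensor, entry_symTensor, entry_symPart]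
  fin_cases i <;> fin_cases k <;> simp <;> ring

theorem inner_smul_sym (c : ℝ) (A B : Sym2x2) : inner ℝ (c • A) B = c * inner ℝ A B :=
  real_inner_smul_left A B c

theorem inner_idMat (A : Sym2x2) : inner ℝ idMat A = tr A := by
  rw [inner_sym]
  simp [idMat, entry_symPart, tr, Fin.sum_univ_two]

theorem tr_sq_le (A : Sym2x2) : tr A ^ 2 ≤ 2 * ‖A‖ ^ 2 := by
  rw [← real_inner_self_eq_norm_sq, inner_sym]
  simp only [tr, Fin.sum_univ_two, LinearMap.coe_toContinuousLinearMap', LinearMap.coe_mk,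
    AddHom.coe_mk]
  nlinarith [sq_nonneg (entry A 0 0 - entry A 1 1), sq_nonneg (entry A 0 1),
    sq_nonneg (entry A 1 0)]

theorem elasticity_apply (lam mu : ℝ) (A : Sym2x2) :
    elasticity lam mu A = (lam * tr A) • idMat + (2 * mu) • A := by
  simp [elasticity, smul_smul]

/-- For `lam ≥ 0` the trace term is dropped. For `lam ≤ 0` the inequality `(tr A)² ≤ 2 |A|²` gives
the constant `2 (lam + mu)`. -/
theorem elasticity_coercive (lam mu : ℝ) (A : Sym2x2) :
    min (2 * mu) (2 * (lam + mu)) * ‖A‖ ^ 2 ≤ inner ℝ (elasticity lam mu A) A := by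
  rw [elasticity_apply, inner_add_left, inner_smul_sym, inner_smul_sym, inner_idMat,
    real_inner_self_eq_norm_sq]
  have h1 := tr_sq_le A
  have h2 := sq_nonneg (tr A)
  rcases le_total 0 lam with h | h
  · nlinarith [mul_le_mul_of_nonneg_right (min_le_left (2 * mu) (2 * (lam + mu)))
      (sq_nonneg ‖A‖), mul_nonneg h h2]
  · nlinarith [mul_le_mul_of_nonneg_right (min_le_right (2 * mu) (2 * (lam + mu)))
      (sq_nonneg ‖A‖), mul_le_mul_of_nonpos_left h1 h]

end Matrices

/-! ### The flow rule -/

section FlowRule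

variable {α κ : ℝ}

theorem supportFun_nonneg (hκ : 0 ≤ κ) (p : Sym2x2) : 0 ≤ supportFun α κ p := by
  refine le_iSup₂_of_le (0 : Sym2x2) ?_ (by simp)
  simp [elasticitySet, dev, hκ]

theorem supportFun_zero (hκ : 0 ≤ κ) : supportFun α κ 0 = 0 :=
  le_antisymm (iSup₂_le fun σ _ => by simp) (supportFun_nonneg hκ 0)

/-- Testing the subgradient inequality with `r = 0` gives the bound, and also excludes the value
`+∞`. -/
theorem supportFun_le_inner (hκ : 0 ≤ κ) {q τ : Sym2x2}
    (h : τ ∈ subdifferential (supportFun α κ) q) :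
    supportFun α κ q ≤ ((inner ℝ τ q : ℝ) : EReal) := by
  have h0 := h 0
  rw [supportFun_zero hκ, zero_sub, inner_neg_right] at h0
  induction hF : supportFun α κ q with
  | bot => exact bot_le
  | top => rw [hF] at h0; simp at h0
  | coe a =>
    rw [hF, ← EReal.coe_add, ← EReal.coe_zero, EReal.coe_le_coe_iff] at h0
    exact EReal.coe_le_coe_iff.2 (by linarith)

/-- Where a subgradient exists the support function is finite, so the proof of monotonicity can be
carried out with real numbers. -/
theorem exists_supportFun_eq (hκ : 0 ≤ κ) {q τ : Sym2x2}
    (h : τ ∈ subdifferential (supportFun α κ) q) :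
    ∃ a : ℝ, 0 ≤ a ∧ supportFun α κ q = a ∧ a ≤ inner ℝ τ q := by
  have h1 := supportFun_le_inner hκ h
  have h2 := supportFun_nonneg (α := α) hκ q
  induction hF : supportFun α κ q with
  | bot => rw [hF] at h2; simp at h2
  | top => rw [hF] at h1; simp at h1
  | coe a =>
    rw [hF] at h1 h2
    exact ⟨a, by exact_mod_cast h2, rfl, by exact_mod_cast h1⟩

/-- Monotonicity of the subdifferential. -/
theorem subdifferential_monotone (hκ : 0 ≤ κ) {q τ q' τ' : Sym2x2}
    (h : τ ∈ subdifferential (supportFun α κ) q) (h' : τ' ∈ subdifferential (supportFun α κ) q') :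
    0 ≤ inner ℝ (τ - τ') (q - q') := by
  obtain ⟨a, -, ha, -⟩ := exists_supportFun_eq hκ h
  obtain ⟨a', -, ha', -⟩ := exists_supportFun_eq hκ h'
  have h1 := h q'
  have h2 := h' q
  rw [ha, ha', ← EReal.coe_add, EReal.coe_le_coe_iff] at h1 h2
  have e : inner ℝ τ (q' - q) = - inner ℝ τ (q - q') := by rw [← inner_neg_right, neg_sub]
  rw [inner_sub_left]
  linarith

/-- This is the regularizing effect of viscosity. Monotonicity gives `0 ≤ ⟨(σ - σ') - ε (q - q'), q
- q'⟩`, and the Cauchy-Schwarz inequality concludes. -/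
theorem norm_sub_le_of_flowRule (hκ : 0 ≤ κ) {ε : ℝ} (hε : 0 < ε) {σ q σ' q' : Sym2x2}
    (h : σ - ε • q ∈ subdifferential (supportFun α κ) q)
    (h' : σ' - ε • q' ∈ subdifferential (supportFun α κ) q') :
    ‖q - q'‖ ≤ ε⁻¹ * ‖σ - σ'‖ := by
  have h1 := subdifferential_monotone hκ h h'
  have e : σ - ε • q - (σ' - ε • q') = (σ - σ') - ε • (q - q') := by
    rw [smul_sub]; abel
  rw [e, inner_sub_left, inner_smul_sym, real_inner_self_eq_norm_sq] at h1
  have h2 := real_inner_le_norm (σ - σ') (q - q')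
  rw [le_inv_mul_iff₀ hε]
  rcases (norm_nonneg (q - q')).eq_or_lt with h3 | h3
  · rw [← h3, mul_zero]; positivity
  · refine le_of_mul_le_mul_right ?_ h3
    nlinarith

/-- Zero stress with zero plastic rate obeys the flow rule. This allows comparison with zero, and
extension by zero outside of `Ω`. -/
theorem zero_mem_subdifferential (hκ : 0 ≤ κ) (ε : ℝ) :
    (0 : Sym2x2) - ε • (0 : Sym2x2) ∈ subdifferential (supportFun α κ) 0 := by
  intro r
  rw [supportFun_zero hκ]
  simpa using supportFun_nonneg hκ r

end FlowRule

/-- An elementary quadratic inequality. -/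
theorem le_mul_of_quadratic_le {c l : ℝ} (hc : 0 < c) (hl : 0 ≤ l) {x a b : ℝ} (ha : 0 ≤ a)
    (hb : 0 ≤ b) (h : c * x ^ 2 ≤ l * x * b + a * x + a * b) :
    x ≤ ((l + 2) / c + 1) * (a + b) := by
  by_contra! hx
  -- If `x > K (a + b)`, then `a + b ≤ x`, so the right side of `h` is at most `(l + 2) (a + b) x`.
  -- Since `c K = l + 2 + c`, the left side exceeds this.
  set K := (l + 2) / c + 1 with hK
  have hcK : c * K = l + 2 + c := by rw [hK]; field_simp
  have hK1 : 1 ≤ K := by rw [hK]; have : 0 ≤ (l + 2) / c := by positivity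
                         linarith
  have hs : 0 ≤ a + b := by linarith
  have hx0 : 0 < x := lt_of_le_of_lt (by positivity) hx
  have hsx : a + b ≤ x := le_trans (by nlinarith) hx.le
  have h1 : l * x * b + a * x + a * b ≤ (l + 2) * ((a + b) * x) := by
    nlinarith [mul_nonneg ha hb, mul_nonneg hl (mul_nonneg hx0.le ha), mul_nonneg hx0.le hb,
      mul_nonneg hx0.le ha, mul_le_mul_of_nonneg_left hsx ha]
  have h2 : c * (K * (a + b)) * x < c * x * x := by
    have := mul_lt_mul_of_pos_right (mul_lt_mul_of_pos_left hx hc) hx0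
    linarith
  nlinarith [mul_nonneg hs hx0.le, mul_nonneg hc.le (mul_nonneg hs hx0.le)]

/-! ### Testing with compactly supported Sobolev functions -/

section Mollification

theorem HasWPD.mapOp {Y Z : Type} [NormedAddCommGroup Y] [InnerProductSpace ℝ Y]
    [NormedAddCommGroup Z] [InnerProductSpace ℝ Z] [CompleteSpace Y] [CompleteSpace Z]
    {i : Fin 2} {F G : LR Y} (h : HasWPD i F G) (L : Y →L[ℝ] Z) :
    HasWPD i (mapOp L F) (mapOp L G) := by
  have key : ∀ (F : LR Y) (φ : Plane → ℝ), IsTestFunction univ φ →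
      ∫ x, φ x • Perzyna.mapOp L F x = L (∫ x, φ x • F x) := by
    intro F φ hφ
    rw [← L.integral_comp_comm (hφ.integrable_smul F)]
    refine integral_congr_ae ?_
    filter_upwards [coeFn_mapOp L F] with x hx
    rw [hx, map_smul]
  intro φ hφ
  rw [key _ _ (hφ.pd i), key _ _ hφ, h φ hφ, map_neg]

/-- This justifies Fubini's theorem below: the integrand is dominated by `|ρ(y)| (T(x)² + g(x -
y)²)`. -/
theorem integrable_mul_convolution_integrand {ρ : Plane → ℝ} (hρ : Continuous ρ)
    (hρc : HasCompactSupport ρ) (T g : LR ℝ) :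
    Integrable (fun p : Plane × Plane => T p.1 * (ρ p.2 * g (p.1 - p.2)))
      ((volume : Measure Plane).prod volume) := by
  have hρi : Integrable ρ (volume : Measure Plane) := hρ.integrable_of_hasCompactSupport hρc
  have hT2 : Integrable (fun x => T x ^ 2) (volume : Measure Plane) := (Lp.memLp T).integrable_sq
  have hg2 : Integrable (fun x => g x ^ 2) (volume : Measure Plane) := (Lp.memLp g).integrable_sq
  have h1 : Integrable (fun p : Plane × Plane => T p.1 ^ 2 * |ρ p.2|)
      ((volume : Measure Plane).prod volume) := hT2.mul_prod hρi.abs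
  have h2 : Integrable (fun p : Plane × Plane => |ρ p.2| * g (p.1 - p.2) ^ 2)
      ((volume : Measure Plane).prod volume) :=
    Integrable.convolution_integrand (ContinuousLinearMap.mul ℝ ℝ) hρi.abs hg2
  have hm : AEStronglyMeasurable (fun p : Plane × Plane => ρ p.2 * g (p.1 - p.2))
      ((volume : Measure Plane).prod volume) :=
    AEStronglyMeasurable.convolution_integrand (ContinuousLinearMap.mul ℝ ℝ)
      hρi.aestronglyMeasurable (Lp.memLp g).aestronglyMeasurable
  refine (h1.add h2).mono' ((Lp.memLp T).aestronglyMeasurable.comp_fst.mul hm)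
    (Eventually.of_forall fun p => ?_)
  simp only [Pi.add_apply, Real.norm_eq_abs, abs_mul]
  nlinarith [sq_nonneg (|T p.1| - |g (p.1 - p.2)|), sq_abs (T p.1), sq_abs (g (p.1 - p.2)),
    abs_nonneg (ρ p.2), abs_nonneg (T p.1), abs_nonneg (g (p.1 - p.2)),
    mul_nonneg (abs_nonneg (ρ p.2)) (sq_nonneg (|T p.1| - |g (p.1 - p.2)|)),
    mul_nonneg (abs_nonneg (ρ p.2)) (mul_nonneg (abs_nonneg (T p.1)) (abs_nonneg (g (p.1 - p.2))))]

/-- By Fubini's theorem, pairing `T` with a mollification of `g` averages the pairings of `T` with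
the translates of `g`. -/
theorem integral_mul_mollify {ρ : Plane → ℝ} (hρ : Continuous ρ) (hρc : HasCompactSupport ρ)
    (T g : LR ℝ) :
    ∫ x, T x * ∫ y, ρ (x - y) * g y = ∫ y, ρ y * inner ℝ T (tau (-y) g) := by
  have h1 : ∀ x, ∫ y, ρ (x - y) * g y = ∫ y, ρ y * g (x - y) := fun x => by
    rw [← integral_sub_left_eq_self (fun y => ρ y * g (x - y)) volume x]
    simp
  simp_rw [h1, ← integral_const_mul]
  rw [integral_integral_swap (integrable_mul_convolution_integrand hρ hρc T g)]
  refine integral_congr_ae (Eventually.of_forall fun y => ?_)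
  simp only [L2.inner_def, ← integral_const_mul]
  refine integral_congr_ae ?_
  filter_upwards [coeFn_tau (-y) g] with x hx
  rw [hx, ← sub_eq_add_neg]
  simp only [RCLike.inner_apply, conj_trivial]
  ring

/-- Mollification of a compactly supported function with weak partial derivatives. -/
theorem isTestFunction_mollify {Ω : Set Plane} {f : LR ℝ} {g : Fin 2 → LR ℝ}
    (hg : ∀ j, HasWPD j f (g j)) {K : Set Plane} (hK : IsCompact K) {δ : ℝ}
    (hKΩ : Metric.cthickening δ K ⊆ Ω) (hf : ∀ᵐ x, x ∉ K → f x = 0)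
    (ρ : ContDiffBump (0 : Plane)) (hρ : ρ.rOut ≤ δ) :
    IsTestFunction Ω (fun x => ∫ y, ρ.normed volume (x - y) * f y) ∧
    ∀ j x, partialDeriv j (fun x => ∫ y, ρ.normed volume (x - y) * f y) x =
      ∫ y, ρ.normed volume (x - y) * g j y := by
  set r : Plane → ℝ := ρ.normed volume with hr
  have hr1 : ContDiff ℝ ∞ r := ρ.contDiff_normed
  have hr2 : HasCompactSupport r := ρ.hasCompactSupport_normed
  -- Setting `f` to zero off `K` alters it only on a null set, but gives pointwise control of the
  -- support of the convolution.
  set f' : Plane → ℝ := K.indicator f with hf'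
  have hff' : f' =ᵐ[volume] f := by
    filter_upwards [hf] with x hx
    by_cases hxK : x ∈ K
    · simp [hf', hxK]
    · simp [hf', hxK, hx hxK]
  have hf'l : LocallyIntegrable f' volume := by
    refine LocallyIntegrable.indicator ?_ hK.isClosed.measurableSet
    exact (Lp.memLp f).locallyIntegrable (by norm_num)
  have hconv : (fun x => ∫ y, r (x - y) * f y) =
      convolution r f' (ContinuousLinearMap.mul ℝ ℝ) volume := by
    funext x
    rw [convolution_eq_swap]
    refine integral_congr_ae ?_
    filter_upwards [hff'] with y hy
    simp [hy]
  have hsmooth : ContDiff ℝ ∞ (fun x => ∫ y, r (x - y) * f y) := by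
    rw [hconv]
    exact hr2.contDiff_convolution_left _ hr1 hf'l
  have hsupp : Function.support (fun x => ∫ y, r (x - y) * f y) ⊆ Metric.cthickening δ K := by
    rw [hconv]
    refine (support_convolution_subset _).trans ?_
    rintro x ⟨a, ha, b, hb, rfl⟩
    rw [hr, ρ.support_normed_eq] at ha
    have hbK : b ∈ K := by
      by_contra h
      exact hb (by simp [hf', h])
    refine Metric.mem_cthickening_of_dist_le _ b δ _ hbK ?_
    have : ‖a‖ < ρ.rOut := by simpa using ha
    simpa [dist_eq_norm] using this.le.trans hρ
  have hts : tsupport (fun x => ∫ y, r (x - y) * f y) ⊆ Metric.cthickening δ K :=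
    closure_minimal hsupp Metric.isClosed_cthickening
  refine ⟨⟨hsmooth, hK.cthickening.of_isClosed_subset (isClosed_tsupport _) hts,
    hts.trans hKΩ⟩, fun j x => ?_⟩
  -- For fixed `x` the kernel is itself a test function in `y`, so the weak derivative of `f` can be
  -- tested with it. Uniqueness of the derivative along the line then identifies the partial
  -- derivative of the mollification.
  have htest : IsTestFunction univ (fun y => r (x - y)) :=
    ⟨hr1.comp (contDiff_const.sub contDiff_id), hr2.comp_homeomorph (Homeomorph.subLeft x),
      subset_univ _⟩
  have h1 := hasDerivAt_integral_smul_tau htest j f 0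
  rw [zero_smul, tau_zero, hg j _ htest, neg_neg] at h1
  have h2 : HasDerivAt (fun t : ℝ => ∫ y, r (x + t • basisVec j - y) * f y)
      (partialDeriv j (fun x => ∫ y, r (x - y) * f y) x) 0 := by
    have h3 := (hsmooth.differentiable (by simp)) (x + (0 : ℝ) • basisVec j)
    have hline : HasDerivAt (fun t : ℝ => x + t • basisVec j) (basisVec j) 0 := by
      simpa using ((hasDerivAt_id (0 : ℝ)).smul_const (basisVec j)).const_add x
    have h4 := h3.hasFDerivAt.comp_hasDerivAt (0 : ℝ) hline
    rw [zero_smul, add_zero] at h4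
    exact h4
  refine h2.unique ?_
  simp only [← smul_eq_mul]
  convert h1 using 1
  funext t
  rw [integral_smul_tau]
  refine integral_congr_ae (Eventually.of_forall fun y => ?_)
  change r (x + t • basisVec j - y) • f y = r (x - (y - t • basisVec j)) • f y
  congr 2
  abel

/-- A vector field without divergence in an open set is orthogonal to the gradients of the
functions with compact support in that set. -/
theorem sum_inner_eq_zero_of_hasWPD {Ω : Set Plane} (hΩ : IsOpen Ω) {T : Fin 2 → LR ℝ}
    (hT : ∀ φ, IsTestFunction Ω φ → ∑ j, ∫ x, T j x * partialDeriv j φ x = 0)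
    {f : LR ℝ} {g : Fin 2 → LR ℝ} (hg : ∀ j, HasWPD j f (g j)) {K : Set Plane}
    (hK : IsCompact K) (hKΩ : K ⊆ Ω) (hf : ∀ᵐ x, x ∉ K → f x = 0) :
    ∑ j, inner ℝ (T j) (g j) = 0 := by
  obtain ⟨δ, hδ, hδΩ⟩ := hK.exists_cthickening_subset_open hΩ hKΩ
  -- The claim is `c 0 = 0` for this continuous function of the translation vector. Testing with a
  -- mollification says that the convolution of `c` with the bump vanishes at the origin. If `c 0`
  -- were nonzero, a bump of small radius would keep that average within `|c 0| / 2` of `c 0`.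
  set c : Plane → ℝ := fun y => ∑ j, inner ℝ (T j) (tau y (g j)) with hc
  have hcc : Continuous c :=
    continuous_finsetSum _ fun j _ => continuous_const.inner (continuous_tau (g j))
  have hc0 : c 0 = ∑ j, inner ℝ (T j) (g j) := by simp only [hc, tau_zero]
  rw [← hc0]
  by_contra hne
  obtain ⟨r, hr, hrc⟩ := Metric.continuousAt_iff.1 hcc.continuousAt (|c 0| / 2)
    (by positivity)
  have hρpos : 0 < min r δ := lt_min hr hδ
  let ρ : ContDiffBump (0 : Plane) := ⟨min r δ / 2, min r δ, by linarith, by linarith⟩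
  have hρδ : ρ.rOut ≤ δ := min_le_right _ _
  obtain ⟨htest, hpd⟩ := isTestFunction_mollify hg hK hδΩ hf ρ hρδ
  have h1 := hT _ htest
  simp_rw [hpd, integral_mul_mollify ρ.continuous_normed ρ.hasCompactSupport_normed] at h1
  have h2 : (convolution (ρ.normed volume) c (ContinuousLinearMap.lsmul ℝ ℝ) volume) 0 = 0 := by
    rw [← h1, ← integral_finsetSum, convolution_def]
    · refine integral_congr_ae (Eventually.of_forall fun y => ?_)
      simp [hc, mul_add]
    · intro j _
      refine Continuous.integrable_of_hasCompactSupport ?_ ρ.hasCompactSupport_normed.mul_right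
      exact ρ.continuous_normed.mul
        (continuous_const.inner ((continuous_tau (g j)).comp continuous_neg))
  have h3 := ρ.dist_normed_convolution_le (μ := volume) (g := c) (x₀ := 0) (ε := |c 0| / 2)
    hcc.aestronglyMeasurable fun x hx => (hrc ((Metric.mem_ball.1 hx).trans_le
      (min_le_left _ _))).le
  rw [h2, dist_comm, Real.dist_eq, sub_zero] at h3
  have : 0 < |c 0| := abs_pos.2 hne
  linarith

theorem HasWeakDiv.sum_integral_eq_zero {Ω : Set Plane} (hΩ : MeasurableSet Ω)
    {θ : L2 Ω Sym2x2} (hθ : HasWeakDiv Ω θ 0) {φ : Plane → ℝ} (hφ : IsTestFunction Ω φ)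
    (i : Fin 2) :
    ∑ j, ∫ x, mapOp (entryL i j) (ext hΩ θ) x * partialDeriv j φ x = 0 := by
  have h1 := hθ φ hφ i
  have h2 : ∫ x in Ω, (0 : L2 Ω Plane) x i * φ x = 0 := by
    rw [← integral_zero Plane ℝ (μ := volume.restrict Ω)]
    refine integral_congr_ae ?_
    filter_upwards [Lp.coeFn_zero Plane 2 (volume.restrict Ω)] with x hx
    rw [hx]
    simp
  rw [h2, neg_zero] at h1
  rw [← h1, ← integral_finsetSum, ← integral_indicator hΩ]
  · refine integral_congr_ae ?_
    have e1 : ∀ j, ∀ᵐ x, mapOp (entryL i j) (ext hΩ θ) x = entry (ext hΩ θ x) i j := fun j =>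
      coeFn_mapOp (entryL i j) (ext hΩ θ)
    filter_upwards [coeFn_ext hΩ θ, ae_all_iff.2 e1] with x hx hx'
    simp only [hx', hx]
    by_cases hxΩ : x ∈ Ω
    · simp [hxΩ]
    · simp [hxΩ, entry]
  · intro j _
    have := (hφ.pd j).integrable_smul (mapOp (entryL i j) (ext hΩ θ))
    simpa only [smul_eq_mul, mul_comm] using this

/-- A stress field without divergence in an open set is orthogonal to the symmetrized gradients of
the functions with compact support in that set. -/
theorem inner_ext_symGrad_eq_zero {Ω : Set Plane} (hΩ : IsOpen Ω) {θ : L2 Ω Sym2x2}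
    (hθ : HasWeakDiv Ω θ 0) {F : LR Plane} {G : Fin 2 → LR Plane} (hG : ∀ j, HasWPD j F (G j))
    {K : Set Plane} (hK : IsCompact K) (hKΩ : K ⊆ Ω) (hF : ∀ᵐ x, x ∉ K → F x = 0) :
    inner ℝ (ext hΩ.measurableSet θ) (∑ j, mapOp (symTensor j) (G j)) = 0 := by
  set pr : Fin 2 → Plane →L[ℝ] ℝ := fun i => EuclideanSpace.proj i with hpr
  -- Row `i` of the stress is a divergence-free vector field, tested with the `i`-th component of
  -- `F`.
  have h1 : ∀ i, ∑ j, inner ℝ (mapOp (entryL i j) (ext hΩ.measurableSet θ))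
      (mapOp (pr i) (G j)) = 0 := by
    intro i
    refine sum_inner_eq_zero_of_hasWPD hΩ
      (fun φ hφ => hθ.sum_integral_eq_zero hΩ.measurableSet hφ i)
      (f := mapOp (pr i) F) (fun j => (hG j).mapOp (pr i)) hK hKΩ ?_
    filter_upwards [hF, coeFn_mapOp (pr i) F] with x hx hx' hxK
    rw [hx', hx hxK, map_zero]
  have h2 : ∀ j, inner ℝ (ext hΩ.measurableSet θ) (mapOp (symTensor j) (G j)) =
      ∑ i, inner ℝ (mapOp (entryL i j) (ext hΩ.measurableSet θ)) (mapOp (pr i) (G j)) := by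
    intro j
    simp_rw [L2.inner_def]
    rw [← integral_finsetSum]
    · refine integral_congr_ae ?_
      have e1 : ∀ i, ∀ᵐ x, mapOp (entryL i j) (ext hΩ.measurableSet θ) x =
          entry (ext hΩ.measurableSet θ x) i j := fun i => coeFn_mapOp (entryL i j) _
      have e2 : ∀ i, ∀ᵐ x, mapOp (pr i) (G j) x = G j x i := fun i => coeFn_mapOp (pr i) _
      filter_upwards [coeFn_mapOp (symTensor j) (G j), ae_all_iff.2 e1, ae_all_iff.2 e2]
        with x h3 h4 h5
      rw [h3, inner_symTensor]
      simp only [h4, h5, RCLike.inner_apply, conj_trivial]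
      exact Finset.sum_congr rfl fun i _ => mul_comm _ _
    · exact fun i _ => L2.integrable_inner _ _
  have h3 : inner ℝ (ext hΩ.measurableSet θ) (∑ j, mapOp (symTensor j) (G j)) =
      ∑ j, inner ℝ (ext hΩ.measurableSet θ) (mapOp (symTensor j) (G j)) :=
    inner_sum (𝕜 := ℝ) (E := LR Sym2x2) _ _ _
  rw [h3]
  simp_rw [h2]
  rw [Finset.sum_comm]
  simp [h1]

end Mollification

/-! ### The interior estimate -/

section InteriorEstimate

/-- Cut-off functions. -/
theorem exists_cutoff {Ω K : Set Plane} (hΩ : IsOpen Ω) (hK : IsCompact K) (hKΩ : K ⊆ Ω) :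
    ∃ (ψ : Plane → ℝ) (d : ℝ), IsTestFunction Ω ψ ∧ 0 < d ∧ Metric.cthickening d K ⊆ Ω ∧
      ∀ x ∈ Metric.thickening d K, ψ x = 1 ∧ ∀ j, partialDeriv j ψ x = 0 := by
  obtain ⟨δ, hδ, hδΩ⟩ := hK.exists_cthickening_subset_open hΩ hKΩ
  have hsub : Metric.cthickening (δ / 2) K ⊆ Metric.thickening δ K :=
    Metric.cthickening_subset_thickening' hδ (by linarith) K
  obtain ⟨ψ, h1, -, h3, h4⟩ := exists_contMDiff_support_eq_eq_one_iff (n := ⊤)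
    (modelWithCornersSelf ℝ Plane) (Metric.isOpen_thickening (δ := δ) (E := K))
    Metric.isClosed_cthickening hsub
  have hts : tsupport ψ ⊆ Metric.cthickening δ K := by
    rw [tsupport, h3]
    exact Metric.closure_thickening_subset_cthickening δ K
  -- The plateau contains an open neighbourhood of `K`, which is why the derivatives of the cut-off
  -- vanish there as well.
  have hone : ∀ x ∈ Metric.thickening (δ / 2) K, ψ x = 1 := fun x hx =>
    (h4 x).1 (Metric.thickening_subset_cthickening _ _ hx)
  refine ⟨ψ, δ / 2, ⟨h1.contDiff, hK.cthickening.of_isClosed_subset (isClosed_tsupport _) hts,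
    hts.trans hδΩ⟩, by positivity, (Metric.cthickening_mono (by linarith) K).trans hδΩ,
    fun x hx => ⟨hone x hx, fun j => ?_⟩⟩
  have hev : ψ =ᶠ[𝓝 x] fun _ => 1 := by
    filter_upwards [Metric.isOpen_thickening.mem_nhds hx] with y hy using hone y hy
  rw [partialDeriv, hev.fderiv_eq]
  simp

/-- The abstract energy estimate behind both the interior and the global bound: `x` is an elastic
strain, `y` its stress, `a` the load, and `x + z` the admissible test field. Coercivity turns
orthogonality into a quadratic inequality for `‖x‖`. -/
theorem norm_le_of_inner_eq_zero {X : Type} [NormedAddCommGroup X] [InnerProductSpace ℝ X]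
    {c l : ℝ} (hc : 0 < c) (hl : 0 ≤ l) {x y z a : X} (h1 : c * ‖x‖ ^ 2 ≤ inner ℝ y x)
    (h2 : ‖y‖ ≤ l * ‖x‖) (h3 : inner ℝ (y - a) (x + z) = 0) :
    ‖x‖ ≤ ((l + 2) / c + 1) * (‖a‖ + ‖z‖) := by
  refine le_mul_of_quadratic_le hc hl (norm_nonneg a) (norm_nonneg z) ?_
  rw [inner_sub_left, inner_add_right, inner_add_right] at h3
  have h4 := neg_le_of_abs_le (abs_real_inner_le_norm y z)
  have h5 := real_inner_le_norm a x
  have h6 := real_inner_le_norm a z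
  have h7 := mul_le_mul_of_nonneg_right h2 (norm_nonneg z)
  linarith

theorem inner_diffOp {Y : Type} [NormedAddCommGroup Y] [InnerProductSpace ℝ Y] (a : Plane)
    (f g : LR Y) : inner ℝ (diffOp a f) g = inner ℝ f (tau (-a) g) - inner ℝ f g := by
  rw [diffOp_apply, inner_sub_left, inner_tau]

theorem mapOp_coercive {Y : Type} [NormedAddCommGroup Y] [InnerProductSpace ℝ Y] {L : Y →L[ℝ] Y}
    {c : ℝ} (hL : ∀ y, c * ‖y‖ ^ 2 ≤ inner ℝ (L y) y) (μ : Measure Plane) (F : Lp Y 2 μ) :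
    c * ‖F‖ ^ 2 ≤ inner ℝ (L.compLp F) F := by
  rw [← real_inner_self_eq_norm_sq, L2.inner_def, L2.inner_def, ← integral_const_mul]
  refine integral_mono_ae ((L2.integrable_inner _ _).const_mul _) (L2.integrable_inner _ _) ?_
  filter_upwards [L.coeFn_compLp F] with x hx
  rw [hx]
  simpa only [real_inner_self_eq_norm_sq] using hL (F x)

/-- The ellipticity constant of the elasticity tensor. -/
def ellipticity (lam mu : ℝ) : ℝ := min (2 * mu) (2 * (lam + mu))

theorem ellipticity_pos {lam mu : ℝ} (hmu : 0 < mu) (hlam : 0 < lam + mu) :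
    0 < ellipticity lam mu := lt_min (by linarith) (by linarith)

/-- The symmetrized gradient, as a square integrable function. -/
def symGradLp {Ω : Set Plane} (v : H1 Ω Plane) : L2 Ω Sym2x2 :=
  ∑ j, (symTensor j).compLp (H1.pd j v)

theorem coeFn_symGradLp {Ω : Set Plane} (v : H1 Ω Plane) :
    symGradLp v =ᵐ[volume.restrict Ω] symGrad v := by
  have h : ∀ j, ∀ᵐ x ∂volume.restrict Ω, ((symTensor j).compLp (H1.pd j v) : L2 Ω Sym2x2) x =
      symTensor j (H1.pd j v x) := fun j => (symTensor j).coeFn_compLp _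
  rw [symGradLp, Fin.sum_univ_two]
  filter_upwards [ae_all_iff.2 h, Lp.coeFn_add ((symTensor 0).compLp (H1.pd 0 v))
    ((symTensor 1).compLp (H1.pd 1 v))] with x hx hx'
  rw [hx', Pi.add_apply, hx, hx, symGrad, symPart_eq_sum (fun j => H1.pd j v x),
    Fin.sum_univ_two]

theorem norm_pd_le {Y : Type} [NormedAddCommGroup Y] [InnerProductSpace ℝ Y] [CompleteSpace Y]
    {Ω : Set Plane} (i : Fin 2) (v : H1 Ω Y) : ‖H1.pd i v‖ ≤ ‖v‖ :=
  (PiLp.norm_apply_le (v : H1Ambient Ω Y).snd i).trans (WithLp.norm_snd_le _ (v : H1Ambient Ω Y))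

theorem norm_fn_le {Y : Type} [NormedAddCommGroup Y] [InnerProductSpace ℝ Y] [CompleteSpace Y]
    {Ω : Set Plane} (v : H1 Ω Y) : ‖H1.fn v‖ ≤ ‖v‖ :=
  WithLp.norm_fst_le _ (v : H1Ambient Ω Y)

/-- Near the support of a cut-off function, multiplication by another cut-off function that is
equal to one does not change the difference quotients. -/
theorem mulOp_diffOp_congr {Y : Type} [NormedAddCommGroup Y] [InnerProductSpace ℝ Y]
    {Ω : Set Plane} {η : Plane → ℝ} (hη : IsTestFunction Ω η) {d : ℝ} {a : Plane} (ha : ‖a‖ < d)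
    {F G : LR Y} (h : ∀ᵐ x, x ∈ Metric.thickening d (tsupport η) → F x = G x) :
    mulOp hη (diffOp a F) = mulOp hη (diffOp a G) := by
  apply Lp.ext
  have h' := (measurePreserving_add_const a).quasiMeasurePreserving.ae h
  filter_upwards [coeFn_mulOp hη (diffOp a F), coeFn_mulOp hη (diffOp a G), coeFn_diffOp a F,
    coeFn_diffOp a G, h, h'] with x h1 h2 h3 h4 h5 h6
  rw [h1, h2, h3, h4]
  by_cases hx : x ∈ tsupport η
  · rw [h5 (Metric.self_subset_thickening ((norm_nonneg a).trans_lt ha) _ hx),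
      h6 (Metric.mem_thickening_iff.2 ⟨x, hx, by simpa using ha⟩)]
  · rw [image_eq_zero_of_notMem_tsupport hx, zero_smul, zero_smul]

/-- Localization of Sobolev functions: bound of the difference quotients. -/
theorem exists_norm_mulOp_diffOp_le {Y : Type} [NormedAddCommGroup Y] [InnerProductSpace ℝ Y]
    [CompleteSpace Y] {Ω : Set Plane} (hΩ : IsOpen Ω) {η : Plane → ℝ} (hη : IsTestFunction Ω η) :
    ∃ C d : ℝ, 0 ≤ C ∧ 0 < d ∧ ∀ (v : H1 Ω Y) (i : Fin 2), ∀ h ∈ Ioo 0 d,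
      ‖mulOp hη (diffOp (h • basisVec i) (ext hΩ.measurableSet (H1.fn v)))‖ ≤ h * (C * ‖v‖) := by
  -- A second cut-off, equal to one near the support of `η`, makes `ψ v` a Sobolev function of the
  -- whole plane. For steps shorter than `d` the localized differences of `v` and `ψ v` agree.
  obtain ⟨ψ, d, hψ, hd, -, hψ1⟩ := exists_cutoff hΩ hη.2.1 hη.2.2
  have hsum : 0 ≤ ∑ i, ‖(mulOp (hψ.pd i) : LR Y →L[ℝ] LR Y)‖ :=
    Finset.sum_nonneg fun i _ => by positivity
  refine ⟨‖(mulOp hη : LR Y →L[ℝ] LR Y)‖ * (‖(mulOp hψ : LR Y →L[ℝ] LR Y)‖ +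
    ∑ i, ‖(mulOp (hψ.pd i) : LR Y →L[ℝ] LR Y)‖), d, by positivity, hd, fun v i h hh => ?_⟩
  have hw := (v.2 i).hasWPD hΩ.measurableSet hψ
  have hnorm : ‖h • basisVec i‖ < d := by
    rw [norm_smul, norm_basisVec, mul_one, Real.norm_of_nonneg hh.1.le]
    exact hh.2
  rw [mulOp_diffOp_congr hη hnorm (F := ext hΩ.measurableSet (H1.fn v))
    (G := mulOp hψ (ext hΩ.measurableSet (H1.fn v)))]
  · refine (ContinuousLinearMap.le_opNorm _ _).trans ?_
    have h1 := norm_diffOp_le hw h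
    rw [abs_of_pos hh.1] at h1
    have h2 : ‖mulOp hψ (ext hΩ.measurableSet (H1.pd i v)) +
        mulOp (hψ.pd i) (ext hΩ.measurableSet (H1.fn v))‖ ≤
        (‖(mulOp hψ : LR Y →L[ℝ] LR Y)‖ +
          ∑ i, ‖(mulOp (hψ.pd i) : LR Y →L[ℝ] LR Y)‖) * ‖v‖ := by
      rw [add_mul]
      refine (norm_add_le _ _).trans (add_le_add ?_ ?_)
      · refine (ContinuousLinearMap.le_opNorm _ _).trans ?_
        rw [norm_ext]
        gcongr
        exact norm_pd_le i v
      · refine (ContinuousLinearMap.le_opNorm _ _).trans ?_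
        rw [norm_ext]
        gcongr
        · exact Finset.single_le_sum
            (f := fun i => ‖(mulOp (hψ.pd i) : LR Y →L[ℝ] LR Y)‖)
            (fun _ _ => by positivity) (Finset.mem_univ i)
        · exact norm_fn_le v
    calc _ ≤ ‖(mulOp hη : LR Y →L[ℝ] LR Y)‖ * (h * ((‖(mulOp hψ : LR Y →L[ℝ] LR Y)‖ +
          ∑ i, ‖(mulOp (hψ.pd i) : LR Y →L[ℝ] LR Y)‖) * ‖v‖)) := by
            gcongr
            exact h1.trans (mul_le_mul_of_nonneg_left h2 hh.1.le)
      _ = _ := by ring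
  · filter_upwards [coeFn_mulOp hψ (ext hΩ.measurableSet (H1.fn v))] with x hx hxt
    rw [hx, (hψ1 x hxt).1, one_smul]

/-- Leibniz rule for the cut-off `η²`, with `P j` in the role of the derivatives of `D`. One factor
`η` is pulled out in front, to be moved onto the stress. -/
theorem sum_mapOp_mulOp_mulOp {Y Z : Type} [NormedAddCommGroup Y] [InnerProductSpace ℝ Y]
    [NormedAddCommGroup Z] [InnerProductSpace ℝ Z] (S : Fin 2 → Y →L[ℝ] Z) {Ω : Set Plane}
    {η : Plane → ℝ} (hη : IsTestFunction Ω η) (D : LR Y) (P : Fin 2 → LR Y) :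
    ∑ j, mapOp (S j) (mulOp hη (mulOp hη (P j) + mulOp (hη.pd j) D) +
      mulOp (hη.pd j) (mulOp hη D)) =
    mulOp hη (∑ j, mapOp (S j) (mulOp hη (P j)) +
      (2 : ℝ) • ∑ j, mapOp (S j) (mulOp (hη.pd j) D)) := by
  rw [Finset.smul_sum, ← Finset.sum_add_distrib, map_sum]
  refine Finset.sum_congr rfl fun j _ => ?_
  rw [two_smul, ← map_add, ← map_add, ← mapOp_mulOp, mulOp_comm (hη.pd j) hη, ← map_add,
    ← add_assoc]

theorem sum_mapOp_mulOp_diffOp {Y Z : Type} [NormedAddCommGroup Y] [InnerProductSpace ℝ Y]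
    [NormedAddCommGroup Z] [InnerProductSpace ℝ Z] (S : Fin 2 → Y →L[ℝ] Z) {Ω Ω' : Set Plane}
    {η : Plane → ℝ} (hη : IsTestFunction Ω' η) (hΩ : MeasurableSet Ω) (a : Plane)
    (P : Fin 2 → L2 Ω Y) :
    ∑ j, mapOp (S j) (mulOp hη (diffOp a (ext hΩ (P j)))) =
      mulOp hη (diffOp a (ext hΩ (∑ j, (S j).compLp (P j)))) := by
  rw [map_sum, map_sum, map_sum]
  refine Finset.sum_congr rfl fun j _ => ?_
  rw [mapOp_mulOp, mapOp_diffOp, mapOp_ext]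

theorem sub_map_mulOp_diffOp_ext {Y : Type} [NormedAddCommGroup Y] [InnerProductSpace ℝ Y]
    (L : Y →L[ℝ] Y) {Ω Ω' : Set Plane}
    {η : Plane → ℝ} (hη : IsTestFunction Ω' η) (hΩ : MeasurableSet Ω) (a : Plane) (e χ : L2 Ω Y) :
    mapOp L (mulOp hη (diffOp a (ext hΩ e))) - mulOp hη (diffOp a (ext hΩ χ)) =
      mulOp hη (diffOp a (ext hΩ (L.compLp e - χ))) := by
  rw [map_sub, map_sub, map_sub, mapOp_mulOp, mapOp_diffOp, mapOp_ext]

/-- Discrete integration by parts: the difference is moved from `f` onto `Z`, so it suffices that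
`f` be orthogonal to `Z` and to one translate of it. -/
theorem inner_mulOp_diffOp_eq_zero {Y : Type} [NormedAddCommGroup Y] [InnerProductSpace ℝ Y]
    {Ω : Set Plane} {η : Plane → ℝ} (hη : IsTestFunction Ω η) (a : Plane) {f g Z : LR Y}
    (hZ : Z = mulOp hη g) (h1 : inner ℝ f Z = 0) (h2 : inner ℝ f (tau (-a) Z) = 0) :
    inner ℝ (mulOp hη (diffOp a f)) g = 0 := by
  rw [inner_mulOp, ← hZ, inner_diffOp, h1, h2, sub_zero]

theorem norm_sum_mapOp_le {Y Z : Type} [NormedAddCommGroup Y] [InnerProductSpace ℝ Y]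
    [NormedAddCommGroup Z] [InnerProductSpace ℝ Z] (S : Fin 2 → Y →L[ℝ] Z) (F : Fin 2 → LR Y) :
    ‖∑ j, mapOp (S j) (F j)‖ ≤ ∑ j, ‖S j‖ * ‖F j‖ :=
  (norm_sum_le _ _).trans (Finset.sum_le_sum fun j _ => (S j).norm_compLp_le (F j))

theorem norm_add_two_smul_le {X : Type} [NormedAddCommGroup X] [NormedSpace ℝ X] (x y : X) :
    ‖x + (2 : ℝ) • y‖ ≤ ‖x‖ + 2 * ‖y‖ := by
  refine (norm_add_le _ _).trans ?_
  rw [norm_smul, Real.norm_of_nonneg (by norm_num : (0 : ℝ) ≤ 2)]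

set_option maxHeartbeats 1600000 in
/-- The interior estimate for the difference quotients of the strain. -/
theorem interior_estimate {Ω : Set Plane} (hΩ : IsOpen Ω) {η : Plane → ℝ}
    (hη : IsTestFunction Ω η) {lam mu : ℝ} (hmu : 0 < mu) (hlam : 0 < lam + mu) :
    ∃ K d : ℝ, 0 ≤ K ∧ 0 < d ∧ ∀ (v : H1 Ω Plane) (e q χ : L2 Ω Sym2x2),
      symGradLp v = e + q → HasWeakDiv Ω (stress lam mu e - χ) 0 →
      ∀ (i : Fin 2), ∀ h ∈ Ioo 0 d,
        ‖mulOp hη (diffOp (h • basisVec i) (ext hΩ.measurableSet e))‖ ≤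
          K * (‖mulOp hη (diffOp (h • basisVec i) (ext hΩ.measurableSet χ))‖ +
            ‖mulOp hη (diffOp (h • basisVec i) (ext hΩ.measurableSet q))‖ + h * ‖v‖) := by
  obtain ⟨ψ, d, hψ, hd, hdΩ, hψ1⟩ := exists_cutoff hΩ hη.2.1 hη.2.2
  choose C d' hC hd' hCd using fun j : Fin 2 =>
    exists_norm_mulOp_diffOp_le (Y := Plane) hΩ (hη.pd j)
  set c := ellipticity lam mu
  have hc : 0 < c := ellipticity_pos hmu hlam
  set l := ‖elasticity lam mu‖
  set B := ∑ j, ‖symTensor j‖ * C j with hB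
  have hB0 : 0 ≤ B := Finset.sum_nonneg fun j _ => by have := hC j; positivity
  have hl : 0 ≤ l := ContinuousLinearMap.opNorm_nonneg _
  -- The first factor comes from the energy estimate. The constant `B` bounds the term in which a
  -- derivative falls on `η`, and the factor 2 comes from differentiating `η²`.
  refine ⟨((l + 2) / c + 1) * (1 + 2 * B), min d (min (d' 0) (d' 1)), by positivity,
    lt_min hd (lt_min (hd' 0) (hd' 1)), fun v e q χ hv hdiv i h hh => ?_⟩
  have hΩm := hΩ.measurableSet
  set a : Plane := h • basisVec i
  have hna : ‖a‖ = h := by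
    rw [norm_smul, norm_basisVec, mul_one, Real.norm_of_nonneg hh.1.le]
  have had : ‖a‖ < d := hna.trans_lt (hh.2.trans_le (min_le_left _ _))
  have hhd' : ∀ j, h ∈ Ioo 0 (d' j) := by
    intro j
    refine ⟨hh.1, hh.2.trans_le ((min_le_right _ _).trans ?_)⟩
    fin_cases j
    · exact min_le_left _ _
    · exact min_le_right _ _
  -- the localized displacement and its weak derivatives
  set V : LR Plane := mulOp hψ (ext hΩm (H1.fn v))
  set Vd : Fin 2 → LR Plane := fun j =>
    mulOp hψ (ext hΩm (H1.pd j v)) + mulOp (hψ.pd j) (ext hΩm (H1.fn v))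
  have hV : ∀ j, HasWPD j V (Vd j) := fun j => (v.2 j).hasWPD hΩm hψ
  have hVeq : ∀ j, mulOp (hη.pd j) (diffOp a V) =
      mulOp (hη.pd j) (diffOp a (ext hΩm (H1.fn v))) := by
    intro j
    refine mulOp_diffOp_congr (hη.pd j) had ?_
    filter_upwards [coeFn_mulOp hψ (ext hΩm (H1.fn v))] with x hx hxt
    rw [hx, (hψ1 x (Metric.thickening_subset_of_subset d (tsupport_partialDeriv_subset j η)
      hxt)).1, one_smul]
  have hVdeq : ∀ j, mulOp hη (diffOp a (Vd j)) =
      mulOp hη (diffOp a (ext hΩm (H1.pd j v))) := by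
    intro j
    refine mulOp_diffOp_congr hη had ?_
    filter_upwards [coeFn_mulOp hψ (ext hΩm (H1.pd j v)),
      coeFn_mulOp (hψ.pd j) (ext hΩm (H1.fn v)), Lp.coeFn_add (mulOp hψ (ext hΩm (H1.pd j v)))
      (mulOp (hψ.pd j) (ext hΩm (H1.fn v)))] with x h1 h2 h3 hxt
    rw [h3, Pi.add_apply, h1, h2, (hψ1 x hxt).1, (hψ1 x hxt).2 j, one_smul, zero_smul, add_zero]
  -- the test function
  set g : LR Plane := mulOp hη (mulOp hη (diffOp a V))
  set gd : Fin 2 → LR Plane := fun j =>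
    mulOp hη (mulOp hη (diffOp a (Vd j)) + mulOp (hη.pd j) (diffOp a V)) +
      mulOp (hη.pd j) (mulOp hη (diffOp a V))
  have hg : ∀ j, HasWPD j g (gd j) := fun j => (((hV j).diffOp a).mulOp hη).mulOp hη
  have hgsupp : ∀ᵐ x, x ∉ tsupport η → g x = 0 := by
    filter_upwards [coeFn_mulOp hη (mulOp hη (diffOp a V))] with x hx hxt
    rw [hx, image_eq_zero_of_notMem_tsupport hxt, zero_smul]
  have hgsupp' : ∀ᵐ x, x ∉ Metric.cthickening d (tsupport η) → tau (-a) g x = 0 := by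
    have h1 := (measurePreserving_add_const (-a)).quasiMeasurePreserving.ae hgsupp
    filter_upwards [coeFn_tau (-a) g, h1] with x hx hx' hxt
    rw [hx, hx' fun hmem => hxt (Metric.mem_cthickening_of_dist_le _ _ _ _ hmem ?_)]
    simpa [dist_eq_norm] using had.le
  -- The test field and its translate are both supported in compact subsets of `Ω`, the second
  -- because the step is shorter than `d`. Both are therefore orthogonal to the divergence-free
  -- stress.
  have o1 := inner_ext_symGrad_eq_zero hΩ hdiv hg hη.2.1 hη.2.2 hgsupp
  have o2 := inner_ext_symGrad_eq_zero hΩ hdiv (fun j => (hg j).tau (-a)) hη.2.1.cthickening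
    hdΩ hgsupp'
  set W : LR Sym2x2 := ∑ j, mapOp (symTensor j) (mulOp (hη.pd j) (diffOp a V)) with hW
  set X : LR Sym2x2 := mulOp hη (diffOp a (ext hΩm e))
  set Q : LR Sym2x2 := mulOp hη (diffOp a (ext hΩm q))
  set A : LR Sym2x2 := mulOp hη (diffOp a (ext hΩm χ))
  -- Kinematic compatibility passes to localized differences: near the support of `η` the
  -- derivatives of `ψ v` are those of `v`.
  have hXQ : X + Q = ∑ j, mapOp (symTensor j) (mulOp hη (diffOp a (Vd j))) := by
    simp_rw [hVdeq]
    refine Eq.trans ?_ (sum_mapOp_mulOp_diffOp symTensor hη hΩm a (fun j => H1.pd j v)).symm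
    change _ = mulOp hη (diffOp a (ext hΩm (symGradLp v)))
    rw [hv, map_add, map_add, map_add]
  have hZ : ∑ j, mapOp (symTensor j) (gd j) = mulOp hη (X + (Q + (2 : ℝ) • W)) := by
    rw [← add_assoc, hXQ]
    exact sum_mapOp_mulOp_mulOp symTensor hη (diffOp a V) fun j => diffOp a (Vd j)
  have hX : ‖X‖ ≤ ((l + 2) / c + 1) * (‖A‖ + ‖Q + (2 : ℝ) • W‖) := by
    refine norm_le_of_inner_eq_zero (X := LR Sym2x2) (y := mapOp (elasticity lam mu) X) hc hl
      (mapOp_coercive (elasticity_coercive lam mu) volume X)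
      ((elasticity lam mu).norm_compLp_le X) ?_
    have h1 : mapOp (elasticity lam mu) X - A =
        mulOp hη (diffOp a (ext hΩm (stress lam mu e - χ))) :=
      sub_map_mulOp_diffOp_ext (elasticity lam mu) hη hΩm a e χ
    rw [h1]
    refine inner_mulOp_diffOp_eq_zero hη a hZ o1 ?_
    have h2 : tau (-a) (∑ j, mapOp (symTensor j) (gd j)) =
        ∑ j, mapOp (symTensor j) (tau (-a) (gd j)) := by
      rw [map_sum]
      exact Finset.sum_congr rfl fun j _ => (mapOp_tau (symTensor j) (-a) (gd j)).symm
    rw [h2]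
    exact o2
  have hWB : ‖W‖ ≤ B * (h * ‖v‖) := by
    rw [hB, Finset.sum_mul]
    refine (norm_sum_mapOp_le symTensor _).trans (Finset.sum_le_sum fun j _ => ?_)
    rw [mul_assoc]
    refine mul_le_mul_of_nonneg_left ?_ (by positivity)
    rw [hVeq j]
    refine (hCd j v i h (hhd' j)).trans (le_of_eq ?_)
    ring
  have hQW : ‖Q + (2 : ℝ) • W‖ ≤ ‖Q‖ + 2 * (B * (h * ‖v‖)) :=
    (norm_add_two_smul_le (X := LR Sym2x2) Q W).trans (by linarith)
  refine hX.trans ?_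
  rw [mul_assoc]
  gcongr
  have h1 : 0 ≤ h * ‖v‖ := mul_nonneg hh.1.le (norm_nonneg v)
  nlinarith [mul_nonneg hB0 (norm_nonneg A), mul_nonneg hB0 (norm_nonneg Q)]

end InteriorEstimate

/-! ### Functions with zero boundary values: Poincaré and Korn inequalities -/

section ZeroBoundary

theorem partialDeriv_comm {φ : Plane → ℝ} (hφ : ContDiff ℝ ∞ φ) (i j : Fin 2) (x : Plane) :
    partialDeriv i (partialDeriv j φ) x = partialDeriv j (partialDeriv i φ) x := by
  have hd : DifferentiableAt ℝ (fderiv ℝ φ) x :=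
    (hφ.fderiv_right (m := ∞) (by simp)).differentiable (by simp) x
  have key : ∀ i j, partialDeriv i (partialDeriv j φ) x =
      fderiv ℝ (fderiv ℝ φ) x (basisVec i) (basisVec j) := by
    intro i j
    change fderiv ℝ (fun y => fderiv ℝ φ y (basisVec j)) x (basisVec i) = _
    rw [fderiv_clm_apply hd (differentiableAt_const _)]
    simp
  rw [key, key]
  have h2 : minSmoothness ℝ 2 ≤ ((⊤ : ℕ∞) : WithTop ℕ∞) := by
    rw [minSmoothness_of_isRCLikeNormedField]
    exact WithTop.coe_le_coe.2 le_top
  exact (hφ.contDiffAt.isSymmSndFDerivAt h2) _ _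

theorem IsTestFunction.integrable_mul {Ω Ω' : Set Plane} {φ ψ : Plane → ℝ}
    (hφ : IsTestFunction Ω φ) (hψ : IsTestFunction Ω' ψ) :
    Integrable (fun x => φ x * ψ x) (volume : Measure Plane) :=
  (hφ.1.continuous.mul hψ.1.continuous).integrable_of_hasCompactSupport hφ.2.1.mul_right

theorem integral_mul_partialDeriv {Ω Ω' : Set Plane} {φ ψ : Plane → ℝ}
    (hφ : IsTestFunction Ω φ) (hψ : IsTestFunction Ω' ψ) (i : Fin 2) :
    ∫ x, φ x * partialDeriv i ψ x = - ∫ x, partialDeriv i φ x * ψ x :=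
  integral_mul_fderiv_eq_neg_fderiv_mul_of_integrable ((hφ.pd i).integrable_mul hψ)
    (hφ.integrable_mul (hψ.pd i)) (hφ.integrable_mul hψ) (fun x _ => hφ.differentiable x)
    (fun x _ => hψ.differentiable x)

/-- Two integrations by parts and the symmetry of second derivatives exchange `i` and `j`. This is
the identity behind Korn's inequality. -/
theorem integral_partialDeriv_mul_partialDeriv {Ω Ω' : Set Plane} {φ ψ : Plane → ℝ}
    (hφ : IsTestFunction Ω φ) (hψ : IsTestFunction Ω' ψ) (i j : Fin 2) :
    ∫ x, partialDeriv i φ x * partialDeriv j ψ x =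
      ∫ x, partialDeriv j φ x * partialDeriv i ψ x := by
  have h1 := integral_mul_partialDeriv hφ (hψ.pd j) i
  have h2 := integral_mul_partialDeriv hφ (hψ.pd i) j
  simp_rw [partialDeriv_comm hψ.1 i j] at h1
  linarith

/-- Poincaré inequality for test functions. -/
theorem integral_sq_le_integral_partialDeriv_sq {Ω : Set Plane} {R : ℝ}
    (hR : ∀ x ∈ Ω, ‖x‖ ≤ R) {φ : Plane → ℝ} (hφ : IsTestFunction Ω φ) :
    ∫ x, φ x * φ x ≤ 4 * R ^ 2 * ∫ x, partialDeriv 0 φ x * partialDeriv 0 φ x := by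
  have hφ2 : IsTestFunction Ω (fun x => φ x * φ x) := (hφ.mul hφ).mono inter_subset_left
  let c : Plane →L[ℝ] ℝ := EuclideanSpace.proj 0
  have hcs : ∀ ψ : Plane → ℝ, IsTestFunction Ω ψ → Integrable (fun x => ψ x * c x) volume :=
    fun ψ hψ => (hψ.1.continuous.mul c.continuous).integrable_of_hasCompactSupport
      hψ.2.1.mul_right
  have hc1 : ∀ x, fderiv ℝ c x (basisVec 0) = 1 := fun x => by
    rw [c.fderiv]; simp [c, basisVec]
  -- Integration by parts against the coordinate `c`, whose derivative is one. Young's inequality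
  -- and `|c| ≤ R` leave `φ²/2 + 2 R² (∂φ)²`, and absorbing the first term gives `4 R²`.
  have h1 : ∫ x, (φ x * φ x) * fderiv ℝ c x (basisVec 0) =
      - ∫ x, partialDeriv 0 (fun x => φ x * φ x) x * c x := by
    refine integral_mul_fderiv_eq_neg_fderiv_mul_of_integrable (hcs _ (hφ2.pd 0)) ?_ (hcs _ hφ2)
      (fun x _ => hφ2.differentiable x) (fun x _ => c.differentiableAt)
    simp_rw [hc1, mul_one]
    exact hφ.integrable_mul hφ
  simp_rw [hc1, mul_one] at h1
  have h2 : - ∫ x, partialDeriv 0 (fun x => φ x * φ x) x * c x ≤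
      ∫ x, ((1 / 2) * (φ x * φ x) + (2 * R ^ 2) * (partialDeriv 0 φ x * partialDeriv 0 φ x)) := by
    rw [← integral_neg]
    refine integral_mono (hcs _ (hφ2.pd 0)).neg
      (((hφ.integrable_mul hφ).const_mul _).add
        (((hφ.pd 0).integrable_mul (hφ.pd 0)).const_mul _)) fun x => ?_
    simp only [partialDeriv_mul hφ.differentiable hφ.differentiable]
    by_cases hx : x ∈ Ω
    · have hcx : |c x| ≤ R := by
        refine le_trans ?_ (hR x hx)
        exact PiLp.norm_apply_le x 0
      have hsq : c x ^ 2 ≤ R ^ 2 := sq_le_sq' (by linarith [neg_le_of_abs_le hcx])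
        ((le_abs_self _).trans hcx)
      nlinarith [sq_nonneg (φ x + 2 * (c x * partialDeriv 0 φ x)),
        mul_le_mul_of_nonneg_right hsq (sq_nonneg (partialDeriv 0 φ x))]
    · have : φ x = 0 := image_eq_zero_of_notMem_tsupport fun h => hx (hφ.2.2 h)
      rw [this]
      nlinarith [mul_nonneg (sq_nonneg R) (sq_nonneg (partialDeriv 0 φ x))]
  rw [integral_add ((hφ.integrable_mul hφ).const_mul _)
    (((hφ.pd 0).integrable_mul (hφ.pd 0)).const_mul _), integral_const_mul,
    integral_const_mul] at h2
  linarith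

theorem eq_zero_of_integral_test_smul {Y : Type} [NormedAddCommGroup Y] [InnerProductSpace ℝ Y]
    [CompleteSpace Y] {Ω : Set Plane} (hΩ : IsOpen Ω) {g : L2 Ω Y}
    (h : ∀ φ : Plane → ℝ, IsTestFunction Ω φ → ∫ x in Ω, φ x • g x = 0) : g = 0 := by
  apply Lp.ext
  have hl : LocallyIntegrableOn g Ω volume :=
    locallyIntegrableOn_of_locallyIntegrable_restrict
      ((Lp.memLp g).locallyIntegrable (by norm_num))
  have h1 := hΩ.ae_eq_zero_of_integral_contDiff_smul_eq_zero hl fun φ h1 h2 h3 => by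
    rw [← h φ ⟨h1, h2, h3⟩]
    refine (setIntegral_eq_integral_of_forall_compl_eq_zero fun x hx => ?_).symm
    rw [image_eq_zero_of_notMem_tsupport fun h => hx (h3 h), zero_smul]
  filter_upwards [(ae_restrict_iff' hΩ.measurableSet).2 h1,
    Lp.coeFn_zero Y 2 (volume.restrict Ω)] with x hx hx'
  rw [hx, hx', Pi.zero_apply]

theorem IsWeakPartial.unique {Y : Type} [NormedAddCommGroup Y] [InnerProductSpace ℝ Y]
    [CompleteSpace Y] {Ω : Set Plane} (hΩ : IsOpen Ω) {i : Fin 2} {f g g' : L2 Ω Y}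
    (h : IsWeakPartial Ω i f g) (h' : IsWeakPartial Ω i f g') : g = g' := by
  rw [← sub_eq_zero]
  refine eq_zero_of_integral_test_smul hΩ fun φ hφ => ?_
  have h1 := isWeakPartial_iff.1 h φ hφ
  have h2 := isWeakPartial_iff.1 h' φ hφ
  rw [← weightedIntegral_apply Ω φ hφ.memLp, map_sub, sub_eq_zero]
  exact add_left_cancel (h1.trans h2.symm)

section TestFields

variable {Y : Type} [NormedAddCommGroup Y] [InnerProductSpace ℝ Y] [CompleteSpace Y]

theorem H1.pd_eq_fderiv {Ω : Set Plane} (hΩ : IsOpen Ω) {v : H1 Ω Y} {φ : Plane → Y}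
    (hφ : IsTestFunction Ω φ) (hv : H1.fn v =ᵐ[volume.restrict Ω] φ) (j : Fin 2) :
    H1.pd j v =ᵐ[volume.restrict Ω] fun x => fderiv ℝ φ x (basisVec j) := by
  have hdc : Continuous fun x => fderiv ℝ φ x (basisVec j) :=
    (hφ.1.continuous_fderiv (by simp)).clm_apply continuous_const
  have hdm : MemLp (fun x => fderiv ℝ φ x (basisVec j)) 2 (volume.restrict Ω) :=
    (hdc.memLp_of_hasCompactSupport (hφ.2.1.fderiv_apply ℝ (basisVec j))).restrict Ω
  have hdiff : Differentiable ℝ φ := hφ.1.differentiable (by simp)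
  have hw : IsWeakPartial Ω j (H1.fn v) (hdm.toLp _) := by
    intro ψ hψ
    have e1 : ∫ x in Ω, partialDeriv j ψ x • H1.fn v x = ∫ x, partialDeriv j ψ x • φ x := by
      rw [← setIntegral_eq_integral_of_forall_compl_eq_zero (s := Ω)
        (f := fun x => partialDeriv j ψ x • φ x)
        fun x hx => by rw [image_eq_zero_of_notMem_tsupport fun h => hx ((hψ.pd j).2.2 h),
          zero_smul]]
      refine integral_congr_ae ?_
      filter_upwards [hv] with x hx
      rw [hx]
    have e2 : ∫ x in Ω, ψ x • hdm.toLp (fun x => fderiv ℝ φ x (basisVec j)) x =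
        ∫ x, ψ x • fderiv ℝ φ x (basisVec j) := by
      rw [← setIntegral_eq_integral_of_forall_compl_eq_zero (s := Ω)
        (f := fun x => ψ x • fderiv ℝ φ x (basisVec j))
        fun x hx => by rw [image_eq_zero_of_notMem_tsupport fun h => hx (hψ.2.2 h), zero_smul]]
      refine integral_congr_ae ?_
      filter_upwards [hdm.coeFn_toLp] with x hx
      rw [hx]
    have i1 : ∀ {ψ : Plane → ℝ} {φ : Plane → Y}, IsTestFunction Ω ψ → Continuous φ →
        Integrable (fun x => ψ x • φ x) volume := fun hψ hφ =>
      (hψ.1.continuous.smul hφ).integrable_of_hasCompactSupport hψ.2.1.smul_right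
    rw [e1, e2, integral_smul_fderiv_eq_neg_fderiv_smul_of_integrable
      (i1 (hψ.pd j) hφ.1.continuous) (i1 hψ hdc) (i1 hψ hφ.1.continuous)
      (fun x _ => hψ.differentiable x) (fun x _ => hdiff x), neg_neg]
    rfl
  have h : H1.pd j v = hdm.toLp _ := IsWeakPartial.unique hΩ (v.2 j) hw
  rw [h]
  exact hdm.coeFn_toLp

end TestFields

theorem IsTestFunction.component {Ω : Set Plane} {φ : Plane → Plane} (hφ : IsTestFunction Ω φ)
    (i : Fin 2) : IsTestFunction Ω (fun x => φ x i) := by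
  have h1 : ContDiff ℝ ∞ (fun x => φ x i) :=
    (EuclideanSpace.proj i : Plane →L[ℝ] ℝ).contDiff.comp hφ.1
  have h2 : HasCompactSupport (fun x => φ x i) := hφ.2.1.comp_left (g := fun a : Plane => a i) rfl
  exact ⟨h1, h2, (closure_mono (Function.support_comp_subset (g := fun a : Plane => a i) rfl φ)).trans
    hφ.2.2⟩

theorem partialDeriv_component {φ : Plane → Plane} (hφ : Differentiable ℝ φ) (i j : Fin 2)
    (x : Plane) : partialDeriv j (fun x => φ x i) x = (fderiv ℝ φ x (basisVec j)) i := by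
  have h1 := (EuclideanSpace.proj i : Plane →L[ℝ] ℝ).hasFDerivAt.comp x
    (hφ x).hasFDerivAt
  have h2 : HasFDerivAt (fun x => φ x i)
    ((EuclideanSpace.proj i : Plane →L[ℝ] ℝ).comp (fderiv ℝ φ x)) x := h1
  rw [partialDeriv, h2.fderiv]
  rfl

theorem norm_sq_eq_integral {Ω : Set Plane} (f : L2 Ω Plane) :
    ‖f‖ ^ 2 = ∫ x in Ω, ∑ i, f x i * f x i := by
  rw [← real_inner_self_eq_norm_sq, L2.inner_def]
  refine integral_congr_ae (Eventually.of_forall fun x => ?_)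
  simp only [PiLp.inner_apply, RCLike.inner_apply, conj_trivial]

theorem norm_sq_eq {Y : Type} [NormedAddCommGroup Y] [InnerProductSpace ℝ Y] [CompleteSpace Y]
    {Ω : Set Plane} (v : H1 Ω Y) : ‖v‖ ^ 2 = ‖H1.fn v‖ ^ 2 + ∑ j, ‖H1.pd j v‖ ^ 2 := by
  have h1 : ‖v‖ ^ 2 = ‖(v : H1Ambient Ω Y).fst‖ ^ 2 + ‖(v : H1Ambient Ω Y).snd‖ ^ 2 :=
    WithLp.prod_norm_sq_eq_of_L2 (v : H1Ambient Ω Y)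
  rw [h1, PiLp.norm_sq_eq_of_L2]
  rfl

theorem integral_restrict_mul_eq {Ω : Set Plane} {φ ψ : Plane → ℝ} (hφ : IsTestFunction Ω φ) :
    ∫ x in Ω, φ x * ψ x = ∫ x, φ x * ψ x :=
  setIntegral_eq_integral_of_forall_compl_eq_zero fun x hx => by
    rw [image_eq_zero_of_notMem_tsupport fun h => hx (hφ.2.2 h), zero_mul]

theorem norm_symGradLp_sq {Ω : Set Plane} (v : H1 Ω Plane) :
    ‖symGradLp v‖ ^ 2 = ∫ x in Ω, ((H1.pd 0 v x 0) * (H1.pd 0 v x 0) +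
      (H1.pd 1 v x 1) * (H1.pd 1 v x 1) + (1 / 2) * ((H1.pd 1 v x 0) * (H1.pd 1 v x 0)) +
      (1 / 2) * ((H1.pd 0 v x 1) * (H1.pd 0 v x 1)) + (H1.pd 0 v x 1) * (H1.pd 1 v x 0)) := by
  have h : ‖symGradLp v‖ ^ 2 = ∫ x in Ω, inner ℝ (symGradLp v x) (symGradLp v x) := by
    rw [← L2.inner_def]
    exact (real_inner_self_eq_norm_sq (F := L2 Ω Sym2x2) _).symm
  rw [h]
  refine integral_congr_ae ?_
  filter_upwards [coeFn_symGradLp v] with x hx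
  rw [hx, inner_sym]
  simp only [Fin.sum_univ_two, symGrad, entry_symPart]
  ring

/-- Korn's and Poincaré's inequality for functions that agree with a test function. -/
theorem norm_sq_le_symGradLp_of_test {Ω : Set Plane} (hΩ : IsOpen Ω) {R : ℝ}
    (hR : ∀ x ∈ Ω, ‖x‖ ≤ R) {v : H1 Ω Plane} {φ : Plane → Plane} (hφ : IsTestFunction Ω φ)
    (hv : H1.fn v =ᵐ[volume.restrict Ω] φ) :
    ‖v‖ ^ 2 ≤ (8 * R ^ 2 + 2) * ‖symGradLp v‖ ^ 2 := by
  have hc := hφ.component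
  have hpd : ∀ i j, (fun x => H1.pd j v x i) =ᵐ[volume.restrict Ω]
      partialDeriv j (fun x => φ x i) := by
    intro i j
    filter_upwards [H1.pd_eq_fderiv hΩ hφ hv j] with x hx
    rw [partialDeriv_component (hφ.1.differentiable (by simp)), hx]
  have hint : ∀ i j k l, Integrable (fun x => partialDeriv j (fun x => φ x i) x *
      partialDeriv l (fun x => φ x k) x) (volume.restrict Ω) := fun i j k l =>
    (((hc i).pd j).integrable_mul ((hc k).pd l)).restrict
  have hint0 : ∀ i, Integrable (fun x => φ x i * φ x i) (volume.restrict Ω) := fun i =>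
    ((hc i).integrable_mul (hc i)).restrict
  set I : Fin 2 → Fin 2 → ℝ := fun i j => ∫ x, partialDeriv j (fun x => φ x i) x *
    partialDeriv j (fun x => φ x i) x with hI
  have e0 : ‖H1.fn v‖ ^ 2 = ∑ i, ∫ x, φ x i * φ x i := by
    rw [norm_sq_eq_integral]
    have : ∀ i, ∫ x, φ x i * φ x i = ∫ x in Ω, φ x i * φ x i := fun i =>
      (integral_restrict_mul_eq (hc i)).symm
    simp_rw [this]
    rw [← integral_finsetSum _ fun i _ => hint0 i]
    refine integral_congr_ae ?_
    filter_upwards [hv] with x hx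
    simp only [hx]
  have e1 : ∀ j, ‖H1.pd j v‖ ^ 2 = ∑ i, I i j := by
    intro j
    rw [norm_sq_eq_integral]
    have : ∀ i, I i j = ∫ x in Ω, partialDeriv j (fun x => φ x i) x *
        partialDeriv j (fun x => φ x i) x := fun i =>
      (integral_restrict_mul_eq ((hc i).pd j)).symm
    simp_rw [this]
    rw [← integral_finsetSum _ fun i _ => hint i j i j]
    refine integral_congr_ae ?_
    filter_upwards [hpd 0 j, hpd 1 j] with x hx hx'
    simp only [Fin.sum_univ_two, hx, hx']
  have e2 : ‖symGradLp v‖ ^ 2 = I 0 0 + I 1 1 + (1 / 2) * I 0 1 + (1 / 2) * I 1 0 +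
      ∫ x, partialDeriv 0 (fun x => φ x 1) x * partialDeriv 1 (fun x => φ x 0) x := by
    rw [norm_symGradLp_sq]
    have : ∀ i j, I i j = ∫ x in Ω, partialDeriv j (fun x => φ x i) x *
        partialDeriv j (fun x => φ x i) x := fun i j =>
      (integral_restrict_mul_eq ((hc i).pd j)).symm
    have i5 : ∀ {a b c d k : Plane → ℝ}, Integrable a (volume.restrict Ω) →
        Integrable b (volume.restrict Ω) → Integrable c (volume.restrict Ω) →
        Integrable d (volume.restrict Ω) → Integrable k (volume.restrict Ω) →
        (∫ x in Ω, a x) + (∫ x in Ω, b x) + (1 / 2) * (∫ x in Ω, c x) +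
          (1 / 2) * (∫ x in Ω, d x) + ∫ x in Ω, k x =
        ∫ x in Ω, (a x + b x + (1 / 2) * c x + (1 / 2) * d x + k x) := by
      intro a b c d k ha hb hc hd hk
      have h1 : Integrable (fun x => a x + b x) (volume.restrict Ω) := ha.add hb
      have h2 : Integrable (fun x => a x + b x + (1 / 2) * c x) (volume.restrict Ω) :=
        h1.add (hc.const_mul _)
      have h3 : Integrable (fun x => a x + b x + (1 / 2) * c x + (1 / 2) * d x)
        (volume.restrict Ω) := h2.add (hd.const_mul _)
      rw [integral_add h3 hk, integral_add h2 (hd.const_mul _), integral_add h1 (hc.const_mul _),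
        integral_add ha hb, integral_const_mul, integral_const_mul]
    rw [this, this, this, this, ← integral_restrict_mul_eq ((hc 1).pd 0),
      i5 (hint 0 0 0 0) (hint 1 1 1 1) (hint 0 1 0 1) (hint 1 0 1 0) (hint 1 0 0 1)]
    refine integral_congr_ae ?_
    filter_upwards [hpd 0 0, hpd 0 1, hpd 1 0, hpd 1 1] with x h1 h2 h3 h4
    simp only [h1, h2, h3, h4]
  -- After the exchange of derivatives the cross term is the integral of `∂₀φ₀ ∂₁φ₁`, which costs at
  -- most half of the diagonal terms. Hence the full gradient is bounded by `√2` times the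
  -- symmetrized one, and Poincaré's inequality adds the `8 R²`.
  have e3 : -((1 / 2) * I 0 0 + (1 / 2) * I 1 1) ≤
      ∫ x, partialDeriv 0 (fun x => φ x 1) x * partialDeriv 1 (fun x => φ x 0) x := by
    rw [integral_partialDeriv_mul_partialDeriv (hc 1) (hc 0), hI]
    simp only
    rw [← integral_const_mul, ← integral_const_mul, ← integral_add
      ((((hc 0).pd 0).integrable_mul ((hc 0).pd 0)).const_mul _)
      ((((hc 1).pd 1).integrable_mul ((hc 1).pd 1)).const_mul _), ← integral_neg]
    refine integral_mono (((((hc 0).pd 0).integrable_mul ((hc 0).pd 0)).const_mul _).add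
      ((((hc 1).pd 1).integrable_mul ((hc 1).pd 1)).const_mul _)).neg
      (((hc 1).pd 1).integrable_mul ((hc 0).pd 0)) fun x => ?_
    simp only
    nlinarith [sq_nonneg (partialDeriv 0 (fun x => φ x 0) x + partialDeriv 1 (fun x => φ x 1) x)]
  have e4 := integral_sq_le_integral_partialDeriv_sq hR (hc 0)
  have e5 := integral_sq_le_integral_partialDeriv_sq hR (hc 1)
  have hIn : ∀ i j, 0 ≤ I i j := fun i j => integral_nonneg fun x => mul_self_nonneg _
  rw [norm_sq_eq, e0, Fin.sum_univ_two, Fin.sum_univ_two, e1, e1, Fin.sum_univ_two,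
    Fin.sum_univ_two, e2]
  have hR2 := sq_nonneg R
  change _ ≤ 4 * R ^ 2 * I 0 0 at e4
  change _ ≤ 4 * R ^ 2 * I 1 0 at e5
  have := hIn 0 0
  have := hIn 0 1
  have := hIn 1 0
  have := hIn 1 1
  nlinarith [mul_nonneg hR2 (hIn 0 0), mul_nonneg hR2 (hIn 0 1), mul_nonneg hR2 (hIn 1 0),
    mul_nonneg hR2 (hIn 1 1), mul_le_mul_of_nonneg_left e3 hR2]

theorem continuous_symGradLp {Ω : Set Plane} :
    Continuous (symGradLp : H1 Ω Plane → L2 Ω Sym2x2) :=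
  continuous_finsetSum _ fun j _ =>
    ((symTensor j).compLpL 2 (volume.restrict Ω)).continuous.comp (H1.continuous_pd j)

/-- Korn's and Poincaré's inequality for functions with zero boundary values. -/
theorem norm_sq_le_symGradLp {Ω : Set Plane} (hΩ : IsOpen Ω) {R : ℝ} (hR : ∀ x ∈ Ω, ‖x‖ ≤ R)
    {v : H1 Ω Plane} (hv : v ∈ H10 Ω Plane) :
    ‖v‖ ^ 2 ≤ (8 * R ^ 2 + 2) * ‖symGradLp v‖ ^ 2 := by
  have hn : Continuous fun v : H1 Ω Plane => ‖symGradLp v‖ :=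
    Continuous.norm (E := L2 Ω Sym2x2) continuous_symGradLp
  have hcl : IsClosed {v : H1 Ω Plane | ‖v‖ ^ 2 ≤ (8 * R ^ 2 + 2) * ‖symGradLp v‖ ^ 2} :=
    isClosed_le (continuous_norm.pow 2)
      (continuous_const.mul (hn.pow 2))
  refine closure_minimal ?_ hcl hv
  rintro v ⟨φ, hφ, hv⟩
  exact norm_sq_le_symGradLp_of_test hΩ hR hφ hv

theorem exists_norm_le_symGradLp {Ω : Set Plane} (hΩ : IsOpen Ω) (hb : Bornology.IsBounded Ω) :
    ∃ C : ℝ, 0 ≤ C ∧ ∀ v ∈ H10 Ω Plane, ‖v‖ ≤ C * ‖symGradLp v‖ := by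
  obtain ⟨R, hR⟩ := hb.exists_norm_le
  refine ⟨√(8 * R ^ 2 + 2), Real.sqrt_nonneg _, fun v hv => ?_⟩
  refine abs_le_of_sq_le_sq' ?_ (by positivity) |>.2
  rw [mul_pow, Real.sq_sqrt (by positivity)]
  exact norm_sq_le_symGradLp hΩ hR hv

theorem inner_symGradLp_eq_zero_of_test {Ω : Set Plane} (hΩ : IsOpen Ω) {θ : L2 Ω Sym2x2}
    (hθ : HasWeakDiv Ω θ 0) {v : H1 Ω Plane} {φ : Plane → Plane} (hφ : IsTestFunction Ω φ)
    (hv : H1.fn v =ᵐ[volume.restrict Ω] φ) : inner ℝ θ (symGradLp v) = 0 := by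
  have hc := hφ.component
  have h1 : ∀ i, ∫ x in Ω, ∑ j, entry (θ x) i j * partialDeriv j (fun x => φ x i) x = 0 := by
    intro i
    rw [hθ _ (hc i) i, neg_eq_zero, ← integral_zero Plane ℝ (μ := volume.restrict Ω)]
    refine integral_congr_ae ?_
    filter_upwards [Lp.coeFn_zero Plane 2 (volume.restrict Ω)] with x hx
    rw [hx]
    simp
  have hint : ∀ i, Integrable (fun x => ∑ j, entry (θ x) i j *
      partialDeriv j (fun x => φ x i) x) (volume.restrict Ω) := by
    intro i
    refine integrable_finsetSum _ fun j _ => ?_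
    have h2 := ((hc i).pd j).integrable_smul ((entryL i j).compLp θ)
    refine h2.congr ?_
    filter_upwards [(entryL i j).coeFn_compLp θ] with x hx
    rw [hx, smul_eq_mul, mul_comm, entryL_apply]
  have h2 : inner ℝ θ (symGradLp v) =
      ∑ i, ∫ x in Ω, ∑ j, entry (θ x) i j * partialDeriv j (fun x => φ x i) x := by
    rw [L2.inner_def, ← integral_finsetSum _ fun i _ => hint i]
    refine integral_congr_ae ?_
    filter_upwards [coeFn_symGradLp v, H1.pd_eq_fderiv hΩ hφ hv 0,
      H1.pd_eq_fderiv hΩ hφ hv 1] with x hx h0 h1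
    have hs := entry_comm (θ x) 0 1
    rw [hx, inner_sym]
    simp only [symGrad, entry_symPart, Fin.sum_univ_two, h0, h1,
      partialDeriv_component (hφ.1.differentiable (by simp))]
    rw [hs]
    ring
  rw [h2]
  exact Finset.sum_eq_zero fun i _ => h1 i

/-- A stress field without divergence is orthogonal to the symmetrized gradients of the functions
with zero boundary values. -/
theorem inner_symGradLp_eq_zero {Ω : Set Plane} (hΩ : IsOpen Ω) {θ : L2 Ω Sym2x2}
    (hθ : HasWeakDiv Ω θ 0) {v : H1 Ω Plane} (hv : v ∈ H10 Ω Plane) :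
    inner ℝ θ (symGradLp v) = 0 := by
  have hcl : IsClosed {v : H1 Ω Plane | inner ℝ θ (symGradLp v) = (0 : ℝ)} :=
    isClosed_eq (Continuous.inner (𝕜 := ℝ) (E := L2 Ω Sym2x2) continuous_const continuous_symGradLp) continuous_const
  refine closure_minimal ?_ hcl hv
  rintro v ⟨φ, hφ, hv⟩
  exact inner_symGradLp_eq_zero_of_test hΩ hθ hφ hv

theorem symGradLp_add {Ω : Set Plane} (v w : H1 Ω Plane) :
    symGradLp (v + w) = symGradLp v + symGradLp w := by
  simp only [symGradLp, H1.pd_add, Fin.sum_univ_two]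
  have h : ∀ j, (symTensor j).compLp (H1.pd j v + H1.pd j w) =
      (symTensor j).compLp (H1.pd j v) + (symTensor j).compLp (H1.pd j w) :=
    fun j => ((symTensor j).compLpL 2 (volume.restrict Ω)).map_add _ _
  rw [h, h]
  abel

theorem symGradLp_smul {Ω : Set Plane} (c : ℝ) (v : H1 Ω Plane) :
    symGradLp (c • v) = c • symGradLp v := by
  simp only [symGradLp, H1.pd_smul, Fin.sum_univ_two]
  have h : ∀ j, (symTensor j).compLp (c • H1.pd j v) = c • (symTensor j).compLp (H1.pd j v) :=
    fun j => ((symTensor j).compLpL 2 (volume.restrict Ω)).map_smul _ _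
  rw [h, h, smul_add]

/-- The symmetrized gradient, as a continuous linear map. -/
def symGradL (Ω : Set Plane) : H1 Ω Plane →L[ℝ] L2 Ω Sym2x2 where
  toFun := symGradLp
  map_add' := symGradLp_add
  map_smul' := symGradLp_smul
  cont := continuous_symGradLp

theorem symGradL_apply {Ω : Set Plane} (v : H1 Ω Plane) : symGradL Ω v = symGradLp v := rfl

/-- The global estimate for the displacement. -/
theorem global_estimate {Ω : Set Plane} (hΩ : IsOpen Ω) (hb : Bornology.IsBounded Ω)
    {lam mu : ℝ} (hmu : 0 < mu) (hlam : 0 < lam + mu) :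
    ∃ C : ℝ, 0 ≤ C ∧ ∀ (v w : H1 Ω Plane) (e q χ : L2 Ω Sym2x2),
      symGradLp v = e + q → v - w ∈ H10 Ω Plane → HasWeakDiv Ω (stress lam mu e - χ) 0 →
      ‖e‖ ≤ C * (‖χ‖ + ‖q‖ + ‖w‖) ∧ ‖v‖ ≤ C * (‖χ‖ + ‖q‖ + ‖w‖) := by
  obtain ⟨C₀, hC₀, hK⟩ := exists_norm_le_symGradLp hΩ hb
  have hc : 0 < ellipticity lam mu := ellipticity_pos hmu hlam
  set l := ‖elasticity lam mu‖
  have hl : 0 ≤ l := ContinuousLinearMap.opNorm_nonneg _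
  obtain ⟨B, hB, hEB⟩ : ∃ B : ℝ, 0 ≤ B ∧ ∀ w : H1 Ω Plane, ‖symGradLp w‖ ≤ B * ‖w‖ := by
    refine ⟨∑ j, ‖symTensor j‖, Finset.sum_nonneg fun j _ => by positivity, fun w => ?_⟩
    rw [Finset.sum_mul]
    refine norm_sum_le_of_le (E := L2 Ω Sym2x2) _ fun j _ => ((symTensor j).norm_compLp_le _).trans ?_
    exact mul_le_mul_of_nonneg_left (norm_pd_le j w) (by positivity)
  set M := ((l + 2) / ellipticity lam mu + 1) * (1 + B)
  have hM : 0 ≤ M := by positivity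
  have key : ∀ (v w : H1 Ω Plane) (e q χ : L2 Ω Sym2x2),
      symGradLp v = e + q → v - w ∈ H10 Ω Plane → HasWeakDiv Ω (stress lam mu e - χ) 0 →
      ‖e‖ ≤ M * (‖χ‖ + ‖q‖ + ‖w‖) := by
    intro v w e q χ hv hvw hdiv
    -- The test field is `v - w`, whose boundary values vanish. The boundary datum joins the plastic
    -- strain in the remainder.
    have h1 : symGradLp (v - w) = e + (q - symGradLp w) := by
      rw [← symGradL_apply, map_sub, symGradL_apply, symGradL_apply, hv, add_sub_assoc]
    have h2 := inner_symGradLp_eq_zero hΩ hdiv hvw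
    rw [h1] at h2
    have h3 := norm_le_of_inner_eq_zero (X := L2 Ω Sym2x2) hc hl
      (mapOp_coercive (elasticity_coercive lam mu) (volume.restrict Ω) e)
      ((elasticity lam mu).norm_compLp_le e) h2
    refine h3.trans ?_
    rw [mul_assoc]
    refine mul_le_mul_of_nonneg_left ?_ (by positivity)
    have h4 : ‖q - symGradLp w‖ ≤ ‖q‖ + B * ‖w‖ := norm_sub_le_of_le (E := L2 Ω Sym2x2) le_rfl (hEB w)
    nlinarith [norm_nonneg w, mul_nonneg hB (norm_nonneg χ), mul_nonneg hB (norm_nonneg q)]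
  -- The first entry serves the strain. The second serves the displacement: Korn's inequality for `v
  -- - w`, whose symmetrized gradient is at most `M + 1 + B` times the data, plus one for `w`
  -- itself.
  refine ⟨max M (1 + C₀ * (M + 1 + B)), le_max_of_le_left hM, fun v w e q χ hv hvw hdiv => ?_⟩
  have hs : 0 ≤ ‖χ‖ + ‖q‖ + ‖w‖ := by positivity
  have h1 := key v w e q χ hv hvw hdiv
  refine ⟨h1.trans (mul_le_mul_of_nonneg_right (le_max_left _ _) hs), ?_⟩
  refine le_trans ?_ (mul_le_mul_of_nonneg_right (le_max_right _ _) hs)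
  have h2 := hK _ hvw
  have h3 : ‖symGradLp (v - w)‖ ≤ ‖e‖ + ‖q‖ + B * ‖w‖ := by
    have : symGradLp (v - w) = e + q - symGradLp w := by
      rw [← symGradL_apply, map_sub, symGradL_apply, symGradL_apply, hv]
    rw [this]
    exact norm_sub_le_of_le (E := L2 Ω Sym2x2) (norm_add_le (E := L2 Ω Sym2x2) _ _) (hEB w)
  have h4 : ‖v‖ ≤ ‖v - w‖ + ‖w‖ := by
    simpa using norm_add_le (v - w) w
  have h5 : ‖symGradLp (v - w)‖ ≤ (M + 1 + B) * (‖χ‖ + ‖q‖ + ‖w‖) := by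
    nlinarith [norm_nonneg w, norm_nonneg q, norm_nonneg χ, mul_nonneg hB (norm_nonneg χ),
      mul_nonneg hB (norm_nonneg q)]
  have h6 := mul_le_mul_of_nonneg_left h5 hC₀
  nlinarith [norm_nonneg w, norm_nonneg q, norm_nonneg χ]

end ZeroBoundary

/-! ### Absolutely continuous curves in Hilbert spaces -/

section Curves

/-- A measurable curve with values in the range of a continuous injective map lifts to a measurable
curve. -/
theorem exists_aestronglyMeasurable_lift {X Z : Type} [NormedAddCommGroup X] [CompleteSpace X]
    [SecondCountableTopology X] [TopologicalSpace Z] [T2Space Z]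
    [TopologicalSpace.PseudoMetrizableSpace Z] [SecondCountableTopology Z] {ν : Measure ℝ} {ι : X → Z} (hι : Continuous ι)
    (hinj : Function.Injective ι) {F : ℝ → Z} (hF : AEStronglyMeasurable F ν) {m : ℝ → ℝ}
    (h : ∀ᵐ t ∂ν, ∃ x, ι x = F t ∧ ‖x‖ ≤ m t) :
    ∃ g : ℝ → X, AEStronglyMeasurable g ν ∧ ∀ᵐ t ∂ν, ι (g t) = F t ∧ ‖g t‖ ≤ m t := by
  let _ : MeasurableSpace X := borel X
  have _ : BorelSpace X := ⟨rfl⟩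
  let _ : MeasurableSpace Z := borel Z
  have _ : BorelSpace Z := ⟨rfl⟩
  -- Lusin-Souslin: a continuous injection from a Polish space is a measurable embedding, so it has
  -- a measurable left inverse, which is then composed with `F`.
  have hemb : MeasurableEmbedding ι := hι.measurableEmbedding hinj
  obtain ⟨r, hr, hrι⟩ := hemb.exists_measurable_extend measurable_id fun _ => ⟨0⟩
  refine ⟨fun t => r (F t), (hr.comp_aemeasurable hF.aemeasurable).aestronglyMeasurable, ?_⟩
  filter_upwards [h] with t ⟨x, hx, hxm⟩
  have : r (F t) = x := by rw [← hx]; exact congrFun hrι x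
  rw [this]
  exact ⟨hx, hxm⟩

theorem eq_of_mapClusterPt_of_tendsto {ι' Z : Type} [TopologicalSpace Z] [T2Space Z]
    {l : Filter ι'} {a b : Z} {f : ι' → Z} (h : MapClusterPt a l f) (hf : Tendsto f l (𝓝 b)) :
    a = b := by
  by_contra hne
  exact ((ClusterPt.mono h hf).neBot).ne (disjoint_nhds_nhds.2 hne).eq_bot

/-- `V` is the variation accumulated from time 0. Being monotone, it has an integrable derivative
almost everywhere, which will dominate the difference quotients of `f`. -/
theorem exists_monotoneOn_dist_le {X : Type} [NormedAddCommGroup X] {f : ℝ → X} {T : ℝ} (hT : 0 < T)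
    (hf : AbsolutelyContinuousOnInterval f 0 T) :
    ∃ V : ℝ → ℝ, MonotoneOn V (Icc 0 T) ∧
      ∀ s ∈ Icc 0 T, ∀ t ∈ Icc 0 T, s ≤ t → ‖f t - f s‖ ≤ V t - V s := by
  have hbv := hf.boundedVariationOn
  rw [uIcc_of_le hT.le] at hbv
  have hlbv := hbv.locallyBoundedVariationOn
  have h0 : (0 : ℝ) ∈ Icc 0 T := ⟨le_rfl, hT.le⟩
  refine ⟨variationOnFromTo f (Icc 0 T) 0, variationOnFromTo.monotoneOn hlbv h0,
    fun s hs t ht hst => ?_⟩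
  have h1 := variationOnFromTo.add hlbv h0 hs ht
  have h2 : ‖f t - f s‖ ≤ variationOnFromTo f (Icc 0 T) s t := by
    rw [variationOnFromTo.eq_of_le _ _ hst, ← dist_eq_norm, dist_edist]
    refine ENNReal.toReal_mono (hlbv s t hs ht) ?_
    exact eVariationOn.edist_le f ⟨ht, hst, le_rfl⟩ ⟨hs, le_rfl, hst⟩
  linarith

/-- An indefinite integral is differentiable almost everywhere. -/
theorem ae_hasDerivAt_of_eq_integral {X : Type} [NormedAddCommGroup X]
    [NormedSpace ℝ X] [CompleteSpace X] {f g : ℝ → X} {T : ℝ} (hT : 0 < T)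
    (hg : IntervalIntegrable g volume 0 T)
    (hf : ∀ t ∈ Icc 0 T, f t = f 0 + ∫ s in (0 : ℝ)..t, g s) :
    ∀ᵐ t ∂volume.restrict (Ioo 0 T), HasDerivAt f (g t) t := by
  filter_upwards [ae_restrict_of_ae hg.ae_hasDerivAt_integral,
    ae_restrict_mem measurableSet_Ioo] with t ht ht'
  rw [uIcc_of_le hT.le] at ht
  have h1 := (ht (Ioo_subset_Icc_self ht') 0 ⟨le_rfl, hT.le⟩).const_add (f 0)
  refine h1.congr_of_eventuallyEq ?_
  filter_upwards [Icc_mem_nhds ht'.1 ht'.2] with s hs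
  exact hf s hs

variable {X : Type} [NormedAddCommGroup X] [InnerProductSpace ℝ X]

theorem absolutelyContinuousOnInterval_inner {f : ℝ → X} {a b : ℝ}
    (hf : AbsolutelyContinuousOnInterval f a b) (x : X) :
    AbsolutelyContinuousOnInterval (fun t => inner ℝ x (f t)) a b := by
  rw [absolutelyContinuousOnInterval_iff] at hf ⊢
  intro ε hε
  obtain ⟨δ, hδ, h⟩ := hf (ε / (‖x‖ + 1)) (by positivity)
  refine ⟨δ, hδ, fun E hE hs => ?_⟩
  have h1 := h E hE hs
  rw [lt_div_iff₀ (by positivity), mul_comm] at h1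
  refine lt_of_le_of_lt ?_ h1
  rw [Finset.mul_sum]
  refine Finset.sum_le_sum fun i _ => ?_
  rw [Real.dist_eq, ← inner_sub_right, dist_eq_norm]
  refine (abs_real_inner_le_norm _ _).trans ?_
  exact mul_le_mul_of_nonneg_right (by linarith) (norm_nonneg _)

/-- An absolutely continuous curve in a separable Hilbert space is the indefinite integral of an
integrable curve. -/
theorem exists_eq_integral_of_absolutelyContinuous [CompleteSpace X]
    [SecondCountableTopology X] {f : ℝ → X} {T : ℝ} (hT : 0 < T)
    (hf : AbsolutelyContinuousOnInterval f 0 T) :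
    ∃ g : ℝ → X, IntervalIntegrable g volume 0 T ∧
      ∀ t ∈ Icc 0 T, f t = f 0 + ∫ s in (0 : ℝ)..t, g s := by
  obtain ⟨V, hVm, hV⟩ := exists_monotoneOn_dist_le hT hf
  let d : ℕ → X := TopologicalSpace.denseSeq X
  have hd : DenseRange d := TopologicalSpace.denseRange_denseSeq X
  have hfd : ∀ n, AbsolutelyContinuousOnInterval (fun t => inner ℝ (d n) (f t)) 0 T := fun n =>
    absolutelyContinuousOnInterval_inner hf (d n)
  have hVi : IntervalIntegrable (deriv V) volume 0 T := by
    apply MonotoneOn.intervalIntegrable_deriv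
    rwa [uIcc_of_le hT.le]
  have hmem : ∀ᵐ t ∂volume.restrict (Ioc 0 T), t ∈ Ioo 0 T := by
    rw [← Measure.restrict_congr_set Ioo_ae_eq_Ioc]
    exact ae_restrict_mem measurableSet_Ioo
  -- At almost every time `V` and all the scalar functions `⟨d n, f⟩` are differentiable. The
  -- forward difference quotients of `f` are then bounded, by `V' + 1` since the slopes of `V` only
  -- tend to `V'`, and a weak cluster point has the required inner products with the dense sequence.
  have hpt : ∀ᵐ t ∂volume.restrict (Ioc 0 T), ∃ x : X,
      (fun n => inner ℝ (d n) x) = (fun n => deriv (fun t => inner ℝ (d n) (f t)) t) ∧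
      ‖x‖ ≤ deriv V t + 1 := by
    have h1 : ∀ᵐ t ∂volume.restrict (Ioc 0 T), DifferentiableWithinAt ℝ V (Icc 0 T) t := by
      filter_upwards [ae_restrict_of_ae hVm.ae_differentiableWithinAt_of_mem, hmem] with t ht ht'
      exact ht (Ioo_subset_Icc_self ht')
    have h2 : ∀ᵐ t ∂volume.restrict (Ioc 0 T), ∀ n,
        DifferentiableAt ℝ (fun t => inner ℝ (d n) (f t)) t := by
      rw [ae_all_iff]
      intro n
      filter_upwards [ae_restrict_of_ae (hfd n).boundedVariationOn.ae_differentiableAt_of_mem_uIcc,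
        hmem] with t ht ht'
      refine ht ?_
      rw [uIcc_of_le hT.le]
      exact Ioo_subset_Icc_self ht'
    filter_upwards [h1, h2, hmem] with t hVt hft ht
    have hVd := (hVt.differentiableAt (Icc_mem_nhds ht.1 ht.2)).hasDerivAt
    have hq : Tendsto (fun s => slope V t s) (𝓝[>] t) (𝓝 (deriv V t)) :=
      (hasDerivAt_iff_tendsto_slope.1 hVd).mono_left
        (nhdsWithin_mono _ fun s hs => ne_of_gt hs)
    have hev : ∀ᶠ s in 𝓝[>] t, ‖(s - t)⁻¹ • (f s - f t)‖ ≤ deriv V t + 1 := by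
      filter_upwards [hq.eventually_lt_const (lt_add_one _), Ioo_mem_nhdsGT ht.2] with s hs hs'
      refine le_trans ?_ hs.le
      have hpos : 0 < s - t := sub_pos.2 hs'.1
      rw [norm_smul, norm_inv, Real.norm_of_nonneg hpos.le, slope_def_field, div_eq_inv_mul]
      exact mul_le_mul_of_nonneg_left (hV t (Ioo_subset_Icc_self ht) s
        ⟨ht.1.le.trans hs'.1.le, hs'.2.le⟩ hs'.1.le) (inv_nonneg.2 hpos.le)
    obtain ⟨x, hx, hcl⟩ := exists_weak_clusterPt _ _ hev
    refine ⟨x, funext fun n => ?_, hx⟩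
    rw [real_inner_comm]
    refine eq_of_mapClusterPt_of_tendsto (hcl (d n)) ?_
    have h3 := (hasDerivAt_iff_tendsto_slope.1 (hft n).hasDerivAt).mono_left
      (nhdsWithin_mono t fun s (hs : s ∈ Ioi t) => ne_of_gt hs)
    refine h3.congr fun s => ?_
    rw [slope_def_field, real_inner_smul_left, inner_sub_left, div_eq_inv_mul,
      real_inner_comm (f s), real_inner_comm (f t)]
  -- The sequence of inner products with a dense sequence determines a vector and depends
  -- continuously on it, so measurability of the derivatives lifts to `g`.
  obtain ⟨g, hgm, hg⟩ := exists_aestronglyMeasurable_lift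
    (ι := fun (x : X) (n : ℕ) => inner ℝ (d n) x)
    (continuous_pi fun n => continuous_const.inner continuous_id)
    (fun x y hxy => by
      refine ext_inner_left ℝ fun v => ?_
      refine congrFun (hd.equalizer (g := fun v => inner ℝ v x) (h := fun v => inner ℝ v y)
        (continuous_id.inner continuous_const) (continuous_id.inner continuous_const) ?_) v
      exact hxy)
    (measurable_pi_lambda _ fun n => measurable_deriv _).aestronglyMeasurable hpt
  have hgi : IntervalIntegrable g volume 0 T := by
    rw [intervalIntegrable_iff_integrableOn_Ioc_of_le hT.le]
    refine Integrable.mono' (g := fun t => deriv V t + 1) ?_ hgm (hg.mono fun t ht => ht.2)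
    exact ((intervalIntegrable_iff_integrableOn_Ioc_of_le hT.le).1 hVi).add
      (integrable_const _)
  refine ⟨g, hgi, fun t ht => ?_⟩
  have hgt : IntervalIntegrable g volume 0 t :=
    hgi.mono_set (by rw [uIcc_of_le hT.le, uIcc_of_le ht.1]; exact Icc_subset_Icc_right ht.2)
  rw [← sub_eq_iff_eq_add']
  -- It is enough to test with the dense sequence, where this is the fundamental theorem of calculus
  -- for absolutely continuous real functions.
  refine ext_inner_left ℝ fun v => ?_
  refine congrFun (hd.equalizer (g := fun v => inner ℝ v (f t - f 0))
    (h := fun v => inner ℝ v (∫ s in (0 : ℝ)..t, g s))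
    (continuous_id.inner continuous_const) (continuous_id.inner continuous_const) ?_) v
  funext n
  have h1 := ((hfd n).mono (c := 0) (d := t) (by
    rw [uIcc_of_le hT.le, uIcc_of_le ht.1]
    exact Icc_subset_Icc_right ht.2)).integral_deriv_eq_sub
  have h2 : ∫ s in (0 : ℝ)..t, inner ℝ (d n) (g s) = inner ℝ (d n) (∫ s in (0 : ℝ)..t, g s) :=
    (innerSL ℝ (d n)).intervalIntegral_comp_comm hgt
  change inner ℝ (d n) (f t - f 0) = inner ℝ (d n) (∫ s in (0 : ℝ)..t, g s)
  rw [inner_sub_right, ← h1, ← h2]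
  refine intervalIntegral.integral_congr_ae_restrict ?_
  rw [uIoc_of_le ht.1]
  refine ae_restrict_of_ae_restrict_of_subset (Ioc_subset_Ioc_right ht.2) ?_
  filter_upwards [hg] with s hs
  exact (congrFun hs.1 n).symm

end Curves

/-! ### Evolution estimates -/

section Evolution

/-- Grönwall's inequality in integral form. -/
theorem le_of_le_add_integral {y : ℝ → ℝ} {T A b : ℝ} (hT : 0 < T) (hA : 0 < A)
    (hy : ContinuousOn y (Icc 0 T)) (hy0 : ∀ t ∈ Icc 0 T, 0 ≤ y t)
    (h : ∀ t ∈ Icc 0 T, y t ≤ b + A * ∫ s in (0 : ℝ)..t, y s) :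
    ∀ t ∈ Icc 0 T, y t ≤ b * Real.exp (A * T) := by
  -- Extending `y` by constants makes its primitive differentiable everywhere. The differential form
  -- of Grönwall's inequality is applied to that primitive.
  let z : ℝ → ℝ := IccExtend hT.le ((Icc 0 T).domRestrict y)
  have hz : Continuous z := hy.domRestrict.Icc_extend'
  have hzy : ∀ t ∈ Icc 0 T, z t = y t := fun t ht => IccExtend_of_mem hT.le _ ht
  have hint : ∀ t ∈ Icc 0 T, ∫ s in (0 : ℝ)..t, y s = ∫ s in (0 : ℝ)..t, z s := fun t ht => by
    refine intervalIntegral.integral_congr fun s hs => ?_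
    rw [uIcc_of_le ht.1] at hs
    exact (hzy s ⟨hs.1, hs.2.trans ht.2⟩).symm
  have hb : 0 ≤ b := by
    have h0 : (0 : ℝ) ∈ Icc 0 T := ⟨le_rfl, hT.le⟩
    have h1 := h 0 h0
    rw [intervalIntegral.integral_same, mul_zero, add_zero] at h1
    exact (hy0 0 h0).trans h1
  have hd : ∀ t, HasDerivAt (fun t => ∫ s in (0 : ℝ)..t, z s) (z t) t := fun t =>
    intervalIntegral.integral_hasDerivAt_right (hz.intervalIntegrable 0 t)
      (hz.stronglyMeasurableAtFilter _ _) hz.continuousAt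
  have hnn : ∀ t ∈ Icc 0 T, 0 ≤ ∫ s in (0 : ℝ)..t, z s := fun t ht =>
    intervalIntegral.integral_nonneg ht.1 fun s hs => by
      rw [hzy s ⟨hs.1, hs.2.trans ht.2⟩]
      exact hy0 s ⟨hs.1, hs.2.trans ht.2⟩
  have key := norm_le_gronwallBound_of_norm_deriv_right_le (δ := 0) (K := A) (ε := b)
    (f := fun t => ∫ s in (0 : ℝ)..t, z s) (f' := z) (a := 0) (b := T)
    (fun t _ => (hd t).continuousAt.continuousWithinAt) (fun t _ => (hd t).hasDerivWithinAt)
    (by simp) (fun t ht => by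
      have ht' := Ico_subset_Icc_self ht
      rw [Real.norm_of_nonneg (hnn t ht'), hzy t ht', Real.norm_of_nonneg (hy0 t ht'), add_comm,
        ← hint t ht']
      exact h t ht')
  intro t ht
  have h1 := key t ht
  rw [Real.norm_of_nonneg (hnn t ht), sub_zero, gronwallBound_of_K_ne_0 hA.ne'] at h1
  simp only [zero_mul, zero_add] at h1
  have h2 := h t ht
  rw [hint t ht] at h2
  have h3 := mul_le_mul_of_nonneg_left h1 hA.le
  have h4 : A * (b / A * (Real.exp (A * t) - 1)) = b * (Real.exp (A * t) - 1) := by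
    field_simp
  have h5 : Real.exp (A * t) ≤ Real.exp (A * T) :=
    Real.exp_le_exp.2 (mul_le_mul_of_nonneg_left ht.2 hA.le)
  nlinarith [mul_le_mul_of_nonneg_left h5 hb]

theorem MemLpTime.intervalIntegrable {X : Type} [NormedAddCommGroup X] {g : ℝ → X} {T : ℝ} (hT : 0 < T)
    (h : MemLpTime 2 T g) :
    IntervalIntegrable g volume 0 T := by
  rw [intervalIntegrable_iff_integrableOn_Ioc_of_le hT.le, integrableOn_Ioc_iff_integrableOn_Ioo]
  exact h.integrable (by norm_num)

variable {X Z : Type} [NormedAddCommGroup X] [NormedSpace ℝ X] [NormedAddCommGroup Z]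
  [NormedSpace ℝ Z]

/-- Grönwall's inequality for the image of an absolutely continuous curve under a linear map. -/
theorem norm_map_le_of_norm_map_deriv_le [CompleteSpace X] [CompleteSpace Z] {f g : ℝ → X}
    {T A c h : ℝ} (hT : 0 < T) (hA : 0 < A) (L : X →L[ℝ] Z)
    (hg : IntervalIntegrable g volume 0 T)
    (hf : ∀ t ∈ Icc 0 T, f t = f 0 + ∫ s in (0 : ℝ)..t, g s) {m : ℝ → ℝ}
    (hm : IntervalIntegrable m volume 0 T) (hm0 : ∀ t, 0 ≤ m t) (hh : 0 ≤ h)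
    (h0 : ‖L (f 0)‖ ≤ h * c)
    (hgL : ∀ᵐ t ∂volume.restrict (Ioo 0 T), ‖L (g t)‖ ≤ h * m t + A * ‖L (f t)‖) :
    ∀ t ∈ Icc 0 T, ‖L (f t)‖ ≤ h * ((c + ∫ s in (0 : ℝ)..T, m s) * Real.exp (A * T)) := by
  have hfc : ContinuousOn f (Icc 0 T) := by
    have h1 := intervalIntegral.continuousOn_primitive_interval' hg left_mem_uIcc
    rw [uIcc_of_le hT.le] at h1
    exact (continuousOn_const.add h1).congr hf
  have hyc : ContinuousOn (fun t => ‖L (f t)‖) (Icc 0 T) := (L.continuous.comp_continuousOn hfc).norm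
  rw [Measure.restrict_congr_set Ioo_ae_eq_Ioc] at hgL
  intro t ht
  rw [← mul_assoc]
  refine le_of_le_add_integral hT hA hyc (fun t _ => norm_nonneg _) (fun t ht => ?_) t ht
  have hsub : uIcc 0 t ⊆ uIcc 0 T := by
    rw [uIcc_of_le hT.le, uIcc_of_le ht.1]
    exact Icc_subset_Icc_right ht.2
  have hgt := hg.mono_set hsub
  have hmt := hm.mono_set hsub
  have hyt : IntervalIntegrable (fun t => ‖L (f t)‖) volume 0 t := by
    refine ContinuousOn.intervalIntegrable ?_
    rw [uIcc_of_le ht.1]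
    exact hyc.mono (Icc_subset_Icc_right ht.2)
  have h1 : L (f t) = L (f 0) + ∫ s in (0 : ℝ)..t, L (g s) := by
    rw [L.intervalIntegral_comp_comm hgt, hf t ht, map_add]
  have hLg : IntervalIntegrable (fun s => L (g s)) volume 0 t :=
    ⟨L.integrable_comp hgt.1, L.integrable_comp hgt.2⟩
  have h2 : ‖∫ s in (0 : ℝ)..t, L (g s)‖ ≤ ∫ s in (0 : ℝ)..t, (h * m s + A * ‖L (f s)‖) := by
    refine intervalIntegral.norm_integral_le_of_norm_le ht.1 ?_
      ((hmt.const_mul h).add (hyt.const_mul A))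
    have h3 := (ae_restrict_iff' measurableSet_Ioc).1 hgL
    filter_upwards [h3] with s hs hs'
    exact hs ⟨hs'.1, hs'.2.trans ht.2⟩
  rw [intervalIntegral.integral_add (hmt.const_mul h) (hyt.const_mul A),
    intervalIntegral.integral_const_mul, intervalIntegral.integral_const_mul] at h2
  have h4 : ∫ s in (0 : ℝ)..t, m s ≤ ∫ s in (0 : ℝ)..T, m s :=
    intervalIntegral.integral_mono_interval le_rfl ht.1 ht.2
      (Eventually.of_forall hm0) hm
  rw [h1]
  refine (norm_add_le _ _).trans ?_
  nlinarith [mul_le_mul_of_nonneg_left h4 hh]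

/-- A curve in a closed subspace has its derivative in the subspace. -/
theorem mem_of_hasDerivAt {S : Submodule ℝ X} (hS : IsClosed (S : Set X)) {f : ℝ → X} {f' : X}
    {T t : ℝ} (hf : ∀ s ∈ Icc 0 T, f s ∈ S) (ht : t ∈ Ioo 0 T) (h : HasDerivAt f f' t) :
    f' ∈ S := by
  have h1 := hasDerivAt_iff_tendsto_slope.1 h
  refine hS.mem_of_tendsto h1 ?_
  filter_upwards [nhdsWithin_le_nhds (Icc_mem_nhds ht.1 ht.2)] with s hs
  rw [slope_def_module]
  exact S.smul_mem _ (S.sub_mem (hf s hs) (hf t (Ioo_subset_Icc_self ht)))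

theorem MemLpTime.map {g : ℝ → X} {T : ℝ} {q : ℝ≥0∞} (h : MemLpTime q T g) (L : X →L[ℝ] Z) :
    MemLpTime q T (fun t => L (g t)) :=
  L.comp_memLp' h

/-- The image of a curve of class `H¹` under a linear map is differentiable almost everywhere. -/
theorem exists_ae_hasDerivAt_map_of_memH1Time [CompleteSpace X] [CompleteSpace Z] {f : ℝ → X}
    {T : ℝ} (hT : 0 < T) (hf : MemH1Time T f) (L : X →L[ℝ] Z) {k : ℝ → Z}
    (hk : ∀ t ∈ Icc 0 T, L (f t) = k t) :
    ∃ g : ℝ → X, MemLpTime 2 T g ∧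
      ∀ᵐ t ∂volume.restrict (Ioo 0 T), HasDerivAt k (L (g t)) t := by
  obtain ⟨g, hg, hfg⟩ := hf
  refine ⟨g, hg, ?_⟩
  filter_upwards [ae_hasDerivAt_of_eq_integral hT (hg.intervalIntegrable hT) hfg,
    ae_restrict_mem measurableSet_Ioo] with t ht ht'
  refine (L.hasFDerivAt.comp_hasDerivAt t ht).congr_of_eventuallyEq ?_
  filter_upwards [Icc_mem_nhds ht'.1 ht'.2] with s hs
  exact (hk s hs).symm

end Evolution

/-! ### Interior regularity in Sobolev spaces -/

section SobolevSpaces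

variable {Y : Type} [NormedAddCommGroup Y] [InnerProductSpace ℝ Y] [CompleteSpace Y]

theorem secondCountableTopology_L2 (Ω : Set Plane) (Y : Type) [NormedAddCommGroup Y]
    [SecondCountableTopology Y] : SecondCountableTopology (L2 Ω Y) := by
  have : Fact ((2 : ℝ≥0∞) ≠ ⊤) := ⟨by norm_num⟩
  exact Lp.SecondCountableTopology

theorem secondCountableTopology_H1 (Ω : Set Plane) (Y : Type) [NormedAddCommGroup Y]
    [InnerProductSpace ℝ Y] [CompleteSpace Y] [SecondCountableTopology Y] :
    SecondCountableTopology (H1 Ω Y) := by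
  have h1 := secondCountableTopology_L2 Ω Y
  have h2 : SecondCountableTopology (PiLp 2 (fun _ : Fin 2 => L2 Ω Y)) :=
    PiLp.secondCountableTopology 2 _
  have h3 : SecondCountableTopology (H1Ambient Ω Y) := WithLp.secondCountableTopology _ _ _
  exact Topology.IsEmbedding.subtypeVal.secondCountableTopology

theorem secondCountableTopology_H2 (Ω : Set Plane) (Y : Type) [NormedAddCommGroup Y]
    [InnerProductSpace ℝ Y] [CompleteSpace Y] [SecondCountableTopology Y] :
    SecondCountableTopology (H2 Ω Y) := by
  have h1 := secondCountableTopology_H1 Ω Y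
  have h2 : SecondCountableTopology (PiLp 2 (fun _ : Fin 2 => H1 Ω Y)) :=
    PiLp.secondCountableTopology 2 _
  have h3 : SecondCountableTopology (H2Ambient Ω Y) := WithLp.secondCountableTopology _ _ _
  exact Topology.IsEmbedding.subtypeVal.secondCountableTopology

/-- The inclusion of `H¹` in `L²`. -/
def H1.fnL (Ω : Set Plane) (Y : Type) [NormedAddCommGroup Y] [InnerProductSpace ℝ Y]
    [CompleteSpace Y] : H1 Ω Y →L[ℝ] L2 Ω Y where
  toFun := H1.fn
  map_add' := H1.fn_add
  map_smul' := H1.fn_smul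
  cont := H1.continuous_fn

/-- The inclusion of `H²` in `H¹`. -/
def H2.fnL (Ω : Set Plane) (Y : Type) [NormedAddCommGroup Y] [InnerProductSpace ℝ Y]
    [CompleteSpace Y] : H2 Ω Y →L[ℝ] H1 Ω Y where
  toFun := H2.fn
  map_add' := fun _ _ => rfl
  map_smul' := fun _ _ => rfl
  cont := (WithLp.continuous_fst 2 _ _).comp continuous_subtype_val

/-- Weak derivatives are unique in an open set, so `H¹` injects into `L²`. This injectivity is what
the measurable lifting of curves requires. -/
theorem H1.ext_fn {Ω : Set Plane} (hΩ : IsOpen Ω) {v w : H1 Ω Y} (h : H1.fn v = H1.fn w) :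
    v = w := by
  have hpd : ∀ i, H1.pd i v = H1.pd i w := fun i =>
    IsWeakPartial.unique hΩ (v.2 i) (by
      have := w.2 i
      change IsWeakPartial Ω i (H1.fn w) _ at this
      rw [← h] at this
      exact this)
  apply Subtype.ext
  refine WithLp.ofLp_injective _ (Prod.ext h ?_)
  exact PiLp.ext hpd

theorem H2.ext_fn {Ω : Set Plane} (hΩ : IsOpen Ω) {v w : H2 Ω Y} (h : H2.fn v = H2.fn w) :
    v = w := by
  apply Subtype.ext
  refine WithLp.ofLp_injective _ (Prod.ext h ?_)
  refine PiLp.ext fun i => H1.ext_fn hΩ ?_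
  have h1 : H1.fn ((v : H2Ambient Ω Y).snd i) = H1.pd i (H2.fn v) := v.2 i
  have h2 : H1.fn ((w : H2Ambient Ω Y).snd i) = H1.pd i (H2.fn w) := w.2 i
  rw [h] at h1
  exact h1.trans h2.symm

/-- The element of `H¹` with given values and partial derivatives. -/
def H1.mk {Ω : Set Plane} (f : L2 Ω Y) (G : Fin 2 → L2 Ω Y) (h : ∀ i, IsWeakPartial Ω i f (G i)) :
    H1 Ω Y :=
  ⟨WithLp.toLp 2 (f, WithLp.toLp 2 G), h⟩

theorem H1.norm_le {Ω : Set Plane} (v : H1 Ω Y) :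
    ‖v‖ ≤ ‖H1.fn v‖ + ∑ j, ‖H1.pd j v‖ := by
  refine abs_le_of_sq_le_sq' ?_ (by positivity) |>.2
  rw [norm_sq_eq, Fin.sum_univ_two, Fin.sum_univ_two]
  have h1 := norm_nonneg (H1.fn v)
  have h2 := norm_nonneg (H1.pd 0 v)
  have h3 := norm_nonneg (H1.pd 1 v)
  nlinarith [mul_nonneg h1 h2, mul_nonneg h1 h3, mul_nonneg h2 h3]

/-- Restriction of functions to a subset. -/
def restL {Ω : Set Plane} (Ω' : Set Plane) (hΩ : IsOpen Ω) : L2 Ω Y →L[ℝ] L2 Ω' Y :=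
  (rest Ω').comp (ext hΩ.measurableSet)

theorem coeFn_restL {Ω Ω' : Set Plane} (hΩ : IsOpen Ω) (hsub : Ω' ⊆ Ω) (f : L2 Ω Y) :
    restL Ω' hΩ f =ᵐ[volume.restrict Ω'] f := by
  have h1 := (ae_restrict_iff' hΩ.measurableSet).2
    ((coeFn_ext hΩ.measurableSet f).mono fun x hx (hxΩ : x ∈ Ω) => hx.trans (indicator_of_mem hxΩ _))
  filter_upwards [coeFn_rest Ω' (ext hΩ.measurableSet f),
    ae_restrict_of_ae_restrict_of_subset hsub h1] with x hx hx'
  exact hx.trans hx'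

theorem norm_restL_le {Ω Ω' : Set Plane} (hΩ : IsOpen Ω) (f : L2 Ω Y) :
    ‖restL Ω' hΩ f‖ ≤ ‖f‖ :=
  (norm_rest_le Ω' _).trans (norm_ext hΩ.measurableSet f).le

theorem restL_compLp {Z : Type} [NormedAddCommGroup Z] [InnerProductSpace ℝ Z] [CompleteSpace Z]
    {Ω Ω' : Set Plane} (hΩ : IsOpen Ω) (hsub : Ω' ⊆ Ω) (L : Y →L[ℝ] Z) (f : L2 Ω Y) :
    restL Ω' hΩ (L.compLp f) = L.compLp (restL Ω' hΩ f) := by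
  apply Lp.ext
  filter_upwards [coeFn_restL hΩ hsub (L.compLp f), L.coeFn_compLp (restL Ω' hΩ f),
    coeFn_restL hΩ hsub f, ae_restrict_of_ae_restrict_of_subset hsub (L.coeFn_compLp f)]
    with x h1 h2 h3 h4
  rw [h1, h2, h3, h4]

theorem IsWeakPartial.restL {Ω Ω' : Set Plane} (hΩ : IsOpen Ω) (hsub : Ω' ⊆ Ω) {i : Fin 2}
    {f g : L2 Ω Y} (h : IsWeakPartial Ω i f g) :
    IsWeakPartial Ω' i (restL Ω' hΩ f) (restL Ω' hΩ g) := by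
  have key : ∀ (f : L2 Ω Y) (φ : Plane → ℝ), IsTestFunction Ω' φ →
      ∫ x in Ω', φ x • Perzyna.restL Ω' hΩ f x = ∫ x in Ω, φ x • f x := by
    intro f φ hφ
    rw [setIntegral_eq_of_subset_of_forall_sdiff_eq_zero hΩ.measurableSet hsub fun x hx => by
      rw [image_eq_zero_of_notMem_tsupport fun h => hx.2 (hφ.2.2 h), zero_smul]]
    refine integral_congr_ae ?_
    filter_upwards [coeFn_restL hΩ hsub f] with x hx
    rw [hx]
  intro φ hφ
  rw [key _ _ (hφ.pd i), key _ _ hφ]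
  exact h φ (hφ.mono hsub)

/-- Restriction of functions of class `H¹` to a subset. -/
def H1.restrict {Ω Ω' : Set Plane} (hΩ : IsOpen Ω) (hsub : Ω' ⊆ Ω) (v : H1 Ω Y) : H1 Ω' Y :=
  H1.mk (restL Ω' hΩ (H1.fn v)) (fun i => restL Ω' hΩ (H1.pd i v)) fun i =>
    IsWeakPartial.restL hΩ hsub (v.2 i)

theorem H1.norm_restrict_le {Ω Ω' : Set Plane} (hΩ : IsOpen Ω) (hsub : Ω' ⊆ Ω) (v : H1 Ω Y) :
    ‖H1.restrict hΩ hsub v‖ ≤ ‖v‖ := by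
  refine abs_le_of_sq_le_sq' ?_ (by positivity) |>.2
  rw [norm_sq_eq, norm_sq_eq]
  have h : ∀ f : L2 Ω Y, ‖Perzyna.restL Ω' hΩ f‖ ^ 2 ≤ ‖f‖ ^ 2 := fun f =>
    pow_le_pow_left₀ (norm_nonneg _) (norm_restL_le hΩ f) 2
  exact add_le_add (h _) (Finset.sum_le_sum fun j _ => h _)

theorem symGradLp_restrict {Ω Ω' : Set Plane} (hΩ : IsOpen Ω) (hsub : Ω' ⊆ Ω) (v : H1 Ω Plane) :
    symGradLp (H1.restrict hΩ hsub v) = restL Ω' hΩ (symGradLp v) := by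
  rw [symGradLp, symGradLp, map_sum]
  exact Finset.sum_congr rfl fun j _ => (restL_compLp hΩ hsub _ _).symm

/-- A bound on the localized difference quotients gives interior `H¹` regularity. -/
theorem exists_H1_of_mulOp_diffOp_le {Ω Ω' : Set Plane} (hΩ : IsOpen Ω) (hΩ' : IsOpen Ω')
    {η : Plane → ℝ} (hη : IsTestFunction Ω η) (hη1 : ∀ x ∈ Ω', η x = 1) {f : L2 Ω Y} {M d : ℝ}
    (hd : 0 < d) (hM : ∀ i, ∀ h ∈ Ioo 0 d,
      ‖mulOp hη (diffOp (h • basisVec i) (ext hΩ.measurableSet f))‖ ≤ h * M) :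
    ∃ g : H1 Ω' Y, H1.fn g = restL Ω' hΩ f ∧ ‖g‖ ≤ ‖f‖ + 2 * M := by
  -- Since `η = 1` on `Ω'`, the bounds localized by `η` are bounds for the restriction to `Ω'`.
  have hrest : ∀ F : LR Y, rest Ω' F = rest Ω' (mulOp hη F) := by
    intro F
    apply Lp.ext
    filter_upwards [coeFn_rest Ω' F, coeFn_rest Ω' (mulOp hη F),
      ae_restrict_of_ae (coeFn_mulOp hη F), ae_restrict_mem hΩ'.measurableSet] with x h1 h2 h3 h4
    rw [h1, h2, h3, hη1 x h4, one_smul]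
  choose G hG hGw using fun i => exists_isWeakPartial_of_diffOp_le (Ω := Ω') (i := i)
    (F := ext hΩ.measurableSet f) (M := M) hd fun h hh => by
      rw [hrest]
      exact (norm_rest_le _ _).trans (hM i h hh)
  refine ⟨H1.mk (restL Ω' hΩ f) G hGw, rfl, (H1.norm_le _).trans ?_⟩
  rw [Fin.sum_univ_two]
  have h1 : ‖H1.fn (H1.mk (restL Ω' hΩ f) G hGw)‖ ≤ ‖f‖ := norm_restL_le hΩ f
  have h2 : ∀ j, ‖H1.pd j (H1.mk (restL Ω' hΩ f) G hGw)‖ ≤ M := hG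
  linarith [h2 0, h2 1]

theorem weightedIntegral_compLp {Z : Type} [NormedAddCommGroup Z] [InnerProductSpace ℝ Z]
    [CompleteSpace Z] {Ω : Set Plane} {φ : Plane → ℝ} (hφ : IsTestFunction Ω φ) (L : Y →L[ℝ] Z)
    (f : L2 Ω Y) :
    weightedIntegral Ω φ hφ.memLp (L.compLp f) = L (weightedIntegral Ω φ hφ.memLp f) := by
  rw [weightedIntegral_apply, weightedIntegral_apply, ← L.integral_comp_comm (hφ.integrable_smul f)]
  refine integral_congr_ae ?_
  filter_upwards [L.coeFn_compLp f] with x hx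
  rw [hx, map_smul]

/-- The `j`-th column of a matrix. -/
def columnL (j : Fin 2) : Sym2x2 →L[ℝ] Plane :=
  ∑ i, (entryL i j).smulRight (basisVec i)

theorem columnL_apply (j i : Fin 2) (A : Sym2x2) : columnL j A i = entry A i j := by
  rw [columnL, Fin.sum_univ_two]
  fin_cases i <;> simp [basisVec, entryL_apply]

/-- The second derivatives of a displacement are combinations of the first derivatives of its
symmetrized gradient. -/
def secondPartial {Ω : Set Plane} (E : H1 Ω Sym2x2) (j k : Fin 2) : L2 Ω Plane :=
  (columnL j).compLp (H1.pd k E) + (columnL k).compLp (H1.pd j E) -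
    ∑ i, ((entryL j k).smulRight (basisVec i)).compLp (H1.pd i E)

/-- This rests on `∂ₖ∂ⱼvₐ = ∂ₖEₐⱼ + ∂ⱼEₐₖ - ∂ₐEⱼₖ`. The second derivatives of `v` are not yet known
to exist, so the identity is checked after pairing with `φ`. -/
theorem isWeakPartial_secondPartial {Ω : Set Plane} {v : H1 Ω Plane} {E : H1 Ω Sym2x2}
    (hE : H1.fn E = symGradLp v) (j k : Fin 2) :
    IsWeakPartial Ω k (H1.pd j v) (secondPartial E j k) := by
  rw [isWeakPartial_iff]
  intro φ hφ
  -- `S k j` stands for minus the pairing of `∂ₖ∂ⱼv` with `φ`. It is symmetric because the second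
  -- derivatives of `φ` are.
  set S : Fin 2 → Fin 2 → Plane := fun k j => weightedIntegral Ω _ (hφ.pd k).memLp (H1.pd j v)
    with hS
  have hsymm : ∀ j k, S j k = S k j := by
    intro j k
    have h1 := isWeakPartial_iff.1 (v.2 j) _ (hφ.pd k)
    have h2 := isWeakPartial_iff.1 (v.2 k) _ (hφ.pd j)
    have h3 : partialDeriv j (partialDeriv k φ) = partialDeriv k (partialDeriv j φ) :=
      funext fun x => partialDeriv_comm hφ.1 j k x
    simp only [h3] at h1
    exact (add_left_cancel (h1.trans h2.symm)).symm
  have hpd : ∀ i, weightedIntegral Ω φ hφ.memLp (H1.pd i E) = -∑ l, symTensor l (S i l) := by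
    intro i
    have h1 := isWeakPartial_iff.1 (E.2 i) _ hφ
    rw [eq_neg_iff_add_eq_zero, add_comm, ← h1]
    congr 1
    change _ = weightedIntegral Ω _ (hφ.pd i).memLp (H1.fn E)
    rw [hE, symGradLp, map_sum]
    exact Finset.sum_congr rfl fun l _ => (weightedIntegral_compLp (hφ.pd i) _ _).symm
  change S k j + _ = 0
  have he : ∀ i a b, entry (∑ l, symTensor l (S i l)) a b = (S i b a + S i a b) / 2 := by
    intro i a b
    rw [← symPart_eq_sum, entry_symPart]
  have hsum : ∀ A : Fin 2 → Sym2x2, ∀ a,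
      (∑ i, (entryL j k).smulRight (basisVec i) (A i)) a = entry (A a) j k := by
    intro A a
    rw [Fin.sum_univ_two]
    fin_cases a <;> simp [basisVec, entryL_apply]
  rw [secondPartial, map_sub, map_add, map_sum, weightedIntegral_compLp hφ,
    weightedIntegral_compLp hφ]
  simp_rw [weightedIntegral_compLp hφ, hpd]
  ext a
  simp only [PiLp.add_apply, PiLp.sub_apply, map_neg, PiLp.neg_apply, columnL_apply, he,
    Finset.sum_neg_distrib, hsum, PiLp.zero_apply]
  rw [hsymm a k, hsymm a j, hsymm k j]
  ring

theorem norm_secondPartial_le : ∃ C : ℝ, 0 ≤ C ∧ ∀ {Ω : Set Plane} (E : H1 Ω Sym2x2)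
    (j k : Fin 2), ‖secondPartial E j k‖ ≤ C * ‖E‖ := by
  have hL : ∀ {Ω : Set Plane} (L : Sym2x2 →L[ℝ] Plane) (E : H1 Ω Sym2x2) (i : Fin 2),
      ‖L.compLp (H1.pd i E)‖ ≤ ‖L‖ * ‖E‖ := fun L E i =>
    (L.norm_compLp_le _).trans (mul_le_mul_of_nonneg_left (norm_pd_le i E)
      (ContinuousLinearMap.opNorm_nonneg _))
  refine ⟨∑ j, ∑ k, (‖columnL j‖ + ‖columnL k‖ +
    ∑ i, ‖(entryL j k).smulRight (basisVec i)‖), by positivity, fun E j k => ?_⟩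
  have h1 : ‖secondPartial E j k‖ ≤ (‖columnL j‖ + ‖columnL k‖ +
      ∑ i, ‖(entryL j k).smulRight (basisVec i)‖) * ‖E‖ := by
    rw [add_mul, add_mul, Finset.sum_mul]
    exact norm_sub_le_of_le (norm_add_le_of_le (hL _ _ _) (hL _ _ _))
      (norm_sum_le_of_le _ fun i _ => hL _ _ _)
  refine h1.trans (mul_le_mul_of_nonneg_right ?_ (norm_nonneg _))
  refine le_trans ?_ (Finset.single_le_sum (f := fun j => ∑ k, (‖columnL j‖ + ‖columnL k‖ +
    ∑ i, ‖(entryL j k).smulRight (basisVec i)‖)) (fun j _ => by positivity) (Finset.mem_univ j))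
  exact Finset.single_le_sum (f := fun k => ‖columnL j‖ + ‖columnL k‖ +
    ∑ i, ‖(entryL j k).smulRight (basisVec i)‖) (fun j _ => by positivity) (Finset.mem_univ k)

theorem H2.norm_le {Ω : Set Plane} (z : H2 Ω Y) :
    ‖z‖ ≤ ‖H2.fn z‖ + ∑ j, ‖(z : H2Ambient Ω Y).snd j‖ := by
  have h1 : ‖z‖ ^ 2 = ‖(z : H2Ambient Ω Y).fst‖ ^ 2 + ‖(z : H2Ambient Ω Y).snd‖ ^ 2 :=
    WithLp.prod_norm_sq_eq_of_L2 (z : H2Ambient Ω Y)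
  refine abs_le_of_sq_le_sq' ?_ (by positivity) |>.2
  rw [h1, PiLp.norm_sq_eq_of_L2, Fin.sum_univ_two, Fin.sum_univ_two]
  change ‖H2.fn z‖ ^ 2 + _ ≤ _
  have h1 := norm_nonneg (H2.fn z)
  have h2 := norm_nonneg ((z : H2Ambient Ω Y).snd 0)
  have h3 := norm_nonneg ((z : H2Ambient Ω Y).snd 1)
  nlinarith [mul_nonneg h1 h2, mul_nonneg h1 h3, mul_nonneg h2 h3]

/-- A displacement whose symmetrized gradient is of class `H¹` is of class `H²`. -/
theorem exists_H2_of_symGradLp : ∃ C : ℝ, 0 ≤ C ∧ ∀ {Ω : Set Plane} (v : H1 Ω Plane)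
    (E : H1 Ω Sym2x2), H1.fn E = symGradLp v →
    ∃ z : H2 Ω Plane, H2.fn z = v ∧ ‖z‖ ≤ C * (‖v‖ + ‖E‖) := by
  obtain ⟨C, hC, h⟩ := norm_secondPartial_le
  refine ⟨4 * C + 3, by positivity, fun v E hE => ?_⟩
  let D : Fin 2 → H1 _ Plane := fun j => H1.mk (H1.pd j v) (fun k => secondPartial E j k)
    fun k => isWeakPartial_secondPartial hE j k
  have hD : ∀ j, ‖D j‖ ≤ ‖v‖ + 2 * (C * ‖E‖) := by
    intro j
    refine (H1.norm_le _).trans ?_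
    rw [Fin.sum_univ_two]
    have h1 : ‖H1.fn (D j)‖ ≤ ‖v‖ := norm_pd_le j v
    have h2 : ∀ k, ‖H1.pd k (D j)‖ ≤ C * ‖E‖ := fun k => h E j k
    linarith [h2 0, h2 1]
  refine ⟨⟨WithLp.toLp 2 (v, WithLp.toLp 2 D), fun j => rfl⟩, rfl, (H2.norm_le _).trans ?_⟩
  rw [Fin.sum_univ_two]
  change ‖v‖ + (‖D 0‖ + ‖D 1‖) ≤ _
  nlinarith [hD 0, hD 1, norm_nonneg v, norm_nonneg E, mul_nonneg hC (norm_nonneg v)]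

end SobolevSpaces

/-! ### Regularity of the visco-plastic evolution -/

section Viscoplastic

/-- The weak divergence tested with `φ`, as a continuous linear form. -/
def divForm {Ω : Set Plane} {φ : Plane → ℝ} (hφ : IsTestFunction Ω φ) (i : Fin 2) :
    L2 Ω Sym2x2 →L[ℝ] ℝ :=
  ∑ j, (weightedIntegral Ω _ (hφ.memLp_partialDeriv j)).comp
    ((entryL i j).compLpL 2 (volume.restrict Ω))

theorem divForm_apply {Ω : Set Plane} {φ : Plane → ℝ} (hφ : IsTestFunction Ω φ) (i : Fin 2)
    (τ : L2 Ω Sym2x2) :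
    divForm hφ i τ = ∫ x in Ω, ∑ j, entry (τ x) i j * partialDeriv j φ x := by
  have hint : ∀ j, Integrable (fun x => partialDeriv j φ x • ((entryL i j).compLp τ : L2 Ω ℝ) x)
      (volume.restrict Ω) := fun j => (hφ.pd j).integrable_smul _
  have h1 : divForm hφ i τ = ∑ j, ∫ x in Ω, partialDeriv j φ x • ((entryL i j).compLp τ : L2 Ω ℝ) x := by
    rw [divForm, sum_apply]
    exact Finset.sum_congr rfl fun j _ => weightedIntegral_apply _ _ _ _
  rw [h1, ← integral_finsetSum _ fun j _ => hint j]
  refine integral_congr_ae ?_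
  filter_upwards [ae_all_iff.2 fun j => (entryL i j).coeFn_compLp τ] with x hx
  refine Finset.sum_congr rfl fun j _ => ?_
  rw [hx j, smul_eq_mul, mul_comm, entryL_apply]

/-- The stress fields without divergence. -/
def divFree (Ω : Set Plane) : Submodule ℝ (L2 Ω Sym2x2) :=
  ⨅ (φ : Plane → ℝ) (hφ : IsTestFunction Ω φ) (i : Fin 2), LinearMap.ker (divForm hφ i).toLinearMap

theorem mem_divFree {Ω : Set Plane} {τ : L2 Ω Sym2x2} :
    τ ∈ divFree Ω ↔ ∀ (φ : Plane → ℝ) (hφ : IsTestFunction Ω φ) (i : Fin 2), divForm hφ i τ = 0 := by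
  simp only [divFree, Submodule.mem_iInf, LinearMap.mem_ker]
  rfl

theorem isClosed_divFree (Ω : Set Plane) : IsClosed (divFree Ω : Set (L2 Ω Sym2x2)) := by
  have : (divFree Ω : Set (L2 Ω Sym2x2)) =
      ⋂ (φ : Plane → ℝ) (hφ : IsTestFunction Ω φ) (i : Fin 2), {τ | divForm hφ i τ = 0} := by
    ext τ
    simp only [SetLike.mem_coe, mem_divFree, mem_iInter]
    rfl
  rw [this]
  exact isClosed_iInter fun φ => isClosed_iInter fun hφ => isClosed_iInter fun i =>
    isClosed_eq (divForm hφ i).continuous continuous_const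

theorem hasWeakDiv_zero_of_mem {Ω : Set Plane} {τ : L2 Ω Sym2x2} (h : τ ∈ divFree Ω) :
    HasWeakDiv Ω τ 0 := by
  intro φ hφ i
  rw [← divForm_apply hφ, mem_divFree.1 h φ hφ i, eq_comm, neg_eq_zero,
    ← integral_zero Plane ℝ (μ := volume.restrict Ω)]
  refine integral_congr_ae ?_
  filter_upwards [Lp.coeFn_zero Plane 2 (volume.restrict Ω)] with x hx
  rw [hx]
  simp

/-- The load cancels between the stress and `χ`. Their difference moves in a fixed closed subspace,
which therefore contains its time derivative too. -/
theorem HasWeakDiv.sub_mem {Ω : Set Plane} {τ τ' : L2 Ω Sym2x2} {g : L2 Ω Plane}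
    (h : HasWeakDiv Ω τ g) (h' : HasWeakDiv Ω τ' g) : τ - τ' ∈ divFree Ω := by
  refine mem_divFree.2 fun φ hφ i => ?_
  rw [map_sub, divForm_apply, divForm_apply, h φ hφ i, h' φ hφ i, sub_self]

theorem IsTestFunction.add {Y : Type} [NormedAddCommGroup Y] [NormedSpace ℝ Y] {Ω : Set Plane}
    {φ ψ : Plane → Y} (hφ : IsTestFunction Ω φ) (hψ : IsTestFunction Ω ψ) :
    IsTestFunction Ω (φ + ψ) :=
  ⟨hφ.1.add hψ.1, hφ.2.1.add hψ.2.1, (tsupport_add φ ψ).trans (union_subset hφ.2.2 hψ.2.2)⟩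

theorem IsTestFunction.const_smul {Y : Type} [NormedAddCommGroup Y] [NormedSpace ℝ Y]
    {Ω : Set Plane} {φ : Plane → Y} (hφ : IsTestFunction Ω φ) (c : ℝ) :
    IsTestFunction Ω (fun x => c • φ x) :=
  ⟨contDiff_const.smul hφ.1, hφ.2.1.comp_left (g := fun y => c • y) (smul_zero c),
    (closure_mono (Function.support_comp_subset (g := fun y : Y => c • y) (smul_zero c) φ)).trans
      hφ.2.2⟩

/-- The functions that agree with a test function. -/
def testSpace (Ω : Set Plane) : Submodule ℝ (H1 Ω Plane) where
  carrier := {v | ∃ φ : Plane → Plane, IsTestFunction Ω φ ∧ H1.fn v =ᵐ[volume.restrict Ω] φ}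
  add_mem' := by
    rintro v w ⟨φ, hφ, hv⟩ ⟨ψ, hψ, hw⟩
    refine ⟨φ + ψ, hφ.add hψ, ?_⟩
    rw [H1.fn_add]
    filter_upwards [Lp.coeFn_add (H1.fn v) (H1.fn w), hv, hw] with x h1 h2 h3
    rw [h1, Pi.add_apply, Pi.add_apply, h2, h3]
  zero_mem' :=
    ⟨0, ⟨contDiff_const, HasCompactSupport.zero, by simp⟩,
      Lp.coeFn_zero Plane 2 (volume.restrict Ω)⟩
  smul_mem' := by
    rintro c v ⟨φ, hφ, hv⟩
    refine ⟨fun x => c • φ x, hφ.const_smul c, ?_⟩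
    rw [H1.fn_smul]
    filter_upwards [Lp.coeFn_smul c (H1.fn v), hv] with x h1 h2
    rw [h1, Pi.smul_apply, h2]

/-- The functions with zero boundary values, as a closed subspace. -/
def zeroBoundary (Ω : Set Plane) : Submodule ℝ (H1 Ω Plane) := (testSpace Ω).topologicalClosure

theorem mem_zeroBoundary {Ω : Set Plane} {v : H1 Ω Plane} :
    v ∈ zeroBoundary Ω ↔ v ∈ H10 Ω Plane :=
  Iff.rfl

theorem isClosed_zeroBoundary (Ω : Set Plane) :
    IsClosed (zeroBoundary Ω : Set (H1 Ω Plane)) :=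
  Submodule.isClosed_topologicalClosure _

theorem symGradLp_eq_of_isAdmissible {Ω : Set Plane} {w v : H1 Ω Plane} {η q : L2 Ω Sym2x2}
    (h : IsAdmissible Ω w v η q) : symGradLp v = η + q := by
  apply Lp.ext
  filter_upwards [coeFn_symGradLp v, h.1, Lp.coeFn_add η q] with x h1 h2 h3
  rw [h1, h2, h3, Pi.add_apply]

/-- The flow rule bounds the plastic strain rate. -/
theorem norm_le_of_flowRule {Ω : Set Plane} {α κ ε : ℝ} (hκ : 0 ≤ κ) (hε : 0 < ε)
    {σ q : L2 Ω Sym2x2}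
    (h : ∀ᵐ x ∂volume.restrict Ω, σ x - ε • q x ∈ subdifferential (supportFun α κ) (q x)) :
    ‖q‖ ≤ ε⁻¹ * ‖σ‖ := by
  refine Lp.norm_le_mul_norm_of_ae_le_mul ?_
  filter_upwards [h] with x hx
  simpa using norm_sub_le_of_flowRule hκ hε hx (zero_mem_subdifferential hκ ε)

/-- The flow rule bounds the localized difference quotients of the plastic strain rate. -/
theorem norm_mulOp_diffOp_le_of_flowRule {Ω : Set Plane} (hΩ : MeasurableSet Ω) {η : Plane → ℝ}
    (hη : IsTestFunction Ω η) {α κ ε : ℝ} (hκ : 0 ≤ κ) (hε : 0 < ε) {σ q : L2 Ω Sym2x2}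
    (h : ∀ᵐ x ∂volume.restrict Ω, σ x - ε • q x ∈ subdifferential (supportFun α κ) (q x))
    (a : Plane) :
    ‖mulOp hη (diffOp a (ext hΩ q))‖ ≤ ε⁻¹ * ‖mulOp hη (diffOp a (ext hΩ σ))‖ := by
  -- The pair extended by zero obeys the flow rule in the whole plane, so points shifted out of `Ω`
  -- need no separate treatment.
  have hext : ∀ᵐ x, ext hΩ σ x - ε • ext hΩ q x ∈
      subdifferential (supportFun α κ) (ext hΩ q x) := by
    filter_upwards [coeFn_ext hΩ σ, coeFn_ext hΩ q, (ae_restrict_iff' hΩ).1 h] with x h1 h2 h3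
    rw [h1, h2]
    by_cases hx : x ∈ Ω
    · rw [indicator_of_mem hx, indicator_of_mem hx]
      exact h3 hx
    · rw [indicator_of_notMem hx, indicator_of_notMem hx]
      exact zero_mem_subdifferential hκ ε
  refine Lp.norm_le_mul_norm_of_ae_le_mul ?_
  filter_upwards [coeFn_mulOp hη (diffOp a (ext hΩ q)), coeFn_mulOp hη (diffOp a (ext hΩ σ)),
    coeFn_diffOp a (ext hΩ q), coeFn_diffOp a (ext hΩ σ), hext,
    (measurePreserving_add_const a).quasiMeasurePreserving.ae hext] with x h1 h2 h3 h4 h5 h6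
  rw [h1, h2, h3, h4, norm_smul, norm_smul]
  have h7 := mul_le_mul_of_nonneg_left (norm_sub_le_of_flowRule hκ hε h6 h5) (norm_nonneg (η x))
  linarith

theorem norm_stress_le {Ω : Set Plane} (lam mu : ℝ) (e : L2 Ω Sym2x2) :
    ‖stress lam mu e‖ ≤ ‖elasticity lam mu‖ * ‖e‖ :=
  (elasticity lam mu).norm_compLp_le e

theorem norm_mulOp_diffOp_stress_le {Ω : Set Plane} (hΩ : MeasurableSet Ω) {η : Plane → ℝ}
    (hη : IsTestFunction Ω η) (lam mu : ℝ) (e : L2 Ω Sym2x2) (a : Plane) :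
    ‖mulOp hη (diffOp a (ext hΩ (stress lam mu e)))‖ ≤
      ‖elasticity lam mu‖ * ‖mulOp hη (diffOp a (ext hΩ e))‖ := by
  rw [stress, ← mapOp_ext, ← mapOp_diffOp, ← mapOp_mulOp]
  exact (elasticity lam mu).norm_compLp_le _

/-- Functions in `H¹_loc` have bounded localized difference quotients. -/
theorem exists_norm_mulOp_diffOp_le_of_memH1Loc {Y : Type} [NormedAddCommGroup Y]
    [InnerProductSpace ℝ Y] [CompleteSpace Y] {Ω : Set Plane} (hΩ : IsOpen Ω) {η : Plane → ℝ}
    (hη : IsTestFunction Ω η) {f : L2 Ω Y} (hf : MemH1Loc Ω f) :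
    ∃ c d : ℝ, 0 < d ∧ ∀ i, ∀ h ∈ Ioo 0 d,
      ‖mulOp hη (diffOp (h • basisVec i) (ext hΩ.measurableSet f))‖ ≤ h * c := by
  obtain ⟨-, d, -, hd, hdΩ, -⟩ := exists_cutoff hΩ hη.2.1 hη.2.2
  -- A neighbourhood of the support of `η`, compactly contained in `Ω`: there `f` is of class `H¹`,
  -- and short shifts of the support stay inside it.
  set Ω' := Metric.thickening d (tsupport η) with hΩ'
  have hΩ'o : IsOpen Ω' := Metric.isOpen_thickening
  have hcl : closure Ω' ⊆ Metric.cthickening d (tsupport η) :=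
    Metric.closure_thickening_subset_cthickening d _
  have hsub : Ω' ⊆ Ω := subset_closure.trans (hcl.trans hdΩ)
  obtain ⟨g, hg⟩ := hf Ω' ⟨hΩ'o,
    (hη.2.1.isCompact.cthickening).of_isClosed_subset isClosed_closure hcl, hcl.trans hdΩ⟩
  have hη' : IsTestFunction Ω' η := ⟨hη.1, hη.2.1, Metric.self_subset_thickening hd _⟩
  obtain ⟨C, d', hC, hd', h⟩ := exists_norm_mulOp_diffOp_le (Y := Y) hΩ'o hη'
  refine ⟨C * ‖g‖, min d d', lt_min hd hd', fun i t ht => ?_⟩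
  have hn : ‖t • basisVec i‖ < d := by
    rw [norm_smul, norm_basisVec, mul_one, Real.norm_of_nonneg ht.1.le]
    exact ht.2.trans_le (min_le_left _ _)
  have h1 := h g i t ⟨ht.1, ht.2.trans_le (min_le_right _ _)⟩
  rw [mulOp_diffOp_congr hη hn (G := ext hΩ'o.measurableSet (H1.fn g))]
  · exact h1
  · filter_upwards [coeFn_ext hΩ.measurableSet f, coeFn_ext hΩ'o.measurableSet (H1.fn g),
      (ae_restrict_iff' hΩ'o.measurableSet).1 hg] with x h1 h2 h3 hx
    rw [h1, h2, indicator_of_mem (hsub hx), indicator_of_mem hx, h3 hx]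

/-- The localized difference quotients of the curve `f'` and of the vector `f₀` are bounded, with
bounds that are square integrable in time. -/
def HasQuotientBound {Y : Type} [NormedAddCommGroup Y] [InnerProductSpace ℝ Y] {Ω : Set Plane}
    (hΩ : IsOpen Ω) (T : ℝ) (f' : ℝ → L2 Ω Y) : Prop :=
  ∀ (η : Plane → ℝ) (hη : IsTestFunction Ω η), ∃ (m : ℝ → ℝ) (d : ℝ), MemLpTime 2 T m ∧ 0 < d ∧
    ∀ᵐ t ∂volume.restrict (Ioo 0 T), ∀ i, ∀ h ∈ Ioo 0 d,
      ‖mulOp hη (diffOp (h • basisVec i) (ext hΩ.measurableSet (f' t)))‖ ≤ h * m t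

/-! ### From quotient bounds to interior Sobolev regularity of curves. -/

section Regularity

variable {Y : Type} [NormedAddCommGroup Y] [InnerProductSpace ℝ Y] [CompleteSpace Y]

theorem exists_cutoff_eq_one {Ω Ω' : Set Plane} (hΩ : IsOpen Ω)
    (h : OpenCompactlyContained Ω' Ω) :
    ∃ η : Plane → ℝ, IsTestFunction Ω η ∧ ∀ x ∈ Ω', η x = 1 := by
  obtain ⟨η, d, hη, hd, -, h1⟩ := exists_cutoff hΩ h.2.1 h.2.2
  exact ⟨η, hη, fun x hx => (h1 x (Metric.self_subset_thickening hd _ (subset_closure hx))).1⟩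

/-- At almost every time the quotient bound gives a local `H¹` representative of norm at most `‖f t‖
+ 2 m t`. The lifting lemma makes it measurable in time, and the bound makes it square integrable.
-/
theorem exists_memLpTime_H1 [SecondCountableTopology Y] {Ω Ω' : Set Plane} (hΩ : IsOpen Ω)
    (hΩ' : OpenCompactlyContained Ω' Ω) {T : ℝ} {f : ℝ → L2 Ω Y} (hf : MemLpTime 2 T f)
    (hb : HasQuotientBound hΩ T f) :
    ∃ g : ℝ → H1 Ω' Y, MemLpTime 2 T g ∧
      ∀ᵐ t ∂volume.restrict (Ioo 0 T), H1.fn (g t) = restL Ω' hΩ (f t) := by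
  obtain ⟨η, hη, hη1⟩ := exists_cutoff_eq_one hΩ hΩ'
  obtain ⟨m, d, hm, hd, hmd⟩ := hb η hη
  have := secondCountableTopology_H1 Ω' Y
  have := secondCountableTopology_L2 Ω' Y
  have hF : MemLpTime 2 T (fun t => restL Ω' hΩ (f t)) := hf.map _
  obtain ⟨g, hgm, hg⟩ := exists_aestronglyMeasurable_lift (ι := (H1.fn : H1 Ω' Y → L2 Ω' Y))
    H1.continuous_fn (fun v w h => H1.ext_fn hΩ'.1 h) hF.1 (m := fun t => ‖f t‖ + 2 * m t) (by
      filter_upwards [hmd] with t ht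
      exact exists_H1_of_mulOp_diffOp_le hΩ hΩ'.1 hη hη1 hd ht)
  refine ⟨g, MemLp.of_le (hf.norm.add (hm.const_mul 2)) hgm ?_, hg.mono fun t ht => ht.1⟩
  filter_upwards [hg] with t ht
  exact ht.2.trans (le_abs_self _)

theorem memL2TimeH1Loc_of_hasQuotientBound [SecondCountableTopology Y] {Ω : Set Plane}
    (hΩ : IsOpen Ω) {T : ℝ} {f : ℝ → L2 Ω Y} (hf : MemLpTime 2 T f)
    (hb : HasQuotientBound hΩ T f) : MemL2TimeH1Loc Ω T f := by
  intro Ω' hΩ'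
  obtain ⟨g, hg, hgf⟩ := exists_memLpTime_H1 hΩ hΩ' hf hb
  refine ⟨g, hg, hgf.mono fun t ht => ?_⟩
  rw [ht]
  exact coeFn_restL hΩ (subset_closure.trans hΩ'.2.2) (f t)

theorem memH1TimeH1Loc_of_hasQuotientBound [SecondCountableTopology Y] {Ω : Set Plane}
    (hΩ : IsOpen Ω) {T : ℝ} (hT : 0 < T) {f f' : ℝ → L2 Ω Y} (hf' : MemLpTime 2 T f')
    (hf : ∀ t ∈ Icc 0 T, f t = f 0 + ∫ s in (0 : ℝ)..t, f' s) (hb : HasQuotientBound hΩ T f')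
    (h0 : ∀ (η : Plane → ℝ) (hη : IsTestFunction Ω η), ∃ c d : ℝ, 0 < d ∧ ∀ i, ∀ h ∈ Ioo 0 d,
      ‖mulOp hη (diffOp (h • basisVec i) (ext hΩ.measurableSet (f 0)))‖ ≤ h * c) :
    MemH1TimeH1Loc Ω T f := by
  intro Ω' hΩ'
  obtain ⟨g, hg, hgf⟩ := exists_memLpTime_H1 hΩ hΩ' hf' hb
  obtain ⟨η, hη, hη1⟩ := exists_cutoff_eq_one hΩ hΩ'
  obtain ⟨c, d, hd, hcd⟩ := h0 η hη
  obtain ⟨g₀, hg₀, -⟩ := exists_H1_of_mulOp_diffOp_le hΩ hΩ'.1 hη hη1 hd hcd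
  -- The lifted curve is the primitive, taken in `H¹`, of the lifted rate, starting from the lifted
  -- initial value. The inclusion in `L²` commutes with the integral, so it agrees with `f` at every
  -- time.
  refine ⟨fun t => g₀ + ∫ s in (0 : ℝ)..t, g s, ⟨g, hg, fun t _ => by simp⟩, fun t ht => ?_⟩
  have hsub : uIcc 0 t ⊆ uIcc 0 T := by
    rw [uIcc_of_le hT.le, uIcc_of_le ht.1]
    exact Icc_subset_Icc_right ht.2
  have h1 : H1.fn (g₀ + ∫ s in (0 : ℝ)..t, g s) = restL Ω' hΩ (f t) := by
    have h2 := (H1.fnL Ω' Y).intervalIntegral_comp_comm ((hg.intervalIntegrable hT).mono_set hsub)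
    have h3 := (restL (Y := Y) Ω' hΩ).intervalIntegral_comp_comm
      ((hf'.intervalIntegrable hT).mono_set hsub)
    have h4 : ∫ s in (0 : ℝ)..t, H1.fnL Ω' Y (g s) = ∫ s in (0 : ℝ)..t, restL Ω' hΩ (f' s) := by
      refine intervalIntegral.integral_congr_ae_restrict ?_
      rw [uIoc_of_le ht.1]
      refine ae_restrict_of_ae_restrict_of_subset (Ioc_subset_Ioc_right ht.2) ?_
      rw [← Measure.restrict_congr_set Ioo_ae_eq_Ioc]
      exact hgf
    rw [hf t ht, map_add, ← h3, ← h4, h2, ← hg₀]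
    rfl
  change H1.fn (g₀ + ∫ s in (0 : ℝ)..t, g s) =ᵐ[volume.restrict Ω'] f t
  rw [h1]
  exact coeFn_restL hΩ (subset_closure.trans hΩ'.2.2) (f t)

end Regularity

theorem exists_H2_of_restL_symGradLp {Ω Ω' : Set Plane} (hΩ : IsOpen Ω) (hsub : Ω' ⊆ Ω) :
    ∃ C : ℝ, ∀ (v : H1 Ω Plane) (E : H1 Ω' Sym2x2), H1.fn E = restL Ω' hΩ (symGradLp v) →
    ∃ z : H2 Ω' Plane, H1.fn (H2.fn z) = restL Ω' hΩ (H1.fn v) ∧ ‖z‖ ≤ C * (‖v‖ + ‖E‖) := by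
  obtain ⟨C, hC, hH2⟩ := exists_H2_of_symGradLp
  refine ⟨C, fun v E h => ?_⟩
  obtain ⟨z, hz, hzn⟩ := hH2 (H1.restrict hΩ hsub v) E (by rw [symGradLp_restrict]; exact h)
  refine ⟨z, by rw [hz]; rfl, hzn.trans ?_⟩
  exact mul_le_mul_of_nonneg_left (by linarith [H1.norm_restrict_le hΩ hsub v]) hC

theorem MemLpTime.symGradLp {Ω : Set Plane} {q : ℝ≥0∞} {T : ℝ} {v : ℝ → H1 Ω Plane}
    (hv : MemLpTime q T v) : MemLpTime q T (fun t => symGradLp (v t)) :=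
  MemLpTime.map (Z := L2 Ω Sym2x2) hv (symGradL Ω)

/-- Quotient bounds are needed only for the symmetrized gradient: its local `H¹` regularity gives
the `H²` regularity of `v` at almost every time, and the lifting lemma is applied to the injection
of `H²` in `L²`. -/
theorem memL2TimeH2Loc_of_hasQuotientBound {Ω : Set Plane} (hΩ : IsOpen Ω) {T : ℝ}
    {v : ℝ → H1 Ω Plane} (hv : MemLpTime 2 T v)
    (hb : HasQuotientBound hΩ T (fun t => symGradLp (v t))) :
    MemL2TimeH2Loc Ω T (fun t => H1.fn (v t)) := by
  intro Ω' hΩ'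
  have hsub : Ω' ⊆ Ω := subset_closure.trans hΩ'.2.2
  obtain ⟨E, hE, hEv⟩ := exists_memLpTime_H1 hΩ hΩ' hv.symGradLp hb
  obtain ⟨C, hH2⟩ := exists_H2_of_restL_symGradLp hΩ hsub
  have h1 := secondCountableTopology_H2 Ω' Plane
  have h2 := secondCountableTopology_L2 Ω' Plane
  have hF : MemLpTime 2 T (fun t => restL Ω' hΩ (H1.fn (v t))) :=
    MemLpTime.map (Z := L2 Ω' Plane) (MemLpTime.map (Z := L2 Ω Plane) hv (H1.fnL Ω Plane))
      (restL Ω' hΩ)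
  have hpt : ∀ᵐ t ∂volume.restrict (Ioo 0 T), ∃ z : H2 Ω' Plane,
      H1.fn (H2.fn z) = restL Ω' hΩ (H1.fn (v t)) ∧ ‖z‖ ≤ C * (‖v t‖ + ‖E t‖) :=
    hEv.mono fun t ht => hH2 (v t) (E t) ht
  have hc : Continuous fun z : H2 Ω' Plane => H1.fn (H2.fn z) :=
    H1.continuous_fn.comp (H2.fnL Ω' Plane).continuous
  have hinj : Function.Injective fun z : H2 Ω' Plane => H1.fn (H2.fn z) :=
    fun z z' h => H2.ext_fn hΩ'.1 (H1.ext_fn hΩ'.1 h)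
  obtain ⟨g, hgm, hg⟩ := exists_aestronglyMeasurable_lift hc hinj hF.1 hpt
  have hm : MemLp (fun t => C * (‖v t‖ + ‖E t‖)) 2 (volume.restrict (Ioo 0 T)) :=
    (MemLp.add (MemLp.norm hv) (MemLp.norm hE)).const_mul C
  refine ⟨g, MemLp.of_le hm hgm ?_, hg.mono fun t ht => ?_⟩
  · exact hg.mono fun t ht => ht.2.trans (le_abs_self _)
  · rw [ht.1]
    exact coeFn_restL hΩ hsub _

end Viscoplastic

/-! ### Normed structures of the function spaces. -/

section Instances

/-- The norm of `L²(Ω; Y)`. -/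
@[reducible] def normedAddCommGroupL2 (Ω : Set Plane) (Y : Type) [NormedAddCommGroup Y] :
    NormedAddCommGroup (L2 Ω Y) := inferInstance

/-- The vector space structure of `L²(Ω; Y)`. -/
@[reducible] def normedSpaceL2 (Ω : Set Plane) (Y : Type) [NormedAddCommGroup Y]
    [InnerProductSpace ℝ Y] : NormedSpace ℝ (L2 Ω Y) := inferInstance

/-- The norm of `L²(Ω; 𝕄)`. -/
@[reducible] def normedAddCommGroupL2Sym (Ω : Set Plane) : NormedAddCommGroup (L2 Ω Sym2x2) :=
  normedAddCommGroupL2 Ω Sym2x2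

/-- The vector space structure of `L²(Ω; 𝕄)`. -/
@[reducible] def normedSpaceL2Sym (Ω : Set Plane) : NormedSpace ℝ (L2 Ω Sym2x2) :=
  normedSpaceL2 Ω Sym2x2

variable (Ω : Set Plane) (Y : Type) [NormedAddCommGroup Y] [InnerProductSpace ℝ Y] [CompleteSpace Y]

/-- The norm of `H¹(Ω; Y)`. -/
@[reducible] def normedAddCommGroupH1 : NormedAddCommGroup (H1 Ω Y) := (H1 Ω Y).normedAddCommGroup

/-- The vector space structure of `H¹(Ω; Y)`. -/
@[reducible] def normedSpaceH1 : NormedSpace ℝ (H1 Ω Y) := (H1 Ω Y).normedSpace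

/-- The vector space structure of `H²(Ω; Y)`. -/
@[reducible] def normedSpaceH2 : NormedSpace ℝ (H2 Ω Y) := (H2 Ω Y).normedSpace

end Instances

/-! ### The rate equations and the closing of the estimate. -/

section Solution

attribute [local instance] normedAddCommGroupL2Sym normedSpaceL2Sym normedAddCommGroupH1
  normedSpaceH1 normedSpaceH2

theorem hasDerivAt_map {X Z : Type} [NormedAddCommGroup X] [NormedSpace ℝ X]
    [NormedAddCommGroup Z] [NormedSpace ℝ Z] (L : X →L[ℝ] Z) {f : ℝ → X} {f' : X} {t : ℝ}
    (h : HasDerivAt f f' t) : HasDerivAt (fun s => L (f s)) (L f') t :=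
  L.hasFDerivAt.comp_hasDerivAt t h

theorem hasDerivAt_stress {Ω : Set Plane} (lam mu : ℝ) {e : ℝ → L2 Ω Sym2x2} {e' : L2 Ω Sym2x2}
    {t : ℝ} (h : HasDerivAt e e' t) :
    HasDerivAt (fun s => stress lam mu (e s)) (stress lam mu e') t :=
  hasDerivAt_map (X := L2 Ω Sym2x2) (Z := L2 Ω Sym2x2)
    ((elasticity lam mu).compLpL 2 (volume.restrict Ω)) h

theorem hasDerivAt_symGradLp {Ω : Set Plane} {u : ℝ → H1 Ω Plane} {u' : H1 Ω Plane}
    {t : ℝ} (h : HasDerivAt u u' t) :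
    HasDerivAt (fun s => symGradLp (u s)) (symGradLp u') t :=
  hasDerivAt_map (X := H1 Ω Plane) (Z := L2 Ω Sym2x2) (symGradL Ω) h

/-- The rates of a curve of solutions: they satisfy almost everywhere in time the kinematic
relation, the boundary condition, the equilibrium condition and the flow rule. -/
structure IsRate (Ω : Set Plane) (T lam mu α κ ε : ℝ) (e : ℝ → L2 Ω Sym2x2)
    (w' v : ℝ → H1 Ω Plane) (e' q : ℝ → L2 Ω Sym2x2) (X : ℝ → H1 Ω Sym2x2) : Prop where
  memLp_w : MemLpTime 2 T w'
  memLp_X : MemLpTime 2 T X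
  int_v : IntervalIntegrable v volume 0 T
  int_e : IntervalIntegrable e' volume 0 T
  int_q : IntervalIntegrable q volume 0 T
  eq_integral : ∀ t ∈ Icc 0 T, e t = e 0 + ∫ s in (0 : ℝ)..t, e' s
  compat : ∀ᵐ t ∂volume.restrict (Ioo 0 T), symGradLp (v t) = e' t + q t
  boundary : ∀ᵐ t ∂volume.restrict (Ioo 0 T), v t - w' t ∈ H10 Ω Plane
  equilibrium : ∀ᵐ t ∂volume.restrict (Ioo 0 T),
    HasWeakDiv Ω (stress lam mu (e' t) - H1.fn (X t)) 0
  flow_rule : ∀ᵐ t ∂volume.restrict (Ioo 0 T), ∀ᵐ x ∂volume.restrict Ω,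
    stress lam mu (e t) x - ε • q t x ∈ subdifferential (supportFun α κ) (q t x)

/-- Compatibility, boundary condition and equilibrium say that linear images of the solution agree
or lie in closed subspaces at all times, so they pass to the rates wherever the derivatives exist.
The function `X` is the rate of `χ` as a curve in `H¹`, and the flow rule already involves only a
rate. -/
theorem IsViscoplasticSolution.exists_isRate {Ω : Set Plane} {T lam mu α κ ε : ℝ} (hT : 0 < T)
    {w : ℝ → H1 Ω Plane} {f : ℝ → L2 Ω Plane} {χ : ℝ → L2 Ω Sym2x2}
    (hsafe : IsSafeLoad Ω T α κ f χ) (hw : MemH1TimeH2 Ω T w) (hχ : MemH1TimeH1 Ω T χ)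
    {u₀ : H1 Ω Plane} {e₀ p₀ : L2 Ω Sym2x2} {u : ℝ → H1 Ω Plane} {e p : ℝ → L2 Ω Sym2x2}
    (hsol : IsViscoplasticSolution Ω T lam mu α κ ε w f u₀ e₀ p₀ u e p) :
    ∃ (w' v : ℝ → H1 Ω Plane) (e' q : ℝ → L2 Ω Sym2x2) (X : ℝ → H1 Ω Sym2x2),
      IsRate Ω T lam mu α κ ε e w' v e' q X ∧
      (∀ᵐ t ∂volume.restrict (Ioo 0 T), deriv u t = v t) ∧
      ∀ᵐ t ∂volume.restrict (Ioo 0 T), deriv p t = q t := by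
  have i1 := secondCountableTopology_H1 Ω Plane
  have i2 := secondCountableTopology_L2 Ω Sym2x2
  obtain ⟨v, hvi, hv⟩ := exists_eq_integral_of_absolutelyContinuous hT hsol.ac_u
  obtain ⟨e', hei, he⟩ := exists_eq_integral_of_absolutelyContinuous hT hsol.ac_e
  obtain ⟨q, hqi, hq⟩ := exists_eq_integral_of_absolutelyContinuous hT hsol.ac_p
  have hvd := ae_hasDerivAt_of_eq_integral hT hvi hv
  have hed := ae_hasDerivAt_of_eq_integral hT hei he
  have hqd := ae_hasDerivAt_of_eq_integral hT hqi hq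
  obtain ⟨W, hW, hWf⟩ := hw
  obtain ⟨w2, hw2, hwd⟩ := exists_ae_hasDerivAt_map_of_memH1Time hT hW (H2.fnL Ω Plane) hWf
  obtain ⟨G, hG, hGf⟩ := hχ
  obtain ⟨X, hX, hXd⟩ := exists_ae_hasDerivAt_map_of_memH1Time (Z := L2 Ω Sym2x2) hT hG
    (H1.fnL Ω Sym2x2) hGf
  obtain ⟨δ, -, hδ⟩ := hsafe
  have hIoo : ∀ᵐ t ∂volume.restrict (Ioo 0 T), t ∈ Ioo 0 T := ae_restrict_mem measurableSet_Ioo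
  refine ⟨fun t => H2.fn (w2 t), v, e', q, X,
    ⟨MemLpTime.map (Z := H1 Ω Plane) hw2 (H2.fnL Ω Plane), hX, hvi, hei, hqi, he, ?_, ?_, ?_, ?_⟩,
    hvd.mono fun t ht => ht.deriv, hqd.mono fun t ht => ht.deriv⟩
  · filter_upwards [hvd, hed, hqd, hIoo] with t h1 h2 h3 ht
    refine (hasDerivAt_symGradLp h1).unique ((HasDerivAt.add h2 h3).congr_of_eventuallyEq ?_)
    filter_upwards [Icc_mem_nhds ht.1 ht.2] with s hs
    exact symGradLp_eq_of_isAdmissible (hsol.admissible s hs)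
  · filter_upwards [hvd, hwd, hIoo] with t h1 h2 ht
    refine mem_zeroBoundary.1 (mem_of_hasDerivAt (isClosed_zeroBoundary Ω)
      (f := fun s => u s - w s) (fun s hs => ?_) ht (h1.sub h2))
    exact mem_zeroBoundary.2 (hsol.admissible s hs).2
  · filter_upwards [hed, hXd, hIoo] with t h1 h2 ht
    refine hasWeakDiv_zero_of_mem (mem_of_hasDerivAt (isClosed_divFree Ω)
      (f := fun s => stress lam mu (e s) - χ s) (fun s hs => ?_) ht
      (HasDerivAt.sub (hasDerivAt_stress lam mu h1) h2))
    exact (hsol.equilibrium s hs).sub_mem (hδ s hs).1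
  · filter_upwards [hsol.flow_rule, hqd] with t h1 h2
    rw [← h2.deriv]
    exact h1

variable {Ω : Set Plane} {T lam mu α κ ε : ℝ} {e : ℝ → L2 Ω Sym2x2} {w' v : ℝ → H1 Ω Plane}
  {e' q : ℝ → L2 Ω Sym2x2} {X : ℝ → H1 Ω Sym2x2}

theorem IntervalIntegrable.aestronglyMeasurable_Ioo {Z : Type} [NormedAddCommGroup Z]
    {g : ℝ → Z} (hT : 0 < T) (hg : IntervalIntegrable g volume 0 T) :
    AEStronglyMeasurable g (volume.restrict (Ioo 0 T)) := by
  rw [Measure.restrict_congr_set Ioo_ae_eq_Ioc]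
  exact ((intervalIntegrable_iff_integrableOn_Ioc_of_le hT.le).1 hg).aestronglyMeasurable

theorem exists_bound_of_eq_integral {Z : Type} [NormedAddCommGroup Z] [NormedSpace ℝ Z]
    {f g : ℝ → Z} (hT : 0 < T) (hg : IntervalIntegrable g volume 0 T)
    (hf : ∀ t ∈ Icc 0 T, f t = f 0 + ∫ s in (0 : ℝ)..t, g s) :
    ∃ B, ∀ t ∈ Icc 0 T, ‖f t‖ ≤ B := by
  have h1 := intervalIntegral.continuousOn_primitive_interval' hg left_mem_uIcc
  rw [uIcc_of_le hT.le] at h1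
  exact isCompact_Icc.exists_bound_of_continuousOn ((continuousOn_const.add h1).congr hf)

theorem memLpTime_const (T D : ℝ) : MemLpTime 2 T (fun _ : ℝ => D) := by
  have : IsFiniteMeasure (volume.restrict (Ioo 0 T)) := ⟨by simp⟩
  unfold MemLpTime
  exact memLp_const D

theorem MemLpTime.add {Z : Type} [NormedAddCommGroup Z] {r : ℝ≥0∞} {T : ℝ} {f g : ℝ → Z}
    (hf : MemLpTime r T f) (hg : MemLpTime r T g) : MemLpTime r T (fun t => f t + g t) :=
  MemLp.add hf hg

theorem MemLpTime.const_mul {r : ℝ≥0∞} {T : ℝ} {f : ℝ → ℝ} (hf : MemLpTime r T f) (c : ℝ) :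
    MemLpTime r T (fun t => c * f t) :=
  MemLp.const_mul hf c

theorem MemLpTime.norm {Z : Type} [NormedAddCommGroup Z] {r : ℝ≥0∞} {T : ℝ} {f : ℝ → Z}
    (hf : MemLpTime r T f) : MemLpTime r T (fun t => ‖f t‖) :=
  MemLp.norm hf

/-- The rates are square integrable in time. -/
theorem IsRate.memLpTime (hΩ : IsOpen Ω) (hb : Bornology.IsBounded Ω) (hT : 0 < T)
    (hmu : 0 < mu) (hlam : 0 < lam + mu) (hκ : 0 ≤ κ) (hε : 0 < ε)
    (h : IsRate Ω T lam mu α κ ε e w' v e' q X) :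
    MemLpTime 2 T v ∧ MemLpTime 2 T e' ∧ MemLpTime 2 T q := by
  obtain ⟨C, hC, hglob⟩ := global_estimate hΩ hb hmu hlam
  obtain ⟨B, hB⟩ := exists_bound_of_eq_integral (Z := L2 Ω Sym2x2) hT h.int_e h.eq_integral
  have hl : 0 ≤ ‖elasticity lam mu‖ := ContinuousLinearMap.opNorm_nonneg _
  obtain ⟨D, hDdef⟩ : ∃ D, D = ε⁻¹ * (‖elasticity lam mu‖ * B) := ⟨_, rfl⟩
  -- The strain is continuous on a compact interval, hence bounded, and comparison with zero in the
  -- flow rule bounds the plastic rate uniformly in time. The global estimate does the rest.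
  have hq : ∀ᵐ t ∂volume.restrict (Ioo 0 T), ‖q t‖ ≤ D := by
    filter_upwards [h.flow_rule, ae_restrict_mem measurableSet_Ioo] with t h1 ht
    rw [hDdef]
    refine (norm_le_of_flowRule hκ hε h1).trans ?_
    refine mul_le_mul_of_nonneg_left ((norm_stress_le lam mu (e t)).trans ?_) (inv_nonneg.2 hε.le)
    exact mul_le_mul_of_nonneg_left (hB t (Ioo_subset_Icc_self ht)) hl
  have hD : MemLpTime 2 T (fun _ : ℝ => D) := memLpTime_const T D
  have hm : MemLpTime 2 T (fun t => C * (‖X t‖ + D + ‖w' t‖)) :=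
    ((h.memLp_X.norm.add hD).add h.memLp_w.norm).const_mul C
  have hest : ∀ᵐ t ∂volume.restrict (Ioo 0 T), ‖e' t‖ ≤ C * (‖X t‖ + D + ‖w' t‖) ∧
      ‖v t‖ ≤ C * (‖X t‖ + D + ‖w' t‖) := by
    filter_upwards [h.compat, h.boundary, h.equilibrium, hq] with t h1 h2 h3 h4
    have h5 := hglob (v t) (w' t) (e' t) (q t) (H1.fn (X t)) h1 h2 h3
    have h6 : C * (‖H1.fn (X t)‖ + ‖q t‖ + ‖w' t‖) ≤ C * (‖X t‖ + D + ‖w' t‖) :=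
      mul_le_mul_of_nonneg_left (by linarith [norm_fn_le (X t)]) hC
    exact ⟨h5.1.trans h6, h5.2.trans h6⟩
  refine ⟨?_, ?_, ?_⟩
  · exact MemLp.of_le (E := H1 Ω Plane) hm (IntervalIntegrable.aestronglyMeasurable_Ioo hT h.int_v)
      (hest.mono fun t ht => ht.2.trans (le_abs_self _))
  · exact MemLp.of_le (E := L2 Ω Sym2x2) hm
      (IntervalIntegrable.aestronglyMeasurable_Ioo hT h.int_e)
      (hest.mono fun t ht => ht.1.trans (le_abs_self _))
  · exact MemLp.of_le (E := L2 Ω Sym2x2) hD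
      (IntervalIntegrable.aestronglyMeasurable_Ioo hT h.int_q)
      (hq.mono fun t ht => ht.trans (le_abs_self _))

/-- Grönwall's inequality for one fixed shift, applied to the operator that extends, takes
differences and cuts off. The step `s` stays in front as a factor. -/
theorem norm_mulOp_diffOp_le_of_rate_le {Y : Type} [NormedAddCommGroup Y] [InnerProductSpace ℝ Y]
    [CompleteSpace Y] (hΩ : MeasurableSet Ω) (hT : 0 < T) {η : Plane → ℝ} (hη : IsTestFunction Ω η)
    {f g : ℝ → L2 Ω Y} (hg : IntervalIntegrable g volume 0 T)
    (hf : ∀ t ∈ Icc 0 T, f t = f 0 + ∫ s in (0 : ℝ)..t, g s) {m : ℝ → ℝ}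
    (hm : IntervalIntegrable m volume 0 T) (hm0 : ∀ t, 0 ≤ m t) {A c s : ℝ} (hA : 0 < A)
    (hs : 0 ≤ s) {a : Plane} (h0 : ‖mulOp hη (diffOp a (ext hΩ (f 0)))‖ ≤ s * c)
    (h : ∀ᵐ t ∂volume.restrict (Ioo 0 T), ‖mulOp hη (diffOp a (ext hΩ (g t)))‖ ≤
      s * m t + A * ‖mulOp hη (diffOp a (ext hΩ (f t)))‖) :
    ∀ t ∈ Icc 0 T, ‖mulOp hη (diffOp a (ext hΩ (f t)))‖ ≤
      s * ((c + ∫ s in (0 : ℝ)..T, m s) * Real.exp (A * T)) :=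
  norm_map_le_of_norm_map_deriv_le (X := L2 Ω Y) (Z := LR Y) hT hA
    ((mulOp hη).comp ((diffOp a).comp (ext hΩ))) hg hf hm hm0 hs h0 h

/-- Here `a`, `y`, `x`, `z` are the localized differences of the strain rate, the strain, the load
rate and the plastic rate, and `s` is the step. The added 1 keeps the constant in Grönwall's
inequality positive. -/
theorem rate_bound_aux {a x y z s v C D K X : ℝ} (hK : 0 ≤ K) (hy : 0 ≤ y)
    (h : a ≤ K * (x + z + s * v)) (hx : x ≤ s * (C * X)) (hz : z ≤ D * y) :
    a ≤ s * (K * (C * X + v)) + (K * D + 1) * y := by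
  have h1 := mul_le_mul_of_nonneg_left (add_le_add (add_le_add hx hz) (le_refl (s * v))) hK
  linarith

/-- Feeds the bound on the strain back into its rate and into the plastic rate. The absolute value
is there because `G` comes without a sign. -/
theorem rate_bound_aux' {a b y s m A D G : ℝ} (hA : 0 ≤ A) (hD : 0 ≤ D) (hs : 0 ≤ s) (hm : 0 ≤ m)
    (ha : a ≤ s * m + A * y) (hb : b ≤ D * y) (hy : y ≤ s * G) :
    a ≤ s * (m + (A * |G| + D * |G|)) ∧ b ≤ s * (m + (A * |G| + D * |G|)) := by
  have h5 : y ≤ s * |G| := hy.trans (mul_le_mul_of_nonneg_left (le_abs_self G) hs)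
  have h6 := mul_le_mul_of_nonneg_left h5 hA
  have h7 := mul_le_mul_of_nonneg_left h5 hD
  have h8 : 0 ≤ s * |G| := mul_nonneg hs (abs_nonneg G)
  have h9 : 0 ≤ s * m := mul_nonneg hs hm
  have h10 := mul_nonneg hA h8
  have h11 := mul_nonneg hD h8
  constructor <;> linarith

/-- The localized difference quotients of the rates are bounded. -/
theorem IsRate.exists_quotient_bound (hΩ : IsOpen Ω) (hb : Bornology.IsBounded Ω) (hT : 0 < T)
    (hmu : 0 < mu) (hlam : 0 < lam + mu) (hκ : 0 ≤ κ) (hε : 0 < ε)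
    (h : IsRate Ω T lam mu α κ ε e w' v e' q X) (he₀ : MemH1Loc Ω (e 0))
    {η : Plane → ℝ} (hη : IsTestFunction Ω η) :
    ∃ (m : ℝ → ℝ) (d : ℝ), MemLpTime 2 T m ∧ 0 < d ∧
      ∀ᵐ t ∂volume.restrict (Ioo 0 T), ∀ i, ∀ s ∈ Ioo 0 d,
        ‖mulOp hη (diffOp (s • basisVec i) (ext hΩ.measurableSet (e' t)))‖ ≤ s * m t ∧
        ‖mulOp hη (diffOp (s • basisVec i) (ext hΩ.measurableSet (q t)))‖ ≤ s * m t := by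
  obtain ⟨K, d₁, hK, hd₁, hint⟩ := interior_estimate hΩ hη hmu hlam
  obtain ⟨C, d₂, hC, hd₂, hX⟩ := exists_norm_mulOp_diffOp_le (Y := Sym2x2) hΩ hη
  obtain ⟨c, d₃, hd₃, hc⟩ := exists_norm_mulOp_diffOp_le_of_memH1Loc hΩ hη he₀
  obtain ⟨hv, -, -⟩ := h.memLpTime hΩ hb hT hmu hlam hκ hε
  have hl : 0 ≤ ‖elasticity lam mu‖ := ContinuousLinearMap.opNorm_nonneg _
  obtain ⟨D, hDdef⟩ : ∃ D, D = ε⁻¹ * ‖elasticity lam mu‖ := ⟨_, rfl⟩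
  have hD : 0 ≤ D := hDdef ▸ mul_nonneg (inv_nonneg.2 hε.le) hl
  have hA : 0 < K * D + 1 := by positivity
  obtain ⟨m, hmdef⟩ : ∃ m : ℝ → ℝ, m = fun t => K * (C * ‖X t‖ + ‖v t‖) := ⟨_, rfl⟩
  have hm : MemLpTime 2 T m := by
    rw [hmdef]
    exact ((h.memLp_X.norm.const_mul C).add hv.norm).const_mul K
  have hm0 : ∀ t, 0 ≤ m t := fun t => by
    rw [hmdef]
    exact mul_nonneg hK (add_nonneg (mul_nonneg hC (norm_nonneg (X t))) (norm_nonneg (v t)))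
  -- The exceptional set of times is that of the flow rule, so it does not depend on the shift.
  have hq : ∀ᵐ t ∂volume.restrict (Ioo 0 T), ∀ a,
      ‖mulOp hη (diffOp a (ext hΩ.measurableSet (q t)))‖ ≤
        D * ‖mulOp hη (diffOp a (ext hΩ.measurableSet (e t)))‖ := by
    filter_upwards [h.flow_rule] with t ht a
    refine (norm_mulOp_diffOp_le_of_flowRule hΩ.measurableSet hη hκ hε ht a).trans ?_
    rw [hDdef, mul_assoc]
    exact mul_le_mul_of_nonneg_left (norm_mulOp_diffOp_stress_le hΩ.measurableSet hη lam mu _ a)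
      (inv_nonneg.2 hε.le)
  -- The elliptic estimate and the flow rule combine into a closed inequality, since both carry the
  -- same cut-off `η`.
  have hrate : ∀ᵐ t ∂volume.restrict (Ioo 0 T), ∀ i, ∀ s ∈ Ioo 0 (min d₁ d₂),
      ‖mulOp hη (diffOp (s • basisVec i) (ext hΩ.measurableSet (e' t)))‖ ≤
        s * m t + (K * D + 1) *
          ‖mulOp hη (diffOp (s • basisVec i) (ext hΩ.measurableSet (e t)))‖ := by
    filter_upwards [h.compat, h.equilibrium, hq] with t h1 h2 h3 i s hs
    have h4 := hint (v t) (e' t) (q t) (H1.fn (X t)) h1 h2 i s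
      ⟨hs.1, hs.2.trans_le (min_le_left _ _)⟩
    have h5 := hX (X t) i s ⟨hs.1, hs.2.trans_le (min_le_right _ _)⟩
    have h6 := h3 (s • basisVec i)
    rw [hmdef]
    exact rate_bound_aux hK (norm_nonneg (E := LR Sym2x2) _) h4 h5 h6
  obtain ⟨G, hG⟩ : ∃ G, G = (c + ∫ s in (0 : ℝ)..T, m s) * Real.exp ((K * D + 1) * T) := ⟨_, rfl⟩
  -- Grönwall's inequality from the initial strain. The constant `G` depends neither on the time nor
  -- on the step.
  have hy : ∀ t ∈ Icc 0 T, ∀ i, ∀ s ∈ Ioo 0 (min (min d₁ d₂) d₃),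
      ‖mulOp hη (diffOp (s • basisVec i) (ext hΩ.measurableSet (e t)))‖ ≤ s * G := by
    intro t ht i s hs
    rw [hG]
    refine norm_mulOp_diffOp_le_of_rate_le hΩ.measurableSet hT hη h.int_e h.eq_integral
      (hm.intervalIntegrable hT) hm0 hA hs.1.le
      (hc i s ⟨hs.1, hs.2.trans_le (min_le_right _ _)⟩) ?_ t ht
    exact hrate.mono fun t ht => ht i s ⟨hs.1, hs.2.trans_le (min_le_left _ _)⟩
  have hmG : MemLpTime 2 T (fun t => m t + ((K * D + 1) * |G| + D * |G|)) :=
    hm.add (memLpTime_const T _)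
  refine ⟨_, min (min d₁ d₂) d₃, hmG, lt_min (lt_min hd₁ hd₂) hd₃, ?_⟩
  filter_upwards [hrate, hq, ae_restrict_mem measurableSet_Ioo] with t h1 h2 ht i s hs
  exact rate_bound_aux' hA.le hD hs.1.le (hm0 t)
    (h1 i s ⟨hs.1, hs.2.trans_le (min_le_left _ _)⟩) (h2 (s • basisVec i))
    (hy t (Ioo_subset_Icc_self ht) i s hs)

theorem HasQuotientBound.congr {Y : Type} [NormedAddCommGroup Y] [InnerProductSpace ℝ Y]
    (hΩ : IsOpen Ω) {f g : ℝ → L2 Ω Y} (h : HasQuotientBound hΩ T f)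
    (hfg : ∀ᵐ t ∂volume.restrict (Ioo 0 T), g t = f t) : HasQuotientBound hΩ T g := by
  intro η hη
  obtain ⟨m, d, hm, hd, hb⟩ := h η hη
  refine ⟨m, d, hm, hd, ?_⟩
  filter_upwards [hb, hfg] with t h1 h2
  rw [h2]
  exact h1

theorem HasQuotientBound.add {Y : Type} [NormedAddCommGroup Y] [InnerProductSpace ℝ Y]
    (hΩ : IsOpen Ω) {f g : ℝ → L2 Ω Y} (hf : HasQuotientBound hΩ T f)
    (hg : HasQuotientBound hΩ T g) : HasQuotientBound hΩ T (fun t => f t + g t) := by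
  intro η hη
  obtain ⟨m, d, hm, hd, hb⟩ := hf η hη
  obtain ⟨m', d', hm', hd', hb'⟩ := hg η hη
  refine ⟨fun t => m t + m' t, min d d', MemLp.add hm hm', lt_min hd hd', ?_⟩
  filter_upwards [hb, hb'] with t h1 h2 i s hs
  rw [map_add, map_add, map_add, mul_add]
  exact norm_add_le_of_le (h1 i s ⟨hs.1, hs.2.trans_le (min_le_left _ _)⟩)
    (h2 i s ⟨hs.1, hs.2.trans_le (min_le_right _ _)⟩)

theorem HasQuotientBound.stress (hΩ : IsOpen Ω) (lam mu : ℝ) (hf : HasQuotientBound hΩ T e') :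
    HasQuotientBound hΩ T (fun t => stress lam mu (e' t)) := by
  intro η hη
  obtain ⟨m, d, hm, hd, hb⟩ := hf η hη
  refine ⟨fun t => ‖elasticity lam mu‖ * m t, d, MemLp.const_mul hm _, hd, ?_⟩
  filter_upwards [hb] with t h1 i s hs
  refine (norm_mulOp_diffOp_stress_le hΩ.measurableSet hη lam mu _ _).trans ?_
  have hl : 0 ≤ ‖elasticity lam mu‖ := ContinuousLinearMap.opNorm_nonneg _
  exact (mul_le_mul_of_nonneg_left (h1 i s hs) hl).trans (by linarith)

theorem stress_eq_integral (hT : 0 < T) (lam mu : ℝ) (he : IntervalIntegrable e' volume 0 T)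
    (h : ∀ t ∈ Icc 0 T, e t = e 0 + ∫ s in (0 : ℝ)..t, e' s) {t : ℝ} (ht : t ∈ Icc 0 T) :
    stress lam mu (e t) = stress lam mu (e 0) + ∫ s in (0 : ℝ)..t, stress lam mu (e' s) := by
  have hsub : uIcc 0 t ⊆ uIcc 0 T := by
    rw [uIcc_of_le hT.le, uIcc_of_le ht.1]
    exact Icc_subset_Icc_right ht.2
  have h1 := ContinuousLinearMap.intervalIntegral_comp_comm (E := L2 Ω Sym2x2)
    (F := L2 Ω Sym2x2) ((elasticity lam mu).compLpL 2 (volume.restrict Ω)) (he.mono_set hsub)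
  have h2 : stress lam mu (e 0 + ∫ s in (0 : ℝ)..t, e' s) = stress lam mu (e 0) +
      stress lam mu (∫ s in (0 : ℝ)..t, e' s) :=
    ((elasticity lam mu).compLpL 2 (volume.restrict Ω)).map_add _ _
  rw [h t ht, h2]
  exact congrArg (stress lam mu (e 0) + ·) h1.symm

end Solution

/-! ### Interior regularity of the strain, the stress, the plastic rate and the velocity. -/

section MainResult

attribute [local instance] normedAddCommGroupL2Sym normedSpaceL2Sym normedAddCommGroupH1
  normedSpaceH1 normedSpaceH2

variable {Ω : Set Plane} {T lam mu α κ ε : ℝ} {e : ℝ → L2 Ω Sym2x2} {w' v : ℝ → H1 Ω Plane}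
  {e' q : ℝ → L2 Ω Sym2x2} {X : ℝ → H1 Ω Sym2x2}

theorem IsRate.hasQuotientBound (hΩ : IsOpen Ω) (hb : Bornology.IsBounded Ω) (hT : 0 < T)
    (hmu : 0 < mu) (hlam : 0 < lam + mu) (hκ : 0 ≤ κ) (hε : 0 < ε)
    (h : IsRate Ω T lam mu α κ ε e w' v e' q X) (he₀ : MemH1Loc Ω (e 0)) :
    HasQuotientBound hΩ T e' ∧ HasQuotientBound hΩ T q := by
  constructor
  · intro η hη
    obtain ⟨m, d, hm, hd, hmd⟩ := h.exists_quotient_bound hΩ hb hT hmu hlam hκ hε he₀ hη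
    exact ⟨m, d, hm, hd, hmd.mono fun t ht i s hs => (ht i s hs).1⟩
  · intro η hη
    obtain ⟨m, d, hm, hd, hmd⟩ := h.exists_quotient_bound hΩ hb hT hmu hlam hκ hε he₀ hη
    exact ⟨m, d, hm, hd, hmd.mono fun t ht i s hs => (ht i s hs).2⟩

theorem memLpTime_stress (hf : MemLpTime 2 T e') :
    MemLpTime 2 T (fun t => stress lam mu (e' t)) :=
  MemLpTime.map (X := L2 Ω Sym2x2) (Z := L2 Ω Sym2x2) hf
    ((elasticity lam mu).compLpL 2 (volume.restrict Ω))

theorem exists_norm_mulOp_diffOp_stress_le (hΩ : IsOpen Ω) {η : Plane → ℝ}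
    (hη : IsTestFunction Ω η) {e₀ : L2 Ω Sym2x2} (he₀ : MemH1Loc Ω e₀) (lam mu : ℝ) :
    ∃ c d : ℝ, 0 < d ∧ ∀ i, ∀ h ∈ Ioo 0 d,
      ‖mulOp hη (diffOp (h • basisVec i) (ext hΩ.measurableSet (stress lam mu e₀)))‖ ≤ h * c := by
  obtain ⟨c, d, hd, hc⟩ := exists_norm_mulOp_diffOp_le_of_memH1Loc hΩ hη he₀
  refine ⟨‖elasticity lam mu‖ * c, d, hd, fun i h hh => ?_⟩
  refine (norm_mulOp_diffOp_stress_le hΩ.measurableSet hη lam mu _ _).trans ?_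
  have hl : 0 ≤ ‖elasticity lam mu‖ := ContinuousLinearMap.opNorm_nonneg _
  rw [mul_left_comm]
  exact mul_le_mul_of_nonneg_left (hc i h hh) hl

theorem IsRate.memH1TimeH1Loc_strain (hΩ : IsOpen Ω) (hb : Bornology.IsBounded Ω) (hT : 0 < T)
    (hmu : 0 < mu) (hlam : 0 < lam + mu) (hκ : 0 ≤ κ) (hε : 0 < ε)
    (h : IsRate Ω T lam mu α κ ε e w' v e' q X) (he₀ : MemH1Loc Ω (e 0)) :
    MemH1TimeH1Loc Ω T e :=
  memH1TimeH1Loc_of_hasQuotientBound hΩ hT (h.memLpTime hΩ hb hT hmu hlam hκ hε).2.1 h.eq_integral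
    (h.hasQuotientBound hΩ hb hT hmu hlam hκ hε he₀).1
    fun _ hη => exists_norm_mulOp_diffOp_le_of_memH1Loc hΩ hη he₀

theorem IsRate.memH1TimeH1Loc_stress (hΩ : IsOpen Ω) (hb : Bornology.IsBounded Ω) (hT : 0 < T)
    (hmu : 0 < mu) (hlam : 0 < lam + mu) (hκ : 0 ≤ κ) (hε : 0 < ε)
    (h : IsRate Ω T lam mu α κ ε e w' v e' q X) (he₀ : MemH1Loc Ω (e 0)) :
    MemH1TimeH1Loc Ω T (fun t => stress lam mu (e t)) :=
  memH1TimeH1Loc_of_hasQuotientBound hΩ hT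
    (memLpTime_stress (h.memLpTime hΩ hb hT hmu hlam hκ hε).2.1)
    (fun _ ht => stress_eq_integral hT lam mu h.int_e h.eq_integral ht)
    ((h.hasQuotientBound hΩ hb hT hmu hlam hκ hε he₀).1.stress hΩ lam mu)
    fun _ hη => exists_norm_mulOp_diffOp_stress_le hΩ hη he₀ lam mu

theorem IsRate.memL2TimeH1Loc_plastic (hΩ : IsOpen Ω) (hb : Bornology.IsBounded Ω) (hT : 0 < T)
    (hmu : 0 < mu) (hlam : 0 < lam + mu) (hκ : 0 ≤ κ) (hε : 0 < ε)
    (h : IsRate Ω T lam mu α κ ε e w' v e' q X) (he₀ : MemH1Loc Ω (e 0)) :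
    MemL2TimeH1Loc Ω T q :=
  memL2TimeH1Loc_of_hasQuotientBound hΩ (h.memLpTime hΩ hb hT hmu hlam hκ hε).2.2
    (h.hasQuotientBound hΩ hb hT hmu hlam hκ hε he₀).2

/-- The symmetrized gradient of the velocity is `e' + q`, so the quotient bounds of the two rates
add up. -/
theorem IsRate.memL2TimeH2Loc_velocity (hΩ : IsOpen Ω) (hb : Bornology.IsBounded Ω) (hT : 0 < T)
    (hmu : 0 < mu) (hlam : 0 < lam + mu) (hκ : 0 ≤ κ) (hε : 0 < ε)
    (h : IsRate Ω T lam mu α κ ε e w' v e' q X) (he₀ : MemH1Loc Ω (e 0)) :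
    MemL2TimeH2Loc Ω T (fun t => H1.fn (v t)) := by
  obtain ⟨h1, h2⟩ := h.hasQuotientBound hΩ hb hT hmu hlam hκ hε he₀
  exact memL2TimeH2Loc_of_hasQuotientBound hΩ (h.memLpTime hΩ hb hT hmu hlam hκ hε).1
    ((h1.add hΩ h2).congr hΩ h.compat)

theorem MemL2TimeH1Loc.congr {Y : Type} [NormedAddCommGroup Y] [InnerProductSpace ℝ Y]
    [CompleteSpace Y] {f g : ℝ → L2 Ω Y} (h : MemL2TimeH1Loc Ω T f)
    (hfg : ∀ᵐ t ∂volume.restrict (Ioo 0 T), g t = f t) : MemL2TimeH1Loc Ω T g := by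
  intro Ω' hΩ'
  obtain ⟨k, hk, hkf⟩ := h Ω' hΩ'
  refine ⟨k, hk, ?_⟩
  filter_upwards [hkf, hfg] with t h1 h2
  rw [h2]
  exact h1

theorem MemL2TimeH2Loc.congr {Y : Type} [NormedAddCommGroup Y] [InnerProductSpace ℝ Y]
    [CompleteSpace Y] {f g : ℝ → L2 Ω Y} (h : MemL2TimeH2Loc Ω T f)
    (hfg : ∀ᵐ t ∂volume.restrict (Ioo 0 T), g t = f t) : MemL2TimeH2Loc Ω T g := by
  intro Ω' hΩ'
  obtain ⟨k, hk, hkf⟩ := h Ω' hΩ'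
  refine ⟨k, hk, ?_⟩
  filter_upwards [hkf, hfg] with t h1 h2
  rw [h2]
  exact h1

end MainResult

end Perzyna

end

theorem proposition3p4
    -- the reference configuration and the time interval
    (Ω : Set Plane) (hΩo : IsOpen Ω) (hΩc : IsConnected Ω) (hΩb : Bornology.IsBounded Ω)
    (hΩL : HasLipschitzBoundary Ω) (T : ℝ) (hT : 0 < T)
    -- Lamé coefficients, elasticity set, viscosity
    (lam mu α κ ε : ℝ) (hmu : 0 < mu) (hlam : 0 < lam + mu) (hα : 0 < α) (hκ : 0 < κ)
    (hε : 0 < ε)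
    -- boundary displacement
    (w : ℝ → H1 Ω Plane) (hw : AbsolutelyContinuousOnInterval w 0 T)
    -- body load and safe-load condition
    (f : ℝ → L2 Ω Plane) (hf : AbsolutelyContinuousOnInterval f 0 T)
    (χ : ℝ → L2 Ω Sym2x2) (hχ : AbsolutelyContinuousOnInterval χ 0 T)
    (hsafe : IsSafeLoad Ω T α κ f χ)
    -- initial datum
    (u₀ : H1 Ω Plane) (e₀ p₀ : L2 Ω Sym2x2) (hadm : IsAdmissible Ω (w 0) u₀ e₀ p₀)
    (hσ₀ : ∀ᵐ x ∂volume.restrict Ω, stress lam mu e₀ x ∈ elasticitySet α κ)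
    (hσ₀f : HasWeakDiv Ω (stress lam mu e₀) (-f 0))
    -- extra regularity of the data
    (hw' : MemH1TimeH2 Ω T w)
    (hχ' : MemW1InfLInf Ω T χ) (hχ'' : MemH1TimeH1 Ω T χ)
    (hf' : MemLpTimeH1 ∞ Ω T f)
    (he₀ : MemH1Loc Ω e₀)
    -- the visco-plastic solution
    (u : ℝ → H1 Ω Plane) (e p : ℝ → L2 Ω Sym2x2)
    (hsol : IsViscoplasticSolution Ω T lam mu α κ ε w f u₀ e₀ p₀ u e p) :
    MemL2TimeH2Loc Ω T (fun t => H1.fn (deriv u t)) ∧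
    MemH1TimeH1Loc Ω T e ∧
    MemH1TimeH1Loc Ω T (fun t => stress lam mu (e t)) ∧
    MemL2TimeH1Loc Ω T (deriv p) := by
  obtain ⟨w', v, e', q, X, hr, hu, hp⟩ := hsol.exists_isRate hT hsafe hw' hχ''
  have he : MemH1Loc Ω (e 0) := by
    rw [hsol.init_e]
    exact he₀
  refine ⟨?_, hr.memH1TimeH1Loc_strain hΩo hΩb hT hmu hlam hκ.le hε he,
    hr.memH1TimeH1Loc_stress hΩo hΩb hT hmu hlam hκ.le hε he,
    (hr.memL2TimeH1Loc_plastic hΩo hΩb hT hmu hlam hκ.le hε he).congr hp⟩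
  refine (hr.memL2TimeH2Loc_velocity hΩo hΩb hT hmu hlam hκ.le hε he).congr ?_
  exact hu.mono fun t ht => congrArg H1.fn ht
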